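/- **Setting.** Let $(S,A,P,r,u,b,\gamma,\rho)$ be a constrained Markov decision process with finite $S,A$, transition kernel $P$, $r,u:S\times A\to[0,1]$, $\gamma\in[0,1)$, $b\in(0,1/(1-\gamma)]$ and initial distribution $\rho$. For a stationary stochastic policy $\pi$ (write $\Pi$ for the set of these) and $c:S\times A\to\mathbb R$ let $V_c^\pi(\rho)=\mathbb E[\sum_t\gamma^tc(s_t,a_t)]$ with $s_0\sim\rho$, and let $Q_c^\pi(s,a)$ be the same expectation given $(s_0,a_0)=(s,a)$; let $d_\rho^\pi(s)=(1-\gamma)\sum_t\gamma^t\Pr(s_t=s)$. Put $g=u-(1-\gamma)b$. Let $\pi^\star$ be any maximizer of $V_r^\pi(\rho)$ over $\pi\in\Pi$ with $V_g^\pi(\rho)\ge0$. Assume that $V_g^{\bar\pi}(\rho)\ge\xi$ for some $\bar\pi\in\Pi$ and some $\xi>0$. For $\delta\in(0,\xi)$ put $g'=g-(1-\gamma)\delta$, $\xi'=\xi-\delta$, $\Lambda'=[0,1/((1-\gamma)\xi')]$, and $\hat\Delta_{\epsilon_0}=\{p\in\Delta(A):p_a\ge\epsilon_0/|A|\ \forall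 a\}$. "Problem-dependent" means independent of $\epsilon$, of the iteration count and of the iterates. **Algorithms, run with $g'$ and $\Lambda'$.** *RPG-PD* ($\eta,\tau,\epsilon_0$): from any $\pi_0(\cdot|s)\in\hat\Delta_{\epsilon_0}$, $\lambda_0\in\Lambda'$, $$\pi_{t+1}(\cdot|s)=\arg\max_{p\in\hat\Delta_{\epsilon_0}}\Big\{\sum_ap_aQ^{\pi_t}_{r+\lambda_tg'-\tau\log\pi_t}(s,a)-\tfrac1\eta\mathrm{KL}(p,\pi_t(\cdot|s))\Big\},$$ $$\lambda_{t+1}=\arg\min_{\lambda\in\Lambda'}\Big\{\lambda\big(V_{g'}^{\pi_t}(\rho)+\tau\lambda_t\big)+\tfrac1{2\eta}(\lambda-\lambda_t)^2\Big\}.$$ *Inexact RPG-PD*: given features $\phi_{s,a}\in\mathbb R^d$, $\|\phi_{s,a}\|\le1$, a bound $W>0$, a distribution $\nu$ on $S\times A$ and $\theta_0\in\mathbb R^d$, start from the log-linear policy $\pi_0(a|s)\propto\exp(\phi_{s,a}^\top\theta_0)$ (assumed to lie in $\hat\Delta_{\epsilon_0}$) and any $\lambda_0\in\Lambda'$, and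 replace $Q^{\pi_t}_{r+\lambda_tg'-\tau\log\pi_t}(s,a)$ in the policy update by $\phi_{s,a}^\top w_t$ with random $w_t$, $\|w_t\|\le W$. With $\mathcal E_t(w,\mu)=\mathbb E_{(s,a)\sim\mu}[(\phi_{s,a}^\top w-Q^{\pi_t}_{r+\lambda_tg'-\tau\log\pi_t}(s,a))^2]$, $d_{t,\nu}(s,a)=(1-\gamma)\mathbb E_{(s_0,a_0)\sim\nu}\sum_k\gamma^k\Pr(s_k=s,a_k=a\,|\,\pi_t,s_0,a_0)$, $w_t^\star\in\arg\min_{w\in\mathbb R^d}\mathcal E_t(w,d_{t,\nu})$, $(\pi_\tau^\star,\lambda_\tau^\star)$ a saddle point of $V^\pi_{r+\lambda g'}(\rho)+\tau(\mathbb E_\pi[\sum_t-\gamma^t\log\pi(a_t|s_t)]+\frac12\lambda^2)$ over $\Pi\times\Lambda'$ and $\nu^\star(s,a)=d_\rho^{\pi_\tau^\star}(s)/|A|$, assume for all $t$ that $\mathbb E[\mathcal E_t(w_t,d_{t,\nu})-\mathcal E_t(w_t^\star,d_{t,\nu})]\le\epsilon_{\rm stat}$ and $\mathbb E[\mathcal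 E_t(w_t^\star,\nu^\star)]\le\epsilon_{\rm bias}$ (with these quantities integrable), and that the relative condition number $\sup_w\frac{w^\top\Sigma_{\nu^\star}w}{w^\top\Sigma_\nu w}$ is finite, where $\Sigma_\mu=\mathbb E_\mu[\phi\phi^\top]$. *OPG-PD* ($\eta$): from any $\hat\pi_0=\pi_0\in\Pi$, $\hat\lambda_0=\lambda_0\in\Lambda'$, for $t\ge0$, $$\hat\pi_{t+1}(\cdot|s)=\arg\max_{p\in\Delta(A)}\Big\{\sum_ap_aQ^{\pi_t}_{r+\lambda_tg'}(s,a)-\tfrac1{2\eta}\|p-\hat\pi_t(\cdot|s)\|_2^2\Big\},\quad \hat\lambda_{t+1}=\arg\min_{\lambda\in\Lambda'}\Big\{\lambda V_{g'}^{\pi_t}(\rho)+\tfrac1{2\eta}(\lambda-\hat\lambda_t)^2\Big\},$$ and $\pi_{t+1},\lambda_{t+1}$ are given by the same formulas with $\hat\pi_t,\hat\lambda_t$ replaced by $\hat\pi_{t+1},\hat\lambda_{t+1}$ in the quadratic terms. **Claims.** 1. (RPG-PD) For all constants $0<a_1\le a_2$, $0<b_1\le b_2$, $c>0$ there are problem-dependent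 $K,C,\bar\epsilon>0$ such that for every $\epsilon\in(0,\bar\epsilon)$ there is $\delta\in(0,\xi)$ such that, for all $\eta\in[a_1\epsilon^4,a_2\epsilon^4]$, $\tau\in[b_1\epsilon^2,b_2\epsilon^2]$, $\epsilon_0=c\epsilon$ and all initial points, the iterates of RPG-PD satisfy $$V_r^{\pi^\star}(\rho)-V_r^{\pi_t}(\rho)\le K\epsilon\quad\text{and}\quad V_g^{\pi_t}(\rho)\ge0\qquad\text{for all }t\ge C\,\epsilon^{-6}\log^2(1/\epsilon).$$ Moreover, for suitable $a_1=a_2$, $b_1=b_2$ and $c$ this holds with $K=1$. 2. (Inexact RPG-PD) For all constants $0<a_1\le a_2$, $0<b_1\le b_2$, $c>0$ there are $K,C,\bar\epsilon>0$, depending only on the problem, $\phi,W,\nu,\theta_0$ and these constants, such that for every $\epsilon\in(0,\bar\epsilon)$ there is $\delta\in(0,\xi)$ such that for all sufficiently small $\epsilon_0>0$ (depending on $\epsilon$), all $\eta\in[a_1\epsilon^4,a_2\epsilon^4]$, $\tau\in[b_1\epsilon^2,b_2\epsilon^2]$ and $0<\epsilon_{\rm stat},\epsilon_{\rm bias}\le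 c\,\epsilon^8$, the iterates of inexact RPG-PD satisfy $$\mathbb E[V_r^{\pi^\star}(\rho)-V_r^{\pi_t}(\rho)]\le K\epsilon\quad\text{and}\quad\mathbb E[-V_g^{\pi_t}(\rho)]\le0\qquad\text{for all }t\ge C\,\epsilon^{-6}\log^2(1/\epsilon).$$ Moreover, for suitable $a_1=a_2$, $b_1=b_2$ and $c$ this holds with $K=1$. 3. (OPG-PD) Assume in addition that $\rho_{\min}=\min_s\rho(s)>0$ and that $d_\rho^{\pi}$ is the same for all optimal constrained policies $\pi$. Put $\kappa_\rho=\sup_{\pi\in\Pi}\max_sd_\rho^\pi(s)/\rho(s)$, $$\iota(\xi)=\frac{2\kappa_\rho^2|A|}{(1-\gamma)^6}+\frac{8\gamma^2|A|^2}{(1-\gamma)^6\rho_{\min}}\Big(1+\frac1{(1-\gamma)^2\xi^2}\Big)+\frac{4|A|}{(1-\gamma)^3},\qquad \bar\eta(\xi)=\min\Big(\frac1{4\sqrt{\iota(\xi)}},\frac{(1-\gamma)^3}{4|A|},\frac{(1-\gamma)^3}{2\kappa_\rho}\Big).$$ For every $0<\eta<\bar\eta(\xi)$ there are $C,\bar\epsilon>0$,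 depending only on the problem and $\eta$, such that for every $\epsilon\in(0,\bar\epsilon)$ there is $\delta\in(0,\xi)$ with $\eta\le\bar\eta(\xi-\delta)$ such that, from all initial points, the iterates of OPG-PD satisfy $$V_r^{\pi^\star}(\rho)-V_r^{\hat\pi_t}(\rho)\le\epsilon\quad\text{and}\quad V_g^{\hat\pi_t}(\rho)\ge0\qquad\text{for all }t\ge C\log^2(1/\epsilon).$$ -/

import Mathlib

open MeasureTheory

universe uS uA uΩ

noncomputable section

/-- A finite discounted constrained Markov decision process
`CMDP(S, A, P, r, u, b, γ, ρ)`. -/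
structure CMDP (S : Type uS) (A : Type uA) [Fintype S] [Fintype A] where
  /-- `P s a s'` is the probability of moving to `s'` from `s` under action `a`. -/
  P : S → A → S → ℝ
  P_mem : ∀ s a, P s a ∈ stdSimplex ℝ S
  /-- reward -/
  r : S → A → ℝ
  r_mem : ∀ s a, r s a ∈ Set.Icc (0 : ℝ) 1
  /-- utility -/
  u : S → A → ℝ
  u_mem : ∀ s a, u s a ∈ Set.Icc (0 : ℝ) 1
  /-- discount factor -/
  γ : ℝ
  γ_mem : γ ∈ Set.Ico (0 : ℝ) 1
  /-- constraint threshold -/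
  b : ℝ
  b_mem : b ∈ Set.Ioc (0 : ℝ) (1 / (1 - γ))
  /-- initial state distribution -/
  ρ : S → ℝ
  ρ_mem : ρ ∈ stdSimplex ℝ S

/-- The set `Π` of stationary stochastic policies; `π s a` is `π(a | s)`. -/
def policies (S : Type uS) (A : Type uA) [Fintype A] : Set (S → A → ℝ) :=
  {π | ∀ s, π s ∈ stdSimplex ℝ A}

/-- The restricted probability simplex: every action has probability at least `ε₀ / |A|`. -/
def restrictedSimplex (A : Type uA) [Fintype A] (ε₀ : ℝ) : Set (A → ℝ) :=
  {p | p ∈ stdSimplex ℝ A ∧ ∀ a, ε₀ / (Fintype.card A : ℝ) ≤ p a}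

/-- The Kullback-Leibler divergence of two probability vectors. -/
def klVec {A : Type uA} [Fintype A] (p q : A → ℝ) : ℝ :=
  ∑ a, p a * Real.log (p a / q a)

namespace CMDP

variable {S : Type uS} {A : Type uA} [Fintype S] [Fintype A] (M : CMDP S A)

/-- The law of `(s_t, a_t)` when `(s_0, a_0)` has law `μ`, `s_{t+1} ∼ P(· | s_t, a_t)` and
`a_{t+1} ∼ π(· | s_{t+1})`. -/
def law (π : S → A → ℝ) (μ : S × A → ℝ) : ℕ → S × A → ℝ
  | 0 => μ
  | t + 1 => fun x => ∑ y : S × A, law π μ t y * M.P y.1 y.2 x.1 * π x.1 x.2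

/-- `E [∑_t γ^t c(s_t, a_t)]` when `(s_0, a_0)` has law `μ` and `π` is followed afterwards. -/
def discountedSum (π : S → A → ℝ) (μ : S × A → ℝ) (c : S → A → ℝ) : ℝ :=
  ∑' t : ℕ, M.γ ^ t * ∑ x : S × A, M.law π μ t x * c x.1 x.2

/-- The law of `(s_0, a_0)` when `s_0 ∼ ρ` and `a_0 ∼ π(· | s_0)`. -/
def start (π : S → A → ℝ) : S × A → ℝ := fun x => M.ρ x.1 * π x.1 x.2

/-- The value `V_c^π(ρ)` of the policy `π` for the per-step function `c`. -/
def V (c : S → A → ℝ) (π : S → A → ℝ) : ℝ := M.discountedSum π (M.start π) c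

/-- The state-action value function `Q_c^π(s, a)`. -/
def Q (c : S → A → ℝ) (π : S → A → ℝ) (s : S) (a : A) : ℝ :=
  M.discountedSum π (Set.indicator {(s, a)} (fun _ => (1 : ℝ))) c

/-- The discounted state-action visitation distribution
`(1 - γ) E_{(s_0, a_0) ∼ μ} ∑_t γ^t Pr(s_t = s, a_t = a)`. -/
def saVisit (π : S → A → ℝ) (μ : S × A → ℝ) (x : S × A) : ℝ :=
  (1 - M.γ) * ∑' t : ℕ, M.γ ^ t * M.law π μ t x

/-- The discounted state visitation distribution `d_ρ^π`. -/
def dρ (π : S → A → ℝ) (s : S) : ℝ := ∑ a, M.saVisit π (M.start π) (s, a)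

/-- The constraint function `g = u - (1 - γ) b`. -/
def g : S → A → ℝ := fun s a => M.u s a - (1 - M.γ) * M.b

/-- The tightened constraint function `g' = g - (1 - γ) δ`. -/
def gTight (δ : ℝ) : S → A → ℝ := fun s a => M.g s a - (1 - M.γ) * δ

/-- `π` is an optimal constrained policy: it maximizes `V_r^π(ρ)` over `π ∈ Π` subject to
`V_g^π(ρ) ≥ 0`. -/
def IsOptimal (π : S → A → ℝ) : Prop :=
  π ∈ policies S A ∧ 0 ≤ M.V M.g π ∧
    ∀ π' ∈ policies S A, 0 ≤ M.V M.g π' → M.V M.r π' ≤ M.V M.r π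

/-- The dual interval `Λ = [0, 1 / ((1 - γ) ξ)]` for the slack `ξ`. -/
def Λ (ξ : ℝ) : Set ℝ := Set.Icc 0 (1 / ((1 - M.γ) * ξ))

/-- The per-step function `r + lam * h`, for a constraint function `h`. -/
def lagr (h : S → A → ℝ) (lam : ℝ) : S → A → ℝ := fun s a => M.r s a + lam * h s a

/-- The per-step function `r + lam * h + τ ψ` with `ψ(s, a) = - log π(a | s)`. -/
def regLagr (h : S → A → ℝ) (τ lam : ℝ) (π : S → A → ℝ) : S → A → ℝ :=
  fun s a => M.r s a + lam * h s a + τ * (-Real.log (π s a))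

/-- `H(π) = E [∑_t - γ^t log π(a_t | s_t)]`. -/
def entropy (π : S → A → ℝ) : ℝ := M.V (fun s a => -Real.log (π s a)) π

/-- The regularized Lagrangian `L_τ(π, lam)` for the constraint function `h`. -/
def L (h : S → A → ℝ) (τ : ℝ) (π : S → A → ℝ) (lam : ℝ) : ℝ :=
  M.V (M.lagr h lam) π + τ * (M.entropy π + lam ^ 2 / 2)

/-- `(π, lam)` is a saddle point of the regularized Lagrangian over `Π × Λ`. -/
def IsRegSaddle (h : S → A → ℝ) (ξ τ : ℝ) (π : S → A → ℝ) (lam : ℝ) : Prop :=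
  π ∈ policies S A ∧ lam ∈ M.Λ ξ ∧
    (∀ π' ∈ policies S A, M.L h τ π' lam ≤ M.L h τ π lam) ∧
    (∀ lam' ∈ M.Λ ξ, M.L h τ π lam ≤ M.L h τ π lam')

/-! ### The three algorithms -/

/-- A mirror step over the restricted simplex, in every state, along the direction `D`. -/
def KLStep (η ε₀ : ℝ) (D : S → A → ℝ) (π π' : S → A → ℝ) : Prop :=
  ∀ s, π' s ∈ restrictedSimplex A ε₀ ∧
    IsMaxOn (fun p : A → ℝ => ∑ a, p a * D s a - 1 / η * klVec p (π s))
      (restrictedSimplex A ε₀) (π' s)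

/-- The dual step `lam' = argmin_{x ∈ Λ} { x (V_h^π(ρ) + τ lam) + (x - lam)² / (2η) }`. -/
def DualStep (h : S → A → ℝ) (ξ τ η : ℝ) (π : S → A → ℝ) (lam lam' : ℝ) : Prop :=
  lam' ∈ M.Λ ξ ∧
    IsMinOn (fun x : ℝ => x * (M.V h π + τ * lam) + 1 / (2 * η) * (x - lam) ^ 2)
      (M.Λ ξ) lam'

/-- The iterates `(π_t, lam_t)` of RPG-PD for the constraint function `h` and slack `ξ`, from an
arbitrary initial point. -/
structure IsRPG (h : S → A → ℝ) (ξ τ η ε₀ : ℝ) (π : ℕ → S → A → ℝ) (lam : ℕ → ℝ) : Prop where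
  init_π : ∀ s, π 0 s ∈ restrictedSimplex A ε₀
  init_lam : lam 0 ∈ M.Λ ξ
  step_π : ∀ t, KLStep η ε₀ (M.Q (M.regLagr h τ (lam t) (π t)) (π t)) (π t) (π (t + 1))
  step_lam : ∀ t, M.DualStep h ξ τ η (π t) (lam t) (lam (t + 1))

/-- A projected step over the simplex, in every state, from `π` along the direction `D`. -/
def ProjStep (η : ℝ) (D : S → A → ℝ) (π π' : S → A → ℝ) : Prop :=
  ∀ s, π' s ∈ stdSimplex ℝ A ∧
    IsMaxOn (fun p : A → ℝ => ∑ a, p a * D s a - 1 / (2 * η) * ∑ a, (p a - π s a) ^ 2)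
      (stdSimplex ℝ A) (π' s)

/-- The iterates of OPG-PD for the constraint function `h` and slack `ξ`, from an arbitrary initial
point; `πh`, `lamh` are the sequences written with a hat. -/
structure IsOPG (h : S → A → ℝ) (ξ η : ℝ) (π πh : ℕ → S → A → ℝ) (lam lamh : ℕ → ℝ) :
    Prop where
  init_π : π 0 ∈ policies S A
  init_lam : lam 0 ∈ M.Λ ξ
  init_πh : πh 0 = π 0
  init_lamh : lamh 0 = lam 0
  step_π : ∀ t, ProjStep η (M.Q (M.lagr h (lam t)) (π t)) (πh (t + 1)) (π (t + 1))
  step_πh : ∀ t, ProjStep η (M.Q (M.lagr h (lam t)) (π t)) (πh t) (πh (t + 1))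
  step_lam : ∀ t, lam (t + 1) ∈ M.Λ ξ ∧
    IsMinOn (fun x : ℝ => x * M.V h (π t) + 1 / (2 * η) * (x - lamh (t + 1)) ^ 2)
      (M.Λ ξ) (lam (t + 1))
  step_lamh : ∀ t, lamh (t + 1) ∈ M.Λ ξ ∧
    IsMinOn (fun x : ℝ => x * M.V h (π t) + 1 / (2 * η) * (x - lamh t) ^ 2)
      (M.Λ ξ) (lamh (t + 1))

/-! ### Linear function approximation -/

section Features

variable {d : ℕ} (φ : S → A → EuclideanSpace ℝ (Fin d))

/-- The log-linear policy with parameter `θ`. -/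
def logLinear (θ : EuclideanSpace ℝ (Fin d)) : S → A → ℝ :=
  fun s a => Real.exp (inner ℝ (φ s a) θ) / ∑ a', Real.exp (inner ℝ (φ s a') θ)

/-- The compatible function approximation error `E_{(s,a) ∼ μ} [(φ_{s,a}ᵀ w - q(s,a))²]`. -/
def approxError (w : EuclideanSpace ℝ (Fin d)) (q : S → A → ℝ) (μ : S × A → ℝ) : ℝ :=
  ∑ x : S × A, μ x * (inner ℝ (φ x.1 x.2) w - q x.1 x.2) ^ 2

/-- The quadratic form `wᵀ Σ_μ w` of the covariance `Σ_μ = E_{(s,a) ∼ μ} [φ_{s,a} φ_{s,a}ᵀ]`. -/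
def covForm (μ : S × A → ℝ) (w : EuclideanSpace ℝ (Fin d)) : ℝ :=
  ∑ x : S × A, μ x * (inner ℝ (φ x.1 x.2) w) ^ 2

/-- The relative condition number `sup_w (wᵀ Σ_{μ'} w) / (wᵀ Σ_μ w)`, possibly infinite
(with `0 / 0 = 0` and `x / 0 = ∞` for `x > 0`). -/
def relCond (μ' μ : S × A → ℝ) : ENNReal :=
  ⨆ w : EuclideanSpace ℝ (Fin d),
    ENNReal.ofReal (covForm φ μ' w) / ENNReal.ofReal (covForm φ μ w)

/-- The distribution `ν⋆(s, a) = d_ρ^π(s) Unif_A(a)`. -/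
def nuStar (π : S → A → ℝ) : S × A → ℝ :=
  fun x => M.dρ π x.1 * (1 / (Fintype.card A : ℝ))

/-- The iterates of inexact RPG-PD, for the constraint function `h` and slack `ξ`, driven by the
random directions `w t` with `‖w t‖ ≤ W`, and started at the log-linear policy with parameter
`θ₀`. -/
structure IsInexactRPG (W : ℝ) (θ₀ : EuclideanSpace ℝ (Fin d))
    (h : S → A → ℝ) (ξ τ η ε₀ : ℝ) {Ω : Type uΩ} [MeasurableSpace Ω]
    (w : ℕ → Ω → EuclideanSpace ℝ (Fin d))
    (π : ℕ → Ω → S → A → ℝ) (lam : ℕ → Ω → ℝ) : Prop where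
  meas_w : ∀ t, Measurable (w t)
  meas_π : ∀ t s a, Measurable fun ω => π t ω s a
  meas_lam : ∀ t, Measurable (lam t)
  norm_w : ∀ t ω, ‖w t ω‖ ≤ W
  init_π : ∀ ω, π 0 ω = logLinear φ θ₀
  init_mem : ∀ ω s, π 0 ω s ∈ restrictedSimplex A ε₀
  init_lam : ∃ lam₀ ∈ M.Λ ξ, ∀ ω, lam 0 ω = lam₀
  step_π : ∀ t ω, KLStep η ε₀ (fun s a => inner ℝ (φ s a) (w t ω)) (π t ω) (π (t + 1) ω)
  step_lam : ∀ t ω, M.DualStep h ξ τ η (π t ω) (lam t ω) (lam (t + 1) ω)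

/-- Bounded statistical error, bounded transfer error and finite relative condition number, along
the iterates of inexact RPG-PD. Here `wstar t` minimizes the approximation error over `ℝ^d` under
the on-policy distribution started from `ν`, and `πτ` is the primal part of the regularized saddle
point. -/
structure BoundedErrors (ν : S × A → ℝ) (h : S → A → ℝ) (τ εstat εbias : ℝ)
    (πτ : S → A → ℝ) {Ω : Type uΩ} [MeasurableSpace Ω] (Pr : Measure Ω)
    (w wstar : ℕ → Ω → EuclideanSpace ℝ (Fin d))
    (π : ℕ → Ω → S → A → ℝ) (lam : ℕ → Ω → ℝ) : Prop where
  minimizer : ∀ t ω (v : EuclideanSpace ℝ (Fin d)),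
    approxError φ (wstar t ω) (M.Q (M.regLagr h τ (lam t ω) (π t ω)) (π t ω))
        (M.saVisit (π t ω) ν)
      ≤ approxError φ v (M.Q (M.regLagr h τ (lam t ω) (π t ω)) (π t ω))
        (M.saVisit (π t ω) ν)
  integrable_stat : ∀ t, Integrable (fun ω =>
    approxError φ (w t ω) (M.Q (M.regLagr h τ (lam t ω) (π t ω)) (π t ω))
        (M.saVisit (π t ω) ν)
      - approxError φ (wstar t ω) (M.Q (M.regLagr h τ (lam t ω) (π t ω)) (π t ω))
        (M.saVisit (π t ω) ν)) Pr
  stat : ∀ t, ∫ ω,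
    (approxError φ (w t ω) (M.Q (M.regLagr h τ (lam t ω) (π t ω)) (π t ω))
        (M.saVisit (π t ω) ν)
      - approxError φ (wstar t ω) (M.Q (M.regLagr h τ (lam t ω) (π t ω)) (π t ω))
        (M.saVisit (π t ω) ν)) ∂Pr ≤ εstat
  integrable_bias : ∀ t, Integrable (fun ω =>
    approxError φ (wstar t ω) (M.Q (M.regLagr h τ (lam t ω) (π t ω)) (π t ω))
      (M.nuStar πτ)) Pr
  bias : ∀ t, ∫ ω,
    approxError φ (wstar t ω) (M.Q (M.regLagr h τ (lam t ω) (π t ω)) (π t ω))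
      (M.nuStar πτ) ∂Pr ≤ εbias
  relCond_lt_top : relCond φ (M.nuStar πτ) ν < ⊤

end Features

/-! ### The stepsize threshold of OPG-PD -/

/-- `ρ_min = min_s ρ(s)`. -/
def ρmin : ℝ := ⨅ s, M.ρ s

/-- The distribution mismatch coefficient `κ_ρ = sup_π ‖d_ρ^π / ρ‖_∞`. -/
def κρ : ℝ := sSup {x : ℝ | ∃ π ∈ policies S A, ∃ s, x = M.dρ π s / M.ρ s}

/-- The constant `ι` of the stepsize threshold. -/
def iota (ξ : ℝ) : ℝ :=
  2 * M.κρ ^ 2 * (Fintype.card A : ℝ) / (1 - M.γ) ^ 6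
    + 8 * M.γ ^ 2 * (Fintype.card A : ℝ) ^ 2 / ((1 - M.γ) ^ 6 * M.ρmin)
        * (1 + 1 / ((1 - M.γ) ^ 2 * ξ ^ 2))
    + 4 * (Fintype.card A : ℝ) / (1 - M.γ) ^ 3

/-- The stepsize threshold `min (1 / (4 √ι), (1-γ)³ / (4 |A|), (1-γ)³ / (2 κ_ρ))`. -/
def opgThreshold (ξ : ℝ) : ℝ :=
  min (1 / (4 * Real.sqrt (M.iota ξ)))
    (min ((1 - M.γ) ^ 3 / (4 * (Fintype.card A : ℝ))) ((1 - M.γ) ^ 3 / (2 * M.κρ)))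

/-! ### Zero constraint violation -/

/-- Zero violation of RPG-PD: for all small `ε` there is a margin `δ` such that RPG-PD for the
tightened constraint, with `η ∈ [a₁ ε⁴, a₂ ε⁴]`, `τ ∈ [b₁ ε², b₂ ε²]` and `ε₀ = c ε`, from every
initial point, has reward gap at most `K ε` and no violation for every `t ≥ C ε⁻⁶ log² (1/ε)`. -/
def RPGZeroViolation (ξ K a₁ a₂ b₁ b₂ c : ℝ) : Prop :=
  ∃ C > 0, ∃ εbar > 0, ∀ ε : ℝ, 0 < ε → ε < εbar →
    ∃ δ : ℝ, 0 < δ ∧ δ < ξ ∧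
      ∀ η τ : ℝ, η ∈ Set.Icc (a₁ * ε ^ 4) (a₂ * ε ^ 4) → τ ∈ Set.Icc (b₁ * ε ^ 2) (b₂ * ε ^ 2) →
      ∀ (π : ℕ → S → A → ℝ) (lam : ℕ → ℝ),
        M.IsRPG (M.gTight δ) (ξ - δ) τ η (c * ε) π lam →
        ∀ t : ℕ, C * (1 / ε ^ 6 * Real.log (1 / ε) ^ 2) ≤ t →
          (∀ πstar, M.IsOptimal πstar → M.V M.r πstar - M.V M.r (π t) ≤ K * ε) ∧
            0 ≤ M.V M.g (π t)

/-- Zero violation of inexact RPG-PD, in expectation: as for RPG-PD, with statistical and transfer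
errors at most `c ε⁸`, and for all small `ε₀`. -/
def InexactZeroViolation {d : ℕ} (φ : S → A → EuclideanSpace ℝ (Fin d)) (W : ℝ)
    (ν : S × A → ℝ) (θ₀ : EuclideanSpace ℝ (Fin d)) (ξ K a₁ a₂ b₁ b₂ c : ℝ) : Prop :=
  ∃ C > 0, ∃ εbar > 0, ∀ ε : ℝ, 0 < ε → ε < εbar →
    ∃ δ : ℝ, 0 < δ ∧ δ < ξ ∧ ∃ ε₀bar > 0, ∀ ε₀ : ℝ, 0 < ε₀ → ε₀ < ε₀bar →
      ∀ η τ : ℝ, η ∈ Set.Icc (a₁ * ε ^ 4) (a₂ * ε ^ 4) → τ ∈ Set.Icc (b₁ * ε ^ 2) (b₂ * ε ^ 2) →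
      ∀ εstat εbias : ℝ, 0 < εstat → εstat ≤ c * ε ^ 8 → 0 < εbias → εbias ≤ c * ε ^ 8 →
      ∀ (Ω : Type uΩ) [MeasurableSpace Ω] (Pr : Measure Ω) [IsProbabilityMeasure Pr]
        (w wstar : ℕ → Ω → EuclideanSpace ℝ (Fin d))
        (π : ℕ → Ω → S → A → ℝ) (lam : ℕ → Ω → ℝ) (πτ : S → A → ℝ) (lamτ : ℝ),
        M.IsRegSaddle (M.gTight δ) (ξ - δ) τ πτ lamτ →
        M.IsInexactRPG φ W θ₀ (M.gTight δ) (ξ - δ) τ η ε₀ w π lam →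
        M.BoundedErrors φ ν (M.gTight δ) τ εstat εbias πτ Pr w wstar π lam →
        ∀ t : ℕ, C * (1 / ε ^ 6 * Real.log (1 / ε) ^ 2) ≤ t →
          (∀ πstar, M.IsOptimal πstar →
            ∫ ω, (M.V M.r πstar - M.V M.r (π t ω)) ∂Pr ≤ K * ε) ∧
          ∫ ω, -M.V M.g (π t ω) ∂Pr ≤ 0

/-- Zero violation of OPG-PD with stepsize `η`: for all small `ε` there is a margin `δ`, for which
`η` is an admissible stepsize of the tightened problem, such that OPG-PD for the tightened
constraint, from every initial point, has reward gap at most `ε` and no violation for every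
`t ≥ C log² (1/ε)`. -/
def OPGZeroViolation (ξ η : ℝ) : Prop :=
  ∃ C > 0, ∃ εbar > 0, ∀ ε : ℝ, 0 < ε → ε < εbar →
    ∃ δ : ℝ, 0 < δ ∧ δ < ξ ∧ η ≤ M.opgThreshold (ξ - δ) ∧
      ∀ (π πh : ℕ → S → A → ℝ) (lam lamh : ℕ → ℝ),
        M.IsOPG (M.gTight δ) (ξ - δ) η π πh lam lamh →
        ∀ t : ℕ, C * Real.log (1 / ε) ^ 2 ≤ t →
          (∀ πstar, M.IsOptimal πstar → M.V M.r πstar - M.V M.r (πh t) ≤ ε) ∧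
            0 ≤ M.V M.g (πh t)

end CMDP

end

noncomputable section
namespace CMDP

variable {S : Type uS} {A : Type uA} [Fintype S] [Fintype A] (M : CMDP S A)

/-! ### Discounted occupancies -/

/-! The values are not concave in the policy, but they are linear in the discounted occupancy. Two
consequences replace convexity throughout: `performance_difference`, and `exists_mixture`, which
realizes any convex combination of two occupancies by a single policy.

Regularized methods. The Lyapunov function `regPotential` is a divergence from a saddle point of the
regularized Lagrangian, weighted by the occupancy of that saddle point, plus a squared dual
distance. The entropy term in the action values produces exactly `τ` times the divergence, and the
term `τ lam² / 2` does the same for the dual variable. Hence one step contracts the potential by `1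
- η τ` and adds noise of order `η²` (`regPotential_step`). The stationary level is of order `η / τ`,
that is `ε²`, and it is reached after order `ε⁻⁶ log (1/ε)` steps. A Pinsker inequality turns a
potential of order `ε²` into an error of order `ε` in all values. Regularizing and restricting the
policies costs another multiple of `ε` at the saddle point (`V_saddle_ge`, `V_r_saddle_ge`), so a
margin `δ` equal to a large multiple of `ε` removes the violation. In RPG-PD the comparator is a
saddle point over the restricted policies, built in `exists_restricted_saddle`. In the inexact
method it is the given regularized saddle point, smoothed by the uniform policy; the error of the
linear direction is handled by `direction_error` and `approxError_transfer_le`, and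
`exists_covForm_le` makes the condition number uniform in the saddle point. The constant `K = 1`
follows by running the result with `ε / K`.

OPG-PD. The squared distance to a saddle point, weighted by its occupancy, decreases by the squared
lengths of the steps (`IsOPG.descent`), and these lengths bound the duality gap (`IsOPG.gap_le`).
Given an error bound (distance to the target at most a constant times the gap), either a step is
long and the potential drops by a fixed fraction, or it is short and the iterate is already near
some target point. This gives a linear rate (`exists_linear_convergence`). The rate must not depend
on `δ`, so the error bounds are derived from the untightened problem: its dual function is a maximum
of finitely many affine functions, one for each deterministic policy, with an interval `[s₁, s₂]` of
minimizers.

If `s₁ = s₂`, the tightened problem has explicit saddle points and an error bound uniform in `δ`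
(`exists_error_bound_unique`), and convergence to accuracy below `δ` suffices. If `s₁ < s₂`, the
target consists of saddle points of the untightened problem, which are approximate for the tightened
one, and the iterates are only known to come within order `δ` of constraint value zero. The sign is
then obtained combinatorially (`exists_elimination_constant`): unless the multiplier is within order
`δ` of `s₂`, the policy uses only actions optimal at `s₁`, which forces a nonpositive constraint
value, so the margin pushes the multiplier up by `η δ` per step. After boundedly many steps it is
far enough from `s₁` that only actions optimal at `s₂` survive, which forces a nonnegative
constraint value. -/

lemma one_sub_γ_pos : 0 < 1 - M.γ := by linarith [M.γ_mem.2]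

lemma one_sub_γ_le_one : 1 - M.γ ≤ 1 := by linarith [M.γ_mem.1]

lemma law_nonneg {π : S → A → ℝ} (hπ : π ∈ policies S A) {μ : S × A → ℝ} (hμ : ∀ x, 0 ≤ μ x)
    (t : ℕ) (x : S × A) : 0 ≤ M.law π μ t x := by
  induction t generalizing x with
  | zero => exact hμ x
  | succ t ih =>
    exact Finset.sum_nonneg fun y _ =>
      mul_nonneg (mul_nonneg (ih y) ((M.P_mem y.1 y.2).1 _)) ((hπ x.1).1 x.2)

lemma sum_transition {π : S → A → ℝ} (hπ : π ∈ policies S A) (s : S) (a : A) :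
    ∑ x : S × A, M.P s a x.1 * π x.1 x.2 = 1 := by
  rw [Fintype.sum_prod_type]
  simp_rw [← Finset.mul_sum]
  rw [← (M.P_mem s a).2]
  exact Finset.sum_congr rfl fun s' _ => by rw [(hπ s').2, mul_one]

lemma law_sum {π : S → A → ℝ} (hπ : π ∈ policies S A) (μ : S × A → ℝ) (t : ℕ) :
    ∑ x, M.law π μ t x = ∑ x, μ x := by
  induction t with
  | zero => rfl
  | succ t ih =>
    rw [← ih]
    simp only [law]
    rw [Finset.sum_comm]
    refine Finset.sum_congr rfl fun y _ => ?_
    simp_rw [mul_assoc]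
    rw [← Finset.mul_sum, M.sum_transition hπ, mul_one]

lemma law_mem {π : S → A → ℝ} (hπ : π ∈ policies S A) {μ : S × A → ℝ}
    (hμ : μ ∈ stdSimplex ℝ (S × A)) (t : ℕ) : M.law π μ t ∈ stdSimplex ℝ (S × A) :=
  ⟨M.law_nonneg hπ hμ.1 t, by rw [M.law_sum hπ, hμ.2]⟩

lemma law_shift (π : S → A → ℝ) (μ : S × A → ℝ) (t : ℕ) :
    M.law π μ (t + 1) = M.law π (M.law π μ 1) t := by
  induction t with
  | zero => rfl
  | succ t ih =>
    funext x
    rw [law, ih]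
    rfl

lemma law_linear (π : S → A → ℝ) {ι : Type*} (s : Finset ι) (k : ι → ℝ) (m : ι → S × A → ℝ)
    (t : ℕ) (x : S × A) :
    M.law π (fun x => ∑ i ∈ s, k i * m i x) t x = ∑ i ∈ s, k i * M.law π (m i) t x := by
  induction t generalizing x with
  | zero => rfl
  | succ t ih =>
    simp only [law, ih, Finset.mul_sum, Finset.sum_mul]
    rw [Finset.sum_comm]
    refine Finset.sum_congr rfl fun i _ => Finset.sum_congr rfl fun y _ => by ring

lemma coord_le_one {ι : Type*} [Fintype ι] {p : ι → ℝ} (hp : p ∈ stdSimplex ℝ ι) (i : ι) :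
    p i ≤ 1 := by
  rw [← hp.2]
  exact Finset.single_le_sum (fun j _ => hp.1 j) (Finset.mem_univ i)

lemma summable_law {π : S → A → ℝ} (hπ : π ∈ policies S A) {μ : S × A → ℝ}
    (hμ : μ ∈ stdSimplex ℝ (S × A)) (x : S × A) :
    Summable fun t : ℕ => M.γ ^ t * M.law π μ t x := by
  refine Summable.of_nonneg_of_le (fun t => mul_nonneg (pow_nonneg M.γ_mem.1 t)
    ((M.law_mem hπ hμ t).1 x)) (fun t => ?_) (summable_geometric_of_lt_one M.γ_mem.1 M.γ_mem.2)
  exact mul_le_of_le_one_right (pow_nonneg M.γ_mem.1 t) (coord_le_one (M.law_mem hπ hμ t) x)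

/-- The unnormalized discounted state-action occupancy. -/
def occ (π : S → A → ℝ) (μ : S × A → ℝ) (x : S × A) : ℝ := ∑' t : ℕ, M.γ ^ t * M.law π μ t x

lemma occ_nonneg {π : S → A → ℝ} (hπ : π ∈ policies S A) {μ : S × A → ℝ}
    (hμ : ∀ x, 0 ≤ μ x) (x : S × A) : 0 ≤ M.occ π μ x :=
  tsum_nonneg fun t => mul_nonneg (pow_nonneg M.γ_mem.1 t) (M.law_nonneg hπ hμ t x)

lemma discountedSum_eq {π : S → A → ℝ} (hπ : π ∈ policies S A) {μ : S × A → ℝ}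
    (hμ : μ ∈ stdSimplex ℝ (S × A)) (c : S → A → ℝ) :
    M.discountedSum π μ c = ∑ x, M.occ π μ x * c x.1 x.2 := by
  simp only [discountedSum, occ, Finset.mul_sum, ← tsum_mul_right]
  rw [← Summable.tsum_finsetSum fun x _ => (M.summable_law hπ hμ x).mul_right _]
  exact tsum_congr fun t => Finset.sum_congr rfl fun x _ => by ring

lemma occ_flow {π : S → A → ℝ} (hπ : π ∈ policies S A) {μ : S × A → ℝ}
    (hμ : μ ∈ stdSimplex ℝ (S × A)) (x : S × A) :
    M.occ π μ x = μ x + M.γ * (∑ y : S × A, M.occ π μ y * M.P y.1 y.2 x.1) * π x.1 x.2 := by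
  rw [occ, (M.summable_law hπ hμ x).tsum_eq_zero_add]
  have h : ∀ t : ℕ, M.γ ^ (t + 1) * M.law π μ (t + 1) x
      = M.γ * (∑ y : S × A, M.γ ^ t * M.law π μ t y * M.P y.1 y.2 x.1) * π x.1 x.2 := by
    intro t
    simp only [law, Finset.mul_sum, Finset.sum_mul]
    exact Finset.sum_congr rfl fun y _ => by ring
  simp_rw [h, tsum_mul_right, tsum_mul_left]
  rw [Summable.tsum_finsetSum fun y _ => (M.summable_law hπ hμ y).mul_right _]
  simp_rw [tsum_mul_right]
  simp [law, occ]

lemma sum_occ {π : S → A → ℝ} (hπ : π ∈ policies S A) {μ : S × A → ℝ}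
    (hμ : μ ∈ stdSimplex ℝ (S × A)) : ∑ x, M.occ π μ x = 1 / (1 - M.γ) := by
  simp only [occ]
  rw [← Summable.tsum_finsetSum fun x _ => M.summable_law hπ hμ x, one_div,
    ← tsum_geometric_of_lt_one M.γ_mem.1 M.γ_mem.2]
  exact tsum_congr fun t => by rw [← Finset.mul_sum, (M.law_mem hπ hμ t).2, mul_one]

lemma saVisit_eq (π : S → A → ℝ) (μ : S × A → ℝ) (x : S × A) :
    M.saVisit π μ x = (1 - M.γ) * M.occ π μ x := rfl

lemma start_mem {π : S → A → ℝ} (hπ : π ∈ policies S A) : M.start π ∈ stdSimplex ℝ (S × A) := by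
  refine ⟨fun x => mul_nonneg (M.ρ_mem.1 _) ((hπ _).1 _), ?_⟩
  rw [Fintype.sum_prod_type, ← M.ρ_mem.2]
  simp_rw [start, ← Finset.mul_sum]
  exact Finset.sum_congr rfl fun s _ => by rw [(hπ s).2, mul_one]

/-- The point mass at a state-action pair. -/
abbrev dirac (s : S) (a : A) : S × A → ℝ := Set.indicator {(s, a)} (fun _ => (1 : ℝ))

lemma sum_dirac_mul (s : S) (a : A) (f : S × A → ℝ) :
    ∑ x, dirac s a x * f x = f (s, a) := by
  classical
  rw [Finset.sum_eq_single (s, a)]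
  · simp
  · intro x _ hx
    simp [hx]
  · simp

lemma dirac_mem (s : S) (a : A) : dirac s a ∈ stdSimplex ℝ (S × A) :=
  ⟨fun x => Set.indicator_nonneg (fun _ _ => zero_le_one) x, by
    simpa using sum_dirac_mul s a fun _ => 1⟩

/-- The law at each time is linear in the initial law, so the latter can be expanded into point
masses. No sign or normalization of `μ` is needed. -/
lemma discountedSum_linear {π : S → A → ℝ} (hπ : π ∈ policies S A) {μ : S × A → ℝ}
    (c : S → A → ℝ) :
    M.discountedSum π μ c = ∑ x, μ x * M.Q c π x.1 x.2 := by
  classical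
  have hlaw : ∀ t x, M.law π μ t x = ∑ y : S × A, μ y * M.law π (dirac y.1 y.2) t x := by
    intro t x
    rw [← law_linear]
    congr 2
    funext z
    rw [Finset.sum_eq_single z]
    · simp
    · intro y _ hy
      simp [Ne.symm hy]
    · simp
  simp only [Q]
  have hs : ∀ y : S × A, Summable fun t : ℕ =>
      M.γ ^ t * ∑ x : S × A, M.law π (dirac y.1 y.2) t x * c x.1 x.2 := by
    intro y
    have := summable_sum (s := Finset.univ) fun (x : S × A) _ =>
      (M.summable_law hπ (dirac_mem y.1 y.2) x).mul_right (c x.1 x.2)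
    refine this.congr fun t => ?_
    rw [Finset.mul_sum]
    exact Finset.sum_congr rfl fun x _ => by ring
  simp only [discountedSum]
  simp_rw [← tsum_mul_left]
  rw [← Summable.tsum_finsetSum fun y _ => (hs y).mul_left _]
  refine tsum_congr fun t => ?_
  simp_rw [hlaw t, Finset.mul_sum, Finset.sum_mul, Finset.mul_sum]
  rw [Finset.sum_comm]
  exact Finset.sum_congr rfl fun y _ => Finset.sum_congr rfl fun x _ => by ring

/-- The state value function. -/
def vf (c π : S → A → ℝ) (s : S) : ℝ := ∑ a, π s a * M.Q c π s a

lemma V_eq_vf {π : S → A → ℝ} (hπ : π ∈ policies S A) (c : S → A → ℝ) :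
    M.V c π = ∑ s, M.ρ s * M.vf c π s := by
  rw [V, M.discountedSum_linear hπ, Fintype.sum_prod_type]
  simp_rw [vf, Finset.mul_sum, start]
  exact Finset.sum_congr rfl fun s _ => Finset.sum_congr rfl fun a _ => by ring

lemma Q_bellman {π : S → A → ℝ} (hπ : π ∈ policies S A) (c : S → A → ℝ) (s : S) (a : A) :
    M.Q c π s a = c s a + M.γ * ∑ s', M.P s a s' * M.vf c π s' := by
  have hstep : ∀ x, M.law π (dirac s a) 1 x = M.P s a x.1 * π x.1 x.2 := by
    intro x
    simp only [law, mul_assoc]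
    exact sum_dirac_mul s a fun y => M.P y.1 y.2 x.1 * π x.1 x.2
  have hsum : Summable fun t : ℕ => M.γ ^ t * ∑ x : S × A, M.law π (dirac s a) t x * c x.1 x.2 := by
    have := summable_sum (s := Finset.univ) fun (x : S × A) _ =>
      (M.summable_law hπ (dirac_mem s a) x).mul_right (c x.1 x.2)
    refine this.congr fun t => ?_
    rw [Finset.mul_sum]
    exact Finset.sum_congr rfl fun x _ => by ring
  rw [Q, discountedSum, hsum.tsum_eq_zero_add]
  congr 1
  · simp only [pow_zero, one_mul, law]
    exact sum_dirac_mul s a fun x => c x.1 x.2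
  · have h := M.discountedSum_linear hπ (μ := M.law π (dirac s a) 1) c
    rw [discountedSum] at h
    have e : ∀ t : ℕ, M.γ ^ (t + 1) * ∑ x : S × A, M.law π (dirac s a) (t + 1) x * c x.1 x.2
        = M.γ * (M.γ ^ t * ∑ x : S × A, M.law π (M.law π (dirac s a) 1) t x * c x.1 x.2) := by
      intro t
      rw [M.law_shift π (dirac s a) t, pow_succ', mul_assoc]
    rw [tsum_congr e, tsum_mul_left, h, Fintype.sum_prod_type]
    congr 1
    refine Finset.sum_congr rfl fun s' _ => ?_
    rw [vf, Finset.mul_sum]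
    exact Finset.sum_congr rfl fun a' _ => by rw [hstep]; ring

/-- The unnormalized discounted state occupancy from the initial distribution. -/
def socc (π : S → A → ℝ) (s : S) : ℝ := ∑ a, M.occ π (M.start π) (s, a)

lemma dρ_eq (π : S → A → ℝ) (s : S) : M.dρ π s = (1 - M.γ) * M.socc π s := by
  simp_rw [dρ, socc, saVisit_eq, Finset.mul_sum]

lemma socc_flow {π : S → A → ℝ} (hπ : π ∈ policies S A) (s : S) :
    M.socc π s = M.ρ s + M.γ * ∑ y : S × A, M.occ π (M.start π) y * M.P y.1 y.2 s := by
  rw [socc]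
  simp_rw [M.occ_flow hπ (M.start_mem hπ) (s, _), start]
  rw [Finset.sum_add_distrib, ← Finset.mul_sum, ← Finset.mul_sum, (hπ s).2, mul_one, mul_one]

/-- At every time, including time zero under `start`, the action is drawn from `π` given the state,
so the occupancy factors. -/
lemma occ_eq {π : S → A → ℝ} (hπ : π ∈ policies S A) (s : S) (a : A) :
    M.occ π (M.start π) (s, a) = M.socc π s * π s a := by
  rw [M.socc_flow hπ, M.occ_flow hπ (M.start_mem hπ), start]
  ring

lemma socc_nonneg {π : S → A → ℝ} (hπ : π ∈ policies S A) (s : S) : 0 ≤ M.socc π s :=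
  Finset.sum_nonneg fun _ _ => M.occ_nonneg hπ (M.start_mem hπ).1 _

/-- The time-zero term of the occupancy. This is how full support of `ρ` becomes a lower bound on
every occupancy weight. -/
lemma ρ_le_socc {π : S → A → ℝ} (hπ : π ∈ policies S A) (s : S) : M.ρ s ≤ M.socc π s := by
  rw [M.socc_flow hπ]
  have := mul_nonneg M.γ_mem.1 (Finset.sum_nonneg fun (y : S × A) (_ : y ∈ Finset.univ) =>
    mul_nonneg (M.occ_nonneg hπ (M.start_mem hπ).1 y) ((M.P_mem y.1 y.2).1 s))
  linarith

lemma sum_socc {π : S → A → ℝ} (hπ : π ∈ policies S A) : ∑ s, M.socc π s = 1 / (1 - M.γ) := by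
  rw [← M.sum_occ hπ (M.start_mem hπ), Fintype.sum_prod_type]
  rfl

lemma socc_le {π : S → A → ℝ} (hπ : π ∈ policies S A) (s : S) : M.socc π s ≤ 1 / (1 - M.γ) := by
  rw [← M.sum_socc hπ]
  exact Finset.single_le_sum (fun s _ => M.socc_nonneg hπ s) (Finset.mem_univ s)

lemma V_eq_socc {π : S → A → ℝ} (hπ : π ∈ policies S A) (c : S → A → ℝ) :
    M.V c π = ∑ s, M.socc π s * ∑ a, π s a * c s a := by
  rw [V, M.discountedSum_eq hπ (M.start_mem hπ), Fintype.sum_prod_type]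
  simp_rw [Finset.mul_sum, M.occ_eq hπ]
  exact Finset.sum_congr rfl fun s _ => Finset.sum_congr rfl fun a _ => by ring

/-- Flow identity: pairing a nonnormalized flow with `c` in terms of the value functions of a
policy. -/
lemma flow_identity {π : S → A → ℝ} (hπ : π ∈ policies S A) (c : S → A → ℝ) (q : S × A → ℝ)
    (hq : ∀ s, ∑ a, q (s, a) = M.ρ s + M.γ * ∑ y : S × A, q y * M.P y.1 y.2 s) :
    ∑ x, q x * c x.1 x.2 - M.V c π = ∑ x, q x * (M.Q c π x.1 x.2 - M.vf c π x.1) := by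
  -- Bellman's equation expresses `c` as the action value minus the discounted next value; the flow
  -- equation for `q` then cancels the transition terms.
  have h1 : ∑ x, q x * c x.1 x.2 = ∑ x, q x * M.Q c π x.1 x.2
      - ∑ s, M.vf c π s * (M.γ * ∑ y : S × A, q y * M.P y.1 y.2 s) := by
    rw [eq_sub_iff_add_eq]
    simp_rw [M.Q_bellman hπ, mul_add, Finset.sum_add_distrib, Finset.mul_sum]
    congr 1
    rw [Finset.sum_comm]
    exact Finset.sum_congr rfl fun y _ => Finset.sum_congr rfl fun s _ => by ring
  have h2 : ∑ x : S × A, q x * M.vf c π x.1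
      = ∑ s, M.vf c π s * (M.ρ s + M.γ * ∑ y : S × A, q y * M.P y.1 y.2 s) := by
    rw [Fintype.sum_prod_type]
    refine Finset.sum_congr rfl fun s _ => ?_
    rw [← hq, Finset.mul_sum]
    exact Finset.sum_congr rfl fun a _ => by ring
  simp_rw [mul_sub, Finset.sum_sub_distrib]
  rw [h1, h2, M.V_eq_vf hπ]
  simp_rw [mul_add, Finset.sum_add_distrib, mul_comm (M.ρ _)]
  ring

lemma occ_start_flow {π : S → A → ℝ} (hπ : π ∈ policies S A) (s : S) :
    ∑ a, M.occ π (M.start π) (s, a)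
      = M.ρ s + M.γ * ∑ y : S × A, M.occ π (M.start π) y * M.P y.1 y.2 s :=
  M.socc_flow hπ s

/-- The performance difference lemma. -/
lemma performance_difference {π π' : S → A → ℝ} (hπ : π ∈ policies S A) (hπ' : π' ∈ policies S A)
    (c : S → A → ℝ) :
    M.V c π' - M.V c π = ∑ s, M.socc π' s * ∑ a, (π' s a - π s a) * M.Q c π s a := by
  have h := M.flow_identity hπ c _ (M.occ_start_flow hπ')
  rw [← M.discountedSum_eq hπ' (M.start_mem hπ')] at h
  rw [V, h, Fintype.sum_prod_type]
  refine Finset.sum_congr rfl fun s _ => ?_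
  simp_rw [M.occ_eq hπ', mul_assoc, ← Finset.mul_sum, mul_sub, sub_mul]
  congr 1
  rw [Finset.sum_sub_distrib, Finset.sum_sub_distrib, ← Finset.sum_mul, (hπ' s).2, one_mul, vf]

/-- Values are affine along suitable mixtures of two policies. -/
lemma exists_mixture {π₀ π₁ : S → A → ℝ} (h₀ : π₀ ∈ policies S A) (h₁ : π₁ ∈ policies S A)
    {θ : ℝ} (hθ : θ ∈ Set.Icc (0 : ℝ) 1) :
    ∃ w : S → ℝ, (∀ s, w s ∈ Set.Icc (0 : ℝ) 1) ∧ (∀ s, w s * M.ρ s ≤ θ / (1 - M.γ)) ∧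
      (fun s a => (1 - w s) * π₀ s a + w s * π₁ s a) ∈ policies S A ∧
      ∀ c, M.V c (fun s a => (1 - w s) * π₀ s a + w s * π₁ s a)
        = (1 - θ) * M.V c π₀ + θ * M.V c π₁ := by
  -- `n` is the state occupancy the mixture must have. In each state the weight of `π₁` is its share
  -- of `n`; in states where `n` vanishes the quotient is zero, which is harmless.
  set n : S → ℝ := fun s => (1 - θ) * M.socc π₀ s + θ * M.socc π₁ s with hn
  have hθ1 : 0 ≤ 1 - θ := by linarith [hθ.2]
  have hA : ∀ s, 0 ≤ (1 - θ) * M.socc π₀ s := fun s => mul_nonneg hθ1 (M.socc_nonneg h₀ s)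
  have hB : ∀ s, 0 ≤ θ * M.socc π₁ s := fun s => mul_nonneg hθ.1 (M.socc_nonneg h₁ s)
  have hw : ∀ s, θ * M.socc π₁ s / n s ∈ Set.Icc (0 : ℝ) 1 := fun s =>
    ⟨div_nonneg (hB s) (add_nonneg (hA s) (hB s)),
      div_le_one_of_le₀ (by simp only [hn]; linarith [hA s]) (add_nonneg (hA s) (hB s))⟩
  have hmem : (fun s a => (1 - θ * M.socc π₁ s / n s) * π₀ s a
      + θ * M.socc π₁ s / n s * π₁ s a) ∈ policies S A := fun s =>
    convex_stdSimplex ℝ A (h₀ s) (h₁ s) (by linarith [(hw s).2]) (hw s).1 (by ring)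
  refine ⟨fun s => θ * M.socc π₁ s / n s, hw, fun s => ?_, hmem, fun c => ?_⟩
  -- Since `n` dominates `ρ`, a small `θ` forces small weights wherever `ρ` is bounded below. This
  -- later gives entrywise distances.
  · have hρn : M.ρ s ≤ n s := by
      have e1 := mul_le_mul_of_nonneg_left (M.ρ_le_socc h₀ s) hθ1
      have e2 := mul_le_mul_of_nonneg_left (M.ρ_le_socc h₁ s) hθ.1
      simp only [hn]; linarith
    have h3 : θ * M.socc π₁ s ≤ θ / (1 - M.γ) := by
      rw [div_eq_mul_one_div]
      exact mul_le_mul_of_nonneg_left (M.socc_le h₁ s) hθ.1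
    rcases (add_nonneg (hA s) (hB s)).eq_or_lt with h | h
    · beta_reduce
      rw [show n s = 0 from h.symm, div_zero, zero_mul]
      exact div_nonneg hθ.1 M.one_sub_γ_pos.le
    · have h' : 0 < n s := h
      calc θ * M.socc π₁ s / n s * M.ρ s ≤ θ * M.socc π₁ s / n s * n s :=
            mul_le_mul_of_nonneg_left hρn (hw s).1
        _ = θ * M.socc π₁ s := by field_simp
        _ ≤ _ := h3
  · set πθ : S → A → ℝ := fun s a => (1 - θ * M.socc π₁ s / n s) * π₀ s a
      + θ * M.socc π₁ s / n s * π₁ s a with hπθ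
    set q : S × A → ℝ := fun x =>
      (1 - θ) * M.occ π₀ (M.start π₀) x + θ * M.occ π₁ (M.start π₁) x with hq
    have hqs : ∀ s, ∑ a, q (s, a) = n s := fun s => by
      simp only [hq, hn, Finset.sum_add_distrib, ← Finset.mul_sum, socc]
    have hqn : ∀ s a, q (s, a) = n s * πθ s a := by
      intro s a
      simp only [hq, M.occ_eq h₀, M.occ_eq h₁, hπθ]
      rcases (add_nonneg (hA s) (hB s)).eq_or_lt with h | h
      · have a0 : (1 - θ) * M.socc π₀ s = 0 := by linarith [hA s, hB s]
        have b0 : θ * M.socc π₁ s = 0 := by linarith [hA s, hB s]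
        rw [show n s = 0 from h.symm, ← mul_assoc, ← mul_assoc, a0, b0]
        ring
      · have h' : n s ≠ 0 := h.ne'
        have : (1 - θ) * M.socc π₀ s = n s - θ * M.socc π₁ s := by simp only [hn]; ring
        rw [← mul_assoc, ← mul_assoc, this]
        field_simp
    have hflow : ∀ s, ∑ a, q (s, a) = M.ρ s + M.γ * ∑ y : S × A, q y * M.P y.1 y.2 s := by
      intro s
      rw [hqs]
      simp only [hn, hq, M.socc_flow h₀, M.socc_flow h₁, add_mul, Finset.sum_add_distrib,
        mul_assoc, ← Finset.mul_sum]
      ring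
    have h := M.flow_identity hmem c q hflow
    -- `q` splits as `n` times the mixed policy, so the advantages of that policy average to zero
    -- under `q`; the flow identity then identifies the pairing of `q` with `c` as the value.
    have h0 : ∑ x : S × A, q x * (M.Q c πθ x.1 x.2 - M.vf c πθ x.1) = 0 := by
      rw [Fintype.sum_prod_type]
      refine Finset.sum_eq_zero fun s _ => ?_
      simp_rw [hqn, mul_assoc, ← Finset.mul_sum, mul_sub, Finset.sum_sub_distrib, ← Finset.sum_mul]
      rw [(hmem s).2, vf]
      ring
    rw [h0, sub_eq_zero] at h
    rw [← h, V, V, M.discountedSum_eq h₀ (M.start_mem h₀), M.discountedSum_eq h₁ (M.start_mem h₁),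
      Finset.mul_sum, Finset.mul_sum, ← Finset.sum_add_distrib]
    exact Finset.sum_congr rfl fun x _ => by simp only [hq]; ring

/-! ### Linearity and bounds of values -/

lemma Q_add_smul {π : S → A → ℝ} (hπ : π ∈ policies S A) (c h : S → A → ℝ) (k : ℝ) (s : S) (a : A) :
    M.Q (fun s a => c s a + k * h s a) π s a = M.Q c π s a + k * M.Q h π s a := by
  simp only [Q]
  rw [M.discountedSum_eq hπ (dirac_mem s a), M.discountedSum_eq hπ (dirac_mem s a),
    M.discountedSum_eq hπ (dirac_mem s a), Finset.mul_sum, ← Finset.sum_add_distrib]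
  exact Finset.sum_congr rfl fun x _ => by ring

lemma V_add_smul {π : S → A → ℝ} (hπ : π ∈ policies S A) (c h : S → A → ℝ) (k : ℝ) :
    M.V (fun s a => c s a + k * h s a) π = M.V c π + k * M.V h π := by
  simp only [V]
  rw [M.discountedSum_eq hπ (M.start_mem hπ), M.discountedSum_eq hπ (M.start_mem hπ),
    M.discountedSum_eq hπ (M.start_mem hπ), Finset.mul_sum, ← Finset.sum_add_distrib]
  exact Finset.sum_congr rfl fun x _ => by ring

lemma V_const {π : S → A → ℝ} (hπ : π ∈ policies S A) (k : ℝ) :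
    M.V (fun _ _ => k) π = k / (1 - M.γ) := by
  rw [V, M.discountedSum_eq hπ (M.start_mem hπ), ← Finset.sum_mul,
    M.sum_occ hπ (M.start_mem hπ)]
  ring

lemma V_lagr {π : S → A → ℝ} (hπ : π ∈ policies S A) (h : S → A → ℝ) (k : ℝ) :
    M.V (M.lagr h k) π = M.V M.r π + k * M.V h π := M.V_add_smul hπ _ _ _

lemma V_gTight {π : S → A → ℝ} (hπ : π ∈ policies S A) (δ : ℝ) :
    M.V (M.gTight δ) π = M.V M.g π - δ := by
  have h := M.V_add_smul hπ M.g (fun _ _ => 1) (-((1 - M.γ) * δ))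
  rw [M.V_const hπ] at h
  have e : M.gTight δ = fun s a => M.g s a + -((1 - M.γ) * δ) * 1 := by
    funext s a; simp only [gTight]; ring
  rw [e, h]
  have := M.one_sub_γ_pos.ne'
  field_simp
  ring

lemma abs_discountedSum_le {π : S → A → ℝ} (hπ : π ∈ policies S A) {μ : S × A → ℝ}
    (hμ : μ ∈ stdSimplex ℝ (S × A)) {c : S → A → ℝ} {B : ℝ} (hc : ∀ s a, |c s a| ≤ B) :
    |M.discountedSum π μ c| ≤ B / (1 - M.γ) := by
  rw [M.discountedSum_eq hπ hμ]
  refine (Finset.abs_sum_le_sum_abs _ _).trans ?_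
  calc ∑ x, |M.occ π μ x * c x.1 x.2| ≤ ∑ x, M.occ π μ x * B := by
        refine Finset.sum_le_sum fun x _ => ?_
        rw [abs_mul, abs_of_nonneg (M.occ_nonneg hπ hμ.1 x)]
        exact mul_le_mul_of_nonneg_left (hc _ _) (M.occ_nonneg hπ hμ.1 x)
    _ = B / (1 - M.γ) := by rw [← Finset.sum_mul, M.sum_occ hπ hμ]; ring

lemma abs_V_le {π : S → A → ℝ} (hπ : π ∈ policies S A) {c : S → A → ℝ} {B : ℝ}
    (hc : ∀ s a, |c s a| ≤ B) : |M.V c π| ≤ B / (1 - M.γ) :=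
  M.abs_discountedSum_le hπ (M.start_mem hπ) hc

lemma abs_Q_le {π : S → A → ℝ} (hπ : π ∈ policies S A) {c : S → A → ℝ} {B : ℝ}
    (hc : ∀ s a, |c s a| ≤ B) (s : S) (a : A) : |M.Q c π s a| ≤ B / (1 - M.γ) :=
  M.abs_discountedSum_le hπ (dirac_mem s a) hc

lemma V_nonneg {π : S → A → ℝ} (hπ : π ∈ policies S A) {c : S → A → ℝ}
    (hc : ∀ s a, 0 ≤ c s a) : 0 ≤ M.V c π := by
  rw [V, M.discountedSum_eq hπ (M.start_mem hπ)]
  exact Finset.sum_nonneg fun x _ =>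
    mul_nonneg (M.occ_nonneg hπ (M.start_mem hπ).1 x) (hc _ _)

lemma V_r_nonneg {π : S → A → ℝ} (hπ : π ∈ policies S A) : 0 ≤ M.V M.r π :=
  M.V_nonneg hπ fun s a => (M.r_mem s a).1

lemma V_r_le {π : S → A → ℝ} (hπ : π ∈ policies S A) : M.V M.r π ≤ 1 / (1 - M.γ) :=
  (le_abs_self _).trans (M.abs_V_le hπ fun s a => by
    rw [abs_of_nonneg (M.r_mem s a).1]; exact (M.r_mem s a).2)

lemma nonempty_state (M : CMDP S A) : Nonempty S := by
  by_contra h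
  rw [not_nonempty_iff] at h
  have := M.ρ_mem.2
  simp at this

lemma nonempty_action (M : CMDP S A) {π : S → A → ℝ} (hπ : π ∈ policies S A) : Nonempty A := by
  obtain ⟨s⟩ := M.nonempty_state
  by_contra h
  rw [not_nonempty_iff] at h
  have := (hπ s).2
  simp at this

/-- The utility value is at most `1 / (1 - γ)`. This keeps the tightened constraint function within
`[-1, 1]` and makes the dual interval have length at least one. -/
lemma add_le_of_slater {ξ : ℝ} {π : S → A → ℝ} (hπ : π ∈ policies S A) (h : ξ ≤ M.V M.g π) :
    (1 - M.γ) * (M.b + ξ) ≤ 1 := by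
  have h1 : M.V M.g π = M.V M.u π - M.b := by
    have := M.V_add_smul hπ M.u (fun _ _ => 1) (-((1 - M.γ) * M.b))
    rw [M.V_const hπ] at this
    have e : M.g = fun s a => M.u s a + -((1 - M.γ) * M.b) * 1 := by
      funext s a; simp only [g]; ring
    rw [e, this]
    have := M.one_sub_γ_pos.ne'
    field_simp
    ring
  have h2 : M.V M.u π ≤ 1 / (1 - M.γ) := (le_abs_self _).trans (M.abs_V_le hπ fun s a => by
    rw [abs_of_nonneg (M.u_mem s a).1]; exact (M.u_mem s a).2)
  have h3 : M.b + ξ ≤ 1 / (1 - M.γ) := by linarith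
  rw [le_div_iff₀ M.one_sub_γ_pos] at h3
  linarith

lemma abs_gTight_le {ξ δ : ℝ} (hδ0 : 0 ≤ δ) (hδ : δ ≤ ξ)
    (hξ : ∃ π ∈ policies S A, ξ ≤ M.V M.g π) (s : S) (a : A) : |M.gTight δ s a| ≤ 1 := by
  obtain ⟨π, hπ, h⟩ := hξ
  have h1 := M.add_le_of_slater hπ h
  have h2 := M.one_sub_γ_pos
  have h3 := M.u_mem s a
  have h4 : (1 - M.γ) * δ ≤ (1 - M.γ) * ξ := mul_le_mul_of_nonneg_left hδ h2.le
  have h5 : 0 ≤ (1 - M.γ) * δ := mul_nonneg h2.le hδ0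
  have h6 : 0 ≤ (1 - M.γ) * M.b := mul_nonneg h2.le M.b_mem.1.le
  simp only [gTight, g]
  rw [abs_le]
  constructor <;> nlinarith [h3.1, h3.2]

/-- Sensitivity of `Q` to the policy. -/
lemma abs_Q_sub_le {π π' : S → A → ℝ} (hπ : π ∈ policies S A) (hπ' : π' ∈ policies S A)
    (c : S → A → ℝ) {B : ℝ} (hB : ∀ s, |∑ a, (π' s a - π s a) * M.Q c π s a| ≤ B) (s : S) (a : A) :
    |M.Q c π' s a - M.Q c π s a| ≤ M.γ / (1 - M.γ) * B := by
  have : Nonempty (S × A) := ⟨(s, a)⟩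
  -- At the pair of largest deviation `m`, one Bellman step gives `m ≤ γ (m + B)`, which is solved
  -- for `m`.
  obtain ⟨x, hx⟩ := Finite.exists_max fun x : S × A => |M.Q c π' x.1 x.2 - M.Q c π x.1 x.2|
  set m := |M.Q c π' x.1 x.2 - M.Q c π x.1 x.2| with hm
  have hv : ∀ s', |M.vf c π' s' - M.vf c π s'| ≤ m + B := by
    intro s'
    have e : M.vf c π' s' - M.vf c π s'
        = ∑ a', π' s' a' * (M.Q c π' s' a' - M.Q c π s' a')
          + ∑ a', (π' s' a' - π s' a') * M.Q c π s' a' := by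
      simp only [vf, ← Finset.sum_sub_distrib, ← Finset.sum_add_distrib]
      exact Finset.sum_congr rfl fun _ _ => by ring
    rw [e]
    refine (abs_add_le _ _).trans (add_le_add ?_ (hB s'))
    refine (Finset.abs_sum_le_sum_abs _ _).trans ?_
    calc _ ≤ ∑ a', π' s' a' * m := Finset.sum_le_sum fun a' _ => by
          rw [abs_mul, abs_of_nonneg ((hπ' s').1 a')]
          exact mul_le_mul_of_nonneg_left (hx (s', a')) ((hπ' s').1 a')
      _ = m := by rw [← Finset.sum_mul, (hπ' s').2, one_mul]
  have hall : ∀ s a, |M.Q c π' s a - M.Q c π s a| ≤ M.γ * (m + B) := by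
    intro s a
    have e : M.Q c π' s a - M.Q c π s a
        = M.γ * ∑ s', M.P s a s' * (M.vf c π' s' - M.vf c π s') := by
      rw [M.Q_bellman hπ', M.Q_bellman hπ]
      simp only [mul_sub, Finset.sum_sub_distrib]
      ring
    rw [e, abs_mul, abs_of_nonneg M.γ_mem.1]
    refine mul_le_mul_of_nonneg_left ((Finset.abs_sum_le_sum_abs _ _).trans ?_) M.γ_mem.1
    calc _ ≤ ∑ s', M.P s a s' * (m + B) := Finset.sum_le_sum fun s' _ => by
          rw [abs_mul, abs_of_nonneg ((M.P_mem s a).1 s')]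
          exact mul_le_mul_of_nonneg_left (hv s') ((M.P_mem s a).1 s')
      _ = m + B := by rw [← Finset.sum_mul, (M.P_mem s a).2, one_mul]
  have hmB : m ≤ M.γ * (m + B) := hall x.1 x.2
  have hpos := M.one_sub_γ_pos
  refine (hx (s, a)).trans ?_
  rw [div_mul_eq_mul_div, le_div_iff₀ hpos]
  linarith

end CMDP

/-! ### First-order conditions and mirror steps -/

/-- This takes the place of differentiation: `a` is a directional derivative at a constrained
optimum and `b` bounds the second-order remainder along a segment. -/
lemma nonneg_of_forall_quadratic {a b : ℝ}
    (h : ∀ θ : ℝ, 0 < θ → θ ≤ 1 → 0 ≤ θ * a + θ ^ 2 * b) : 0 ≤ a := by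
  by_contra ha
  push Not at ha
  set θ := min 1 (-a / (2 * (|b| + 1))) with hθ
  have hb : 0 < 2 * (|b| + 1) := by positivity
  have hpos : 0 < θ := lt_min one_pos (div_pos (neg_pos.2 ha) hb)
  have h1 := h θ hpos (min_le_left _ _)
  have h2 : θ * (2 * (|b| + 1)) ≤ -a := by
    rw [← le_div_iff₀ hb]; exact min_le_right _ _
  have h3 : 0 ≤ a + θ * b := by
    have : 0 ≤ θ * (a + θ * b) := by linarith [h1]
    exact nonneg_of_mul_nonneg_right this hpos
  have h4 : θ * b ≤ θ * |b| := mul_le_mul_of_nonneg_left (le_abs_self b) hpos.le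
  nlinarith

/-- Variational inequality of a proximal step on an interval. -/
lemma prox_real_foc {l u v η x₀ y : ℝ} (hη : 0 < η) (hy : y ∈ Set.Icc l u)
    (hmin : IsMinOn (fun x : ℝ => x * v + 1 / (2 * η) * (x - x₀) ^ 2) (Set.Icc l u) y)
    {x : ℝ} (hx : x ∈ Set.Icc l u) : 0 ≤ (η * v + (y - x₀)) * (x - y) := by
  refine nonneg_of_forall_quadratic (b := (x - y) ^ 2 / 2) fun θ h0 h1 => ?_
  have hmem : (1 - θ) * y + θ * x ∈ Set.Icc l u :=
    convex_Icc l u hy hx (by linarith) h0.le (by ring)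
  have h := isMinOn_iff.1 hmin _ hmem
  have h2 := mul_le_mul_of_nonneg_left h hη.le
  have e : ∀ z : ℝ, η * (z * v + 1 / (2 * η) * (z - x₀) ^ 2) = η * z * v + (z - x₀) ^ 2 / 2 := by
    intro z; field_simp
  simp only [e] at h2
  nlinarith

/-- Three-point inequality for a proximal step on an interval. -/
lemma prox_real_descent {l u v η x₀ y : ℝ} (hη : 0 < η) (hy : y ∈ Set.Icc l u)
    (hmin : IsMinOn (fun x : ℝ => x * v + 1 / (2 * η) * (x - x₀) ^ 2) (Set.Icc l u) y)
    {x : ℝ} (hx : x ∈ Set.Icc l u) :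
    (y - x) ^ 2 ≤ (x₀ - x) ^ 2 - 2 * η * (x₀ - x) * v + η ^ 2 * v ^ 2 := by
  have h := prox_real_foc hη hy hmin hx
  nlinarith [sq_nonneg (η * v + (y - x₀))]

/-- Variational inequality of a projected step. -/
lemma proj_foc {ι : Type*} [Fintype ι] {K : Set (ι → ℝ)} (hK : Convex ℝ K) {η : ℝ} (hη : 0 < η)
    {D q p : ι → ℝ} (hp : p ∈ K)
    (hmax : IsMaxOn (fun x : ι → ℝ => ∑ i, x i * D i - 1 / (2 * η) * ∑ i, (x i - q i) ^ 2) K p)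
    {x : ι → ℝ} (hx : x ∈ K) :
    η * ∑ i, (x i - p i) * D i ≤ ∑ i, (p i - q i) * (x i - p i) := by
  have key : 0 ≤ ∑ i, (p i - q i) * (x i - p i) - η * ∑ i, (x i - p i) * D i := by
    refine nonneg_of_forall_quadratic (b := (∑ i, (x i - p i) ^ 2) / 2) fun θ h0 h1 => ?_
    have hmem : (fun i => (1 - θ) * p i + θ * x i) ∈ K :=
      hK hp hx (by linarith) h0.le (by ring)
    have h := isMaxOn_iff.1 hmax _ hmem
    have h2 := mul_le_mul_of_nonneg_left h hη.le
    have e : ∀ z : ι → ℝ, η * (∑ i, z i * D i - 1 / (2 * η) * ∑ i, (z i - q i) ^ 2)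
        = ∑ i, (η * (z i * D i) - (z i - q i) ^ 2 / 2) := by
      intro z
      rw [Finset.sum_sub_distrib, ← Finset.mul_sum, ← Finset.sum_div]
      field_simp
    rw [e, e] at h2
    have e2 : θ * (∑ i, (p i - q i) * (x i - p i) - η * ∑ i, (x i - p i) * D i)
        + θ ^ 2 * ((∑ i, (x i - p i) ^ 2) / 2)
        = ∑ i, (η * (p i * D i) - (p i - q i) ^ 2 / 2)
          - ∑ i, (η * (((1 - θ) * p i + θ * x i) * D i)
            - ((1 - θ) * p i + θ * x i - q i) ^ 2 / 2) := by
      rw [Finset.sum_div, Finset.mul_sum, ← Finset.sum_sub_distrib, Finset.mul_sum, Finset.mul_sum,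
        ← Finset.sum_add_distrib, ← Finset.sum_sub_distrib]
      exact Finset.sum_congr rfl fun i _ => by ring
    rw [e2]
    linarith
  linarith

/-! ### Kullback-Leibler divergence -/

/-- Apply `1 - 1/x ≤ log x` at `x = √p / √q`. The terms `- p + q` cancel after summing two
probability vectors, so this is the termwise form of "squared Hellinger distance at most
divergence". -/
lemma sq_sqrt_sub_le {p q : ℝ} (hp : 0 ≤ p) (hq : 0 < q) :
    (√p - √q) ^ 2 ≤ p * Real.log (p / q) - p + q := by
  rcases hp.eq_or_lt with rfl | hp'
  · simp [Real.sq_sqrt hq.le]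
  have hsp := Real.sqrt_pos.2 hp'
  have hsq := Real.sqrt_pos.2 hq
  have h1 : Real.log (p / q) = 2 * Real.log (√p / √q) := by
    rw [← Real.sqrt_div hp, Real.log_sqrt (div_nonneg hp hq.le)]; ring
  have h2 : 1 - (√p / √q)⁻¹ ≤ Real.log (√p / √q) := Real.one_sub_inv_le_log_of_pos (by positivity)
  have h3 : p * (√p / √q)⁻¹ = √p * √q := by
    rw [inv_div]
    nth_rewrite 1 [← Real.mul_self_sqrt hp]
    field_simp
  have h4 := mul_le_mul_of_nonneg_left h2 hp
  rw [mul_sub, h3] at h4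
  rw [h1]
  nlinarith [Real.sq_sqrt hp, Real.sq_sqrt hq.le]

section KL

variable {A : Type uA} [Fintype A]

/-- Pinsker's inequality with the weaker constant 4: factor `p - q` as a difference of squares of
roots, apply Cauchy-Schwarz, and bound the Hellinger factor by the divergence. -/
lemma sq_l1_le_klVec {p q : A → ℝ} (hp : p ∈ stdSimplex ℝ A) (hq : q ∈ stdSimplex ℝ A)
    (hq0 : ∀ a, 0 < q a) : (∑ a, |p a - q a|) ^ 2 ≤ 4 * klVec p q := by
  have h1 : ∑ a, (√(p a) - √(q a)) ^ 2 ≤ klVec p q := by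
    calc _ ≤ ∑ a, (p a * Real.log (p a / q a) - p a + q a) :=
          Finset.sum_le_sum fun a _ => sq_sqrt_sub_le (hp.1 a) (hq0 a)
      _ = klVec p q := by
          rw [Finset.sum_add_distrib, Finset.sum_sub_distrib, hp.2, hq.2, klVec]; ring
  have h2 : ∑ a, (√(p a) + √(q a)) ^ 2 ≤ 4 := by
    calc _ ≤ ∑ a, (2 * p a + 2 * q a) := Finset.sum_le_sum fun a _ => by
          nlinarith [Real.sq_sqrt (hp.1 a), Real.sq_sqrt (hq.1 a), sq_nonneg (√(p a) - √(q a))]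
      _ = 4 := by rw [Finset.sum_add_distrib, ← Finset.mul_sum, ← Finset.mul_sum, hp.2, hq.2]; ring
  have h3 : ∀ a, |p a - q a| = |√(p a) - √(q a)| * (√(p a) + √(q a)) := by
    intro a
    rw [← abs_of_nonneg (add_nonneg (Real.sqrt_nonneg (p a)) (Real.sqrt_nonneg (q a))), ← abs_mul]
    congr 1
    nlinarith [Real.sq_sqrt (hp.1 a), Real.sq_sqrt (hq.1 a)]
  simp_rw [h3]
  refine (Finset.sum_mul_sq_le_sq_mul_sq _ _ _).trans ?_
  simp_rw [sq_abs]
  have h4 : 0 ≤ ∑ a, (√(p a) - √(q a)) ^ 2 := Finset.sum_nonneg fun a _ => sq_nonneg _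
  nlinarith

lemma klVec_nonneg {p q : A → ℝ} (hp : p ∈ stdSimplex ℝ A) (hq : q ∈ stdSimplex ℝ A)
    (hq0 : ∀ a, 0 < q a) : 0 ≤ klVec p q := by
  nlinarith [sq_l1_le_klVec hp hq hq0, sq_nonneg (∑ a, |p a - q a|)]

lemma klVec_eq {p q : A → ℝ} (hq0 : ∀ a, 0 < q a) :
    klVec p q = ∑ a, p a * Real.log (p a) - ∑ a, p a * Real.log (q a) := by
  rw [klVec, ← Finset.sum_sub_distrib]
  refine Finset.sum_congr rfl fun a _ => ?_
  rcases eq_or_ne (p a) 0 with h | h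
  · simp [h]
  · rw [Real.log_div h (hq0 a).ne']; ring

lemma mul_log_nonpos {x : ℝ} (h0 : 0 ≤ x) (h1 : x ≤ 1) : x * Real.log x ≤ 0 :=
  mul_nonpos_of_nonneg_of_nonpos h0 (Real.log_nonpos h0 h1)

lemma neg_one_le_mul_log {x : ℝ} (h0 : 0 ≤ x) : -1 ≤ x * Real.log x := by
  rcases h0.eq_or_lt with rfl | h
  · simp
  · have := mul_le_mul_of_nonneg_left (Real.one_sub_inv_le_log_of_pos h) h0
    rw [mul_sub, mul_inv_cancel₀ h.ne'] at this
    linarith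

lemma restricted_pos {ε₀ : ℝ} (h : 0 < ε₀) {p : A → ℝ} (hp : p ∈ restrictedSimplex A ε₀) (a : A) :
    0 < p a :=
  (div_pos h (by exact_mod_cast Fintype.card_pos_iff.2 ⟨a⟩)).trans_le (hp.2 a)

lemma neg_log_restricted_le {ε₀ : ℝ} (h : 0 < ε₀) {p : A → ℝ} (hp : p ∈ restrictedSimplex A ε₀)
    (a : A) : -Real.log (p a) ≤ Real.log (Fintype.card A / ε₀) := by
  have hc : (0 : ℝ) < Fintype.card A := by exact_mod_cast Fintype.card_pos_iff.2 ⟨a⟩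
  rw [← Real.log_inv]
  refine Real.log_le_log (inv_pos.2 (restricted_pos h hp a)) ?_
  rw [inv_le_comm₀ (restricted_pos h hp a) (by positivity), inv_div]
  exact hp.2 a

lemma klVec_le_of_neg_log_le {p q : A → ℝ} (hp : p ∈ stdSimplex ℝ A)
    (hq0 : ∀ a, 0 < q a) {B : ℝ} (hB : ∀ a, -Real.log (q a) ≤ B) : klVec p q ≤ B := by
  rw [klVec_eq hq0]
  have h1 : ∑ a, p a * Real.log (p a) ≤ 0 := Finset.sum_nonpos fun a _ =>
    mul_log_nonpos (hp.1 a) (CMDP.coord_le_one hp a)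
  have h2 : -∑ a, p a * Real.log (q a) ≤ B := by
    calc _ = ∑ a, p a * -Real.log (q a) := by simp [Finset.sum_neg_distrib]
      _ ≤ ∑ a, p a * B := Finset.sum_le_sum fun a _ => mul_le_mul_of_nonneg_left (hB a) (hp.1 a)
      _ = B := by rw [← Finset.sum_mul, hp.2, one_mul]
  linarith

lemma restrictedSimplex_convex (ε₀ : ℝ) : Convex ℝ (restrictedSimplex A ε₀) := by
  intro p hp q hq a b ha hb hab
  refine ⟨convex_stdSimplex ℝ A hp.1 hq.1 ha hb hab, fun i => ?_⟩
  simp only [Pi.add_apply, Pi.smul_apply, smul_eq_mul]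
  calc _ = a * (ε₀ / Fintype.card A) + b * (ε₀ / Fintype.card A) := by rw [← add_mul, hab, one_mul]
    _ ≤ _ := add_le_add (mul_le_mul_of_nonneg_left (hp.2 i) ha)
      (mul_le_mul_of_nonneg_left (hq.2 i) hb)

/-- The mixture of a probability vector with the uniform one. -/
def unifMix (ε₀ : ℝ) (p : A → ℝ) : A → ℝ := fun a => (1 - ε₀) * p a + ε₀ * (1 / Fintype.card A)

lemma unif_mem [Nonempty A] : (fun _ : A => (1 / Fintype.card A : ℝ)) ∈ stdSimplex ℝ A :=
  ⟨fun _ => by positivity, by simp⟩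

lemma unifMix_mem [Nonempty A] {ε₀ : ℝ} (h0 : 0 ≤ ε₀) (h1 : ε₀ ≤ 1) {p : A → ℝ}
    (hp : p ∈ stdSimplex ℝ A) : unifMix ε₀ p ∈ restrictedSimplex A ε₀ := by
  refine ⟨convex_stdSimplex ℝ A hp unif_mem (by linarith) h0 (by ring), fun a => ?_⟩
  have := mul_nonneg (by linarith : 0 ≤ 1 - ε₀) (hp.1 a)
  simp only [unifMix]
  rw [mul_one_div]
  linarith

lemma l1_unifMix_sub_le [Nonempty A] {ε₀ : ℝ} (h0 : 0 ≤ ε₀) {p : A → ℝ} (hp : p ∈ stdSimplex ℝ A) :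
    ∑ a, |unifMix ε₀ p a - p a| ≤ 2 * ε₀ := by
  calc _ ≤ ∑ a, (ε₀ * (1 / Fintype.card A) + ε₀ * p a) := Finset.sum_le_sum fun a _ => by
        have e : unifMix ε₀ p a - p a = ε₀ * (1 / Fintype.card A) - ε₀ * p a := by
          simp only [unifMix]; ring
        rw [e]
        refine (abs_sub _ _).trans (le_of_eq ?_)
        rw [abs_of_nonneg (mul_nonneg h0 (hp.1 a)), abs_of_nonneg (by positivity)]
    _ = 2 * ε₀ := by
        rw [Finset.sum_add_distrib, ← Finset.mul_sum, ← Finset.mul_sum, hp.2, unif_mem.2]; ring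

/-- The divergence is convex in its first argument, and from the uniform law to a restricted one it
is at most `log (|A| / ε₀)`. -/
lemma klVec_unifMix_le [Nonempty A] {ε₀ : ℝ} (h0 : 0 < ε₀) (h1 : ε₀ ≤ 1) {p q : A → ℝ}
    (hp : p ∈ stdSimplex ℝ A) (hq : q ∈ restrictedSimplex A ε₀) :
    klVec (unifMix ε₀ p) q ≤ klVec p q + ε₀ * Real.log (Fintype.card A / ε₀) := by
  have hq0 := restricted_pos h0 hq
  have hu := klVec_le_of_neg_log_le (unif_mem (A := A)) hq0 (neg_log_restricted_le h0 hq)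
  have hc : klVec (unifMix ε₀ p) q
      ≤ (1 - ε₀) * klVec p q + ε₀ * klVec (fun _ : A => (1 / Fintype.card A : ℝ)) q := by
    simp only [klVec_eq hq0]
    have : ∑ a, unifMix ε₀ p a * Real.log (unifMix ε₀ p a)
        ≤ ∑ a, ((1 - ε₀) * (p a * Real.log (p a))
          + ε₀ * ((1 / Fintype.card A : ℝ) * Real.log (1 / Fintype.card A))) :=
      Finset.sum_le_sum fun a _ => Real.convexOn_mul_log.2 (hp.1 a)
        (Set.mem_Ici.2 (by positivity : (0 : ℝ) ≤ 1 / Fintype.card A)) (by linarith) h0.le (by ring)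
    have e : ∑ a, unifMix ε₀ p a * Real.log (q a)
        = (1 - ε₀) * ∑ a, p a * Real.log (q a)
          + ε₀ * ∑ a, (1 / Fintype.card A : ℝ) * Real.log (q a) := by
      rw [Finset.mul_sum, Finset.mul_sum, ← Finset.sum_add_distrib]
      exact Finset.sum_congr rfl fun a _ => by simp only [unifMix]; ring
    rw [Finset.sum_add_distrib, ← Finset.mul_sum, ← Finset.mul_sum] at this
    rw [e]
    linarith
  have h2 := mul_nonneg h0.le (klVec_nonneg hp hq.1 hq0)
  have h3 := mul_le_mul_of_nonneg_left hu h0.le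
  linarith

/-- Three-point inequality of a mirror step over the restricted simplex. -/
lemma mirror_three_point {η ε₀ : ℝ} (hη : 0 < η) (hε : 0 < ε₀) {D q p' : A → ℝ}
    (hq : q ∈ restrictedSimplex A ε₀) (hp' : p' ∈ restrictedSimplex A ε₀)
    (hmax : IsMaxOn (fun p : A → ℝ => ∑ a, p a * D a - 1 / η * klVec p q)
      (restrictedSimplex A ε₀) p') {p : A → ℝ} (hp : p ∈ restrictedSimplex A ε₀) :
    η * ∑ a, p a * D a - klVec p q ≤ η * ∑ a, p' a * D a - klVec p' q - klVec p p' := by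
  have hq0 := restricted_pos hε hq
  have hp0' := restricted_pos hε hp'
  -- A quadratic upper bound of the divergence along the segment from `p'` to `p`, obtained from
  -- `log x ≤ x - 1`; the coordinates of `p'` are positive, so the remainder is finite.
  have hbound : ∀ θ : ℝ, 0 < θ → θ ≤ 1 → ∀ a,
      ((1 - θ) * p' a + θ * p a) * Real.log (((1 - θ) * p' a + θ * p a) / q a)
        ≤ p' a * Real.log (p' a / q a) + θ * ((p a - p' a) * (Real.log (p' a / q a) + 1))
          + θ ^ 2 * ((p a - p' a) ^ 2 / p' a) := by
    intro θ h0 h1 a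
    have hx : 0 < (1 - θ) * p' a + θ * p a := by
      have h2 := mul_pos h0 (restricted_pos hε hp a)
      have h3 := mul_nonneg (by linarith : 0 ≤ 1 - θ) (hp0' a).le
      linarith
    set x := (1 - θ) * p' a + θ * p a with hxdef
    have h4 : Real.log (x / q a) ≤ Real.log (p' a / q a) + (x / p' a - 1) := by
      have e : x / q a = (x / p' a) * (p' a / q a) := by
        have := (hp0' a).ne'; have := (hq0 a).ne'; field_simp
      rw [e, Real.log_mul (div_pos hx (hp0' a)).ne' (div_pos (hp0' a) (hq0 a)).ne']
      linarith [Real.log_le_sub_one_of_pos (div_pos hx (hp0' a))]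
    refine (mul_le_mul_of_nonneg_left h4 hx.le).trans (le_of_eq ?_)
    have hne := (hp0' a).ne'
    rw [hxdef]
    field_simp
    ring
  have key : 0 ≤ ∑ a, (p a - p' a) * (Real.log (p' a / q a) + 1)
      - η * ∑ a, (p a - p' a) * D a := by
    refine nonneg_of_forall_quadratic (b := ∑ a, (p a - p' a) ^ 2 / p' a) fun θ h0 h1 => ?_
    have hmem : (fun a => (1 - θ) * p' a + θ * p a) ∈ restrictedSimplex A ε₀ :=
      restrictedSimplex_convex ε₀ hp' hp (by linarith) h0.le (by ring)
    have h := mul_le_mul_of_nonneg_left (isMaxOn_iff.1 hmax _ hmem) hη.le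
    have h2 := Finset.sum_le_sum fun a (_ : a ∈ Finset.univ) => hbound θ h0 h1 a
    simp only [Finset.sum_add_distrib, ← Finset.mul_sum] at h2
    have e1 : ∑ a, ((1 - θ) * p' a + θ * p a) * D a
        = ∑ a, p' a * D a + θ * ∑ a, (p a - p' a) * D a := by
      rw [Finset.mul_sum, ← Finset.sum_add_distrib]
      exact Finset.sum_congr rfl fun a _ => by ring
    simp only [mul_sub, e1, ← mul_assoc, mul_one_div_cancel hη.ne', one_mul] at h
    simp only [klVec] at h
    linarith
  have e2 : ∑ a, (p a - p' a) * (Real.log (p' a / q a) + 1)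
      = klVec p q - klVec p' q - klVec p p' := by
    have s1 : ∑ a, (p a - p' a) = 0 := by rw [Finset.sum_sub_distrib, hp.1.2, hp'.1.2, sub_self]
    simp only [mul_add, mul_one, Finset.sum_add_distrib, s1, add_zero]
    simp only [klVec, ← Finset.sum_sub_distrib]
    refine Finset.sum_congr rfl fun a _ => ?_
    have hpa := restricted_pos hε hp a
    rw [Real.log_div (hp0' a).ne' (hq0 a).ne', Real.log_div hpa.ne' (hq0 a).ne',
      Real.log_div hpa.ne' (hp0' a).ne']
    ring
  rw [e2] at key
  simp only [sub_mul, Finset.sum_sub_distrib] at key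
  linarith

lemma abs_sum_mul_le {ι : Type*} [Fintype ι] {x D : ι → ℝ} {B : ℝ} (hD : ∀ i, |D i| ≤ B) :
    |∑ i, x i * D i| ≤ B * ∑ i, |x i| := by
  refine (Finset.abs_sum_le_sum_abs _ _).trans ?_
  rw [Finset.mul_sum]
  exact Finset.sum_le_sum fun i _ => by
    rw [abs_mul, mul_comm]; exact mul_le_mul_of_nonneg_right (hD i) (abs_nonneg _)

/-- One mirror step along a bounded direction. -/
lemma mirror_descent {η ε₀ B : ℝ} (hη : 0 < η) (hε : 0 < ε₀) {D q p' : A → ℝ}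
    (hD : ∀ a, |D a| ≤ B)
    (hq : q ∈ restrictedSimplex A ε₀) (hp' : p' ∈ restrictedSimplex A ε₀)
    (hmax : IsMaxOn (fun p : A → ℝ => ∑ a, p a * D a - 1 / η * klVec p q)
      (restrictedSimplex A ε₀) p') {p : A → ℝ} (hp : p ∈ restrictedSimplex A ε₀) :
    klVec p p' ≤ klVec p q - η * ∑ a, (p a - q a) * D a + η ^ 2 * B ^ 2 := by
  have h1 := mirror_three_point hη hε hq hp' hmax hp
  have h2 := sq_l1_le_klVec hp'.1 hq.1 (restricted_pos hε hq)
  have h3 : ∑ a, (p' a - q a) * D a ≤ B * ∑ a, |p' a - q a| :=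
    (le_abs_self _).trans (abs_sum_mul_le hD)
  have h4 := mul_le_mul_of_nonneg_left h3 hη.le
  simp only [sub_mul, Finset.sum_sub_distrib] at h4 ⊢
  -- Young's inequality: the gain from moving from `q` to `p'` is at most `η B` times the `ℓ¹`
  -- length, which Pinsker pays for out of the divergence at the cost `η² B²`.
  nlinarith [sq_nonneg (η * B - (∑ a, |p' a - q a|) / 2)]

end KL

namespace CMDP

variable {S : Type uS} {A : Type uA} [Fintype S] [Fintype A] (M : CMDP S A)

/-! ### The regularized Lagrangian -/

lemma abs_V_sub_le {π π' : S → A → ℝ} (hπ : π ∈ policies S A) (hπ' : π' ∈ policies S A)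
    {c : S → A → ℝ} {B : ℝ} (hc : ∀ s a, |c s a| ≤ B) :
    |M.V c π' - M.V c π| ≤ B / (1 - M.γ) * ∑ s, M.socc π' s * ∑ a, |π' s a - π s a| := by
  rw [M.performance_difference hπ hπ', Finset.mul_sum]
  refine (Finset.abs_sum_le_sum_abs _ _).trans (Finset.sum_le_sum fun s _ => ?_)
  rw [abs_mul, abs_of_nonneg (M.socc_nonneg hπ' s), mul_left_comm]
  exact mul_le_mul_of_nonneg_left (abs_sum_mul_le fun a => M.abs_Q_le hπ hc s a)
    (M.socc_nonneg hπ' s)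

lemma sum_socc_mul_le {π : S → A → ℝ} (hπ : π ∈ policies S A) {f : S → ℝ} {B : ℝ}
    (hf : ∀ s, f s ≤ B) : ∑ s, M.socc π s * f s ≤ B / (1 - M.γ) := by
  calc _ ≤ ∑ s, M.socc π s * B :=
        Finset.sum_le_sum fun s _ => mul_le_mul_of_nonneg_left (hf s) (M.socc_nonneg hπ s)
    _ = _ := by rw [← Finset.sum_mul, M.sum_socc hπ]; ring

lemma abs_V_unifMix_sub_le {π : S → A → ℝ} (hπ : π ∈ policies S A) {ε₀ : ℝ} (h0 : 0 ≤ ε₀)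
    (h1 : ε₀ ≤ 1) {c : S → A → ℝ} {B : ℝ} (hB : 0 ≤ B) (hc : ∀ s a, |c s a| ≤ B) :
    |M.V c (fun s => unifMix ε₀ (π s)) - M.V c π| ≤ B / (1 - M.γ) * (2 * ε₀ / (1 - M.γ)) := by
  have := M.nonempty_action hπ
  have hm : (fun s => unifMix ε₀ (π s)) ∈ policies S A := fun s => (unifMix_mem h0 h1 (hπ s)).1
  refine (M.abs_V_sub_le hπ hm hc).trans ?_
  refine mul_le_mul_of_nonneg_left ?_ (div_nonneg hB M.one_sub_γ_pos.le)
  exact M.sum_socc_mul_le hm fun s => l1_unifMix_sub_le h0 (hπ s)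

lemma entropy_nonneg {π : S → A → ℝ} (hπ : π ∈ policies S A) : 0 ≤ M.entropy π :=
  M.V_nonneg hπ fun s a => neg_nonneg.2 (Real.log_nonpos ((hπ s).1 a) (coord_le_one (hπ s) a))

/-- Each term `-x log x` is bounded by one. The resulting factor `|A|` is cruder than `log |A|`, but
only its independence of `ε` matters. -/
lemma entropy_le {π : S → A → ℝ} (hπ : π ∈ policies S A) :
    M.entropy π ≤ Fintype.card A / (1 - M.γ) := by
  rw [entropy, M.V_eq_socc hπ]
  refine M.sum_socc_mul_le hπ fun s => ?_
  calc _ ≤ ∑ _a : A, (1 : ℝ) := Finset.sum_le_sum fun a _ => by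
        have := neg_one_le_mul_log ((hπ s).1 a); linarith
    _ = _ := by simp

/-- Cross entropy of two policies along the occupancy of the first. -/
lemma V_neg_log {π π' : S → A → ℝ} (hπ' : π' ∈ policies S A) (hpos : ∀ s a, 0 < π s a) :
    M.V (fun s a => -Real.log (π s a)) π'
      = M.entropy π' + ∑ s, M.socc π' s * klVec (π' s) (π s) := by
  rw [entropy, M.V_eq_socc hπ', M.V_eq_socc hπ', ← Finset.sum_add_distrib]
  refine Finset.sum_congr rfl fun s _ => ?_
  rw [klVec_eq (hpos s)]
  simp only [mul_neg, Finset.sum_neg_distrib]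
  ring

lemma V_regLagr {π π' : S → A → ℝ} (hπ' : π' ∈ policies S A) (h : S → A → ℝ) (τ lam : ℝ) :
    M.V (M.regLagr h τ lam π) π'
      = M.V M.r π' + lam * M.V h π' + τ * M.V (fun s a => -Real.log (π s a)) π' := by
  have := M.V_add_smul hπ' (M.lagr h lam) (fun s a => -Real.log (π s a)) τ
  rw [M.V_lagr hπ'] at this
  exact this

lemma L_eq {π : S → A → ℝ} (hπ : π ∈ policies S A) (h : S → A → ℝ) (τ lam : ℝ) :
    M.L h τ π lam = M.V M.r π + lam * M.V h π + τ * (M.entropy π + lam ^ 2 / 2) := by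
  rw [L, M.V_lagr hπ]

/-- The Lyapunov function of the regularized methods. -/
def regPotential (πo po : S → A → ℝ) (lamo : ℝ) (π : S → A → ℝ) (lam : ℝ) : ℝ :=
  ∑ s, M.socc πo s * klVec (po s) (π s) + (lam - lamo) ^ 2 / 2

/-- One step of a regularized primal-dual mirror method, with errors in the direction and in the
comparator. -/
lemma regPotential_step {h : S → A → ℝ} {ξ τ η ε₀ B Bv eD eK : ℝ} (hη : 0 < η) (hε : 0 < ε₀)
    (hτ : 0 ≤ τ) {πo po π π' D : S → A → ℝ} {lamo lam lam' : ℝ}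
    (hπo : πo ∈ policies S A) (hpo : ∀ s, po s ∈ restrictedSimplex A ε₀)
    (hπ : ∀ s, π s ∈ restrictedSimplex A ε₀) (hlamo : lamo ∈ M.Λ ξ)
    (hsaddle : M.L h τ π lamo ≤ M.L h τ πo lam)
    (hD : ∀ s a, |D s a| ≤ B) (hstep : KLStep η ε₀ D π π')
    (hdual : M.DualStep h ξ τ η π lam lam') (hBv : |M.V h π + τ * lam| ≤ Bv)
    (heK : ∀ s, klVec (po s) (π s) ≤ klVec (πo s) (π s) + eK)
    (heD : ∑ s, M.socc πo s * ∑ a, (πo s a - π s a) * M.Q (M.regLagr h τ lam π) π s a - eD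
      ≤ ∑ s, M.socc πo s * ∑ a, (po s a - π s a) * D s a) :
    M.regPotential πo po lamo π' lam' ≤ (1 - η * τ) * M.regPotential πo po lamo π lam
      + η * (eD + τ * (eK / (1 - M.γ))) + η ^ 2 * (B ^ 2 / (1 - M.γ) + Bv ^ 2 / 2) := by
  have hπp : π ∈ policies S A := fun s => (hπ s).1
  have hpos : ∀ s a, 0 < π s a := fun s => restricted_pos hε (hπ s)
  have h1 : ∑ s, M.socc πo s * klVec (po s) (π' s)
      ≤ ∑ s, M.socc πo s * klVec (po s) (π s)
        - η * ∑ s, M.socc πo s * ∑ a, (po s a - π s a) * D s a + η ^ 2 * (B ^ 2 / (1 - M.γ)) := by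
    have : ∀ s, klVec (po s) (π' s) ≤ klVec (po s) (π s) - η * ∑ a, (po s a - π s a) * D s a
        + η ^ 2 * B ^ 2 := fun s =>
      mirror_descent hη hε (hD s) (hπ s) (hstep s).1 (hstep s).2 (hpo s)
    calc _ ≤ ∑ s, M.socc πo s * (klVec (po s) (π s) - η * ∑ a, (po s a - π s a) * D s a
        + η ^ 2 * B ^ 2) := Finset.sum_le_sum fun s _ =>
          mul_le_mul_of_nonneg_left (this s) (M.socc_nonneg hπo s)
      _ = _ := by
        simp only [mul_add, mul_sub, Finset.sum_add_distrib, Finset.sum_sub_distrib,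
          ← Finset.sum_mul, M.sum_socc hπo, mul_left_comm _ η, ← Finset.mul_sum]
        ring
  have h2 := M.performance_difference hπp hπo (M.regLagr h τ lam π)
  -- Under the comparator, the value of `-log π` is its entropy plus the weighted divergence. This
  -- divergence, multiplied by `η τ`, is the source of the contraction.
  rw [M.V_regLagr hπo, M.V_regLagr hπp, M.V_neg_log hπo hpos] at h2
  have h3 : M.V (fun s a => -Real.log (π s a)) π = M.entropy π := rfl
  rw [h3] at h2
  -- The dual contraction comes from writing `lam (lam - lamo)` as `(lam² - lamo²) / 2 + (lam -
  -- lamo)² / 2`: the first part is matched by the saddle inequality, the second contracts.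
  have h4 := prox_real_descent hη hdual.1 hdual.2 hlamo
  have h5 : ∑ s, M.socc πo s * klVec (po s) (π s)
      ≤ ∑ s, M.socc πo s * klVec (πo s) (π s) + eK / (1 - M.γ) := by
    calc _ ≤ ∑ s, M.socc πo s * (klVec (πo s) (π s) + eK) := Finset.sum_le_sum fun s _ =>
          mul_le_mul_of_nonneg_left (heK s) (M.socc_nonneg hπo s)
      _ = _ := by
        simp only [mul_add, Finset.sum_add_distrib, ← Finset.sum_mul, M.sum_socc hπo]; ring
  rw [M.L_eq hπp, M.L_eq hπo] at hsaddle
  have h6 : (M.V h π + τ * lam) ^ 2 ≤ Bv ^ 2 := sq_le_sq' (by linarith [abs_le.1 hBv])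
    (abs_le.1 hBv).2
  have h7 := mul_le_mul_of_nonneg_left h6 (sq_nonneg η)
  have h8 := mul_le_mul_of_nonneg_left h5 (mul_nonneg hη.le hτ)
  have h9 := mul_le_mul_of_nonneg_left heD hη.le
  have h10 := mul_le_mul_of_nonneg_left hsaddle hη.le
  rw [← h2] at h9
  simp only [regPotential]
  nlinarith

/-- The error is written as `k * e` so that `e` is the fixed point of the recursion; the transient
is `(1 - k)^t`, bounded by an exponential. -/
lemma le_of_geometric_recursion {Φ : ℕ → ℝ} {k e : ℝ} (hk1 : k ≤ 1)
    (h : ∀ t, Φ (t + 1) ≤ (1 - k) * Φ t + k * e) (he : 0 ≤ e) (hΦ : 0 ≤ Φ 0) (t : ℕ) :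
    Φ t ≤ Real.exp (-(k * t)) * Φ 0 + e := by
  have h1 : ∀ t, Φ t ≤ (1 - k) ^ t * Φ 0 + e := by
    intro t
    induction t with
    | zero => simpa using he
    | succ t ih =>
      have := mul_le_mul_of_nonneg_left ih (sub_nonneg.2 hk1)
      rw [pow_succ]
      nlinarith [h t]
  refine (h1 t).trans ?_
  gcongr
  have : (1 - k) ^ t ≤ Real.exp (-k) ^ t :=
    pow_le_pow_left₀ (sub_nonneg.2 hk1) (by linarith [Real.add_one_le_exp (-k)]) t
  refine this.trans (le_of_eq ?_)
  rw [← Real.exp_nat_mul]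
  ring_nf

/-- Constraint value at a saddle point. -/
lemma V_saddle_ge {ξ' τ e : ℝ} {h : S → A → ℝ} (hξ' : 0 < ξ') (hξ1 : (1 - M.γ) * ξ' ≤ 1)
    (hτ : 0 ≤ τ) (he : 0 ≤ e) {πo πt : S → A → ℝ} {lamo : ℝ} (hπo : πo ∈ policies S A)
    (hπt : πt ∈ policies S A) (hlamo : lamo ∈ M.Λ ξ')
    (hmax : M.L h τ πt lamo ≤ M.L h τ πo lamo)
    (hmin : ∀ lam ∈ M.Λ ξ', M.L h τ πo lamo ≤ M.L h τ πo lam)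
    (hV : ξ' - e ≤ M.V h πt) :
    -(e + τ * (Fintype.card A / (1 - M.γ)) + τ * (1 / ((1 - M.γ) * ξ'))) ≤ M.V h πo := by
  have hg := M.one_sub_γ_pos
  set lm := 1 / ((1 - M.γ) * ξ') with hlm
  have hlm0 : 0 < lm := by positivity
  have hcard : 0 ≤ τ * (Fintype.card A / (1 - M.γ)) := by positivity
  -- At the right endpoint of the dual interval, `lm * ξ'` equals the largest possible reward `1 /
  -- (1 - γ)`, so comparison with the Slater policy decides. Elsewhere the multiplier may increase,
  -- and the first-order condition in that direction bounds the constraint value below.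
  rcases hlamo.2.eq_or_lt with hl | hl
  · rw [M.L_eq hπo, M.L_eq hπt] at hmax
    have e1 := M.V_r_nonneg hπt
    have e2 := M.V_r_le hπo
    have e3 := mul_nonneg hτ (M.entropy_nonneg hπt)
    have e4 := mul_le_mul_of_nonneg_left (M.entropy_le hπo) hτ
    have e5 : lm * ξ' = 1 / (1 - M.γ) := by rw [hlm]; field_simp
    rw [show lamo = lm from hl] at hmax
    have e6 := mul_le_mul_of_nonneg_left hV hlm0.le
    have e7 : lm * (-e) - τ * (Fintype.card A / (1 - M.γ)) ≤ lm * M.V h πo := by linarith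
    -- Needed to divide by `lm` without enlarging the entropy error.
    have e8 : 1 ≤ lm := by rw [hlm, le_div_iff₀ (by positivity), one_mul]; exact hξ1
    have e9 : lm * (-e - τ * (Fintype.card A / (1 - M.γ))) ≤ lm * M.V h πo := by
      nlinarith
    have := le_of_mul_le_mul_left e9 hlm0
    have := mul_nonneg hτ hlm0.le
    linarith
  · have e1 : 0 ≤ (lm - lamo) * (M.V h πo + τ * lamo) := by
      refine nonneg_of_forall_quadratic (b := τ * (lm - lamo) ^ 2 / 2) fun θ h0 h1 => ?_
      have hmem : (1 - θ) * lamo + θ * lm ∈ M.Λ ξ' :=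
        convex_Icc _ _ hlamo (Set.right_mem_Icc.2 hlm0.le) (by linarith) h0.le (by ring)
      have := hmin _ hmem
      rw [M.L_eq hπo, M.L_eq hπo] at this
      nlinarith
    have e2 : 0 ≤ M.V h πo + τ * lamo := nonneg_of_mul_nonneg_right e1 (sub_pos.2 hl)
    have e3 := mul_le_mul_of_nonneg_left hl.le hτ
    linarith

/-- Reward value at a saddle point. -/
lemma V_r_saddle_ge {ξ' τ e : ℝ} {h : S → A → ℝ} (hτ : 0 ≤ τ) (he : 0 ≤ e) (hξ' : 0 < ξ')
    {πo πt : S → A → ℝ} {lamo : ℝ} (hπo : πo ∈ policies S A)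
    (hπt : πt ∈ policies S A) (hlamo : lamo ∈ M.Λ ξ')
    (hmax : M.L h τ πt lamo ≤ M.L h τ πo lamo)
    (hmin : ∀ lam ∈ M.Λ ξ', M.L h τ πo lamo ≤ M.L h τ πo lam)
    (hV : -e ≤ M.V h πt) :
    M.V M.r πt - (1 / ((1 - M.γ) * ξ') * e + τ * (Fintype.card A / (1 - M.γ))) ≤ M.V M.r πo := by
  have hg := M.one_sub_γ_pos
  -- Comparison with the zero multiplier gives `lamo * V h πo + τ * lamo² / 2 ≤ 0`, so the
  -- Lagrangian at the saddle point does not exceed reward plus entropy.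
  have h0 := hmin 0 (Set.left_mem_Icc.2 (by positivity))
  rw [M.L_eq hπo, M.L_eq hπo] at h0
  rw [M.L_eq hπo, M.L_eq hπt] at hmax
  have e3 := mul_nonneg hτ (M.entropy_nonneg hπt)
  have e4 := mul_le_mul_of_nonneg_left (M.entropy_le hπo) hτ
  have e5 := mul_le_mul_of_nonneg_left hV hlamo.1
  have e6 := mul_le_mul_of_nonneg_right hlamo.2 he
  have e7 := mul_nonneg hτ (sq_nonneg lamo)
  nlinarith

/-! ### Saddle points over restricted policies -/

/-- Policies whose action distributions lie in the restricted simplex. -/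
def restrictedPolicies (S : Type uS) (A : Type uA) [Fintype A] (ε₀ : ℝ) : Set (S → A → ℝ) :=
  {π | ∀ s, π s ∈ restrictedSimplex A ε₀}

lemma restricted_subset {ε₀ : ℝ} {π : S → A → ℝ} (h : π ∈ restrictedPolicies S A ε₀) :
    π ∈ policies S A := fun s => (h s).1

lemma isCompact_restrictedPolicies (ε₀ : ℝ) : IsCompact (restrictedPolicies S A ε₀) := by
  have h1 : IsCompact (restrictedSimplex A ε₀) := by
    refine (isCompact_stdSimplex ℝ A).of_isClosed_subset ?_ fun p hp => hp.1
    have e : restrictedSimplex A ε₀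
        = stdSimplex ℝ A ∩ ⋂ a, {p : A → ℝ | ε₀ / (Fintype.card A : ℝ) ≤ p a} := by
      ext p; simp [restrictedSimplex]
    rw [e]
    exact (isClosed_stdSimplex ℝ A).inter
      (isClosed_iInter fun a => isClosed_le continuous_const (continuous_apply a))
  have h2 : restrictedPolicies S A ε₀ = Set.univ.pi fun _ => restrictedSimplex A ε₀ := by
    ext π; simp [restrictedPolicies]
  rw [h2]
  exact isCompact_univ_pi fun _ => h1

lemma continuousOn_law (x : S × A) (t : ℕ) :
    Continuous fun π : S → A → ℝ => M.law π (M.start π) t x := by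
  induction t generalizing x with
  | zero =>
    simp only [law, start]
    fun_prop
  | succ t ih =>
    simp only [law]
    exact continuous_finsetSum _ fun y _ => ((ih y).mul continuous_const).mul (by fun_prop)

lemma continuousOn_occ (x : S × A) :
    ContinuousOn (fun π : S → A → ℝ => M.occ π (M.start π) x) (policies S A) := by
  refine continuousOn_tsum (u := fun t => M.γ ^ t)
    (fun t => (continuous_const.mul (M.continuousOn_law x t)).continuousOn)
    (summable_geometric_of_lt_one M.γ_mem.1 M.γ_mem.2) fun t π hπ => ?_
  have h := M.law_mem hπ (M.start_mem hπ) t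
  rw [Real.norm_eq_abs, abs_of_nonneg (mul_nonneg (pow_nonneg M.γ_mem.1 t) (h.1 x))]
  exact mul_le_of_le_one_right (pow_nonneg M.γ_mem.1 t) (coord_le_one h x)

lemma continuousOn_V {K : Set (S → A → ℝ)} (hK : K ⊆ policies S A) {c : (S → A → ℝ) → S → A → ℝ}
    (hc : ∀ s a, ContinuousOn (fun π => c π s a) K) :
    ContinuousOn (fun π => M.V (c π) π) K := by
  have h : ContinuousOn (fun π => ∑ x : S × A, M.occ π (M.start π) x * c π x.1 x.2) K :=
    continuousOn_finsetSum _ fun x _ => ((M.continuousOn_occ x).mono hK).mul (hc x.1 x.2)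
  exact h.congr fun π hπ => M.discountedSum_eq (hK hπ) (M.start_mem (hK hπ)) _

lemma restrictedPolicies_mix {ε₀ : ℝ} {π₀ π₁ : S → A → ℝ} (h₀ : π₀ ∈ restrictedPolicies S A ε₀)
    (h₁ : π₁ ∈ restrictedPolicies S A ε₀) {w : S → ℝ} (hw : ∀ s, w s ∈ Set.Icc (0 : ℝ) 1) :
    (fun s a => (1 - w s) * π₀ s a + w s * π₁ s a) ∈ restrictedPolicies S A ε₀ := fun s =>
  restrictedSimplex_convex ε₀ (h₀ s) (h₁ s) (by linarith [(hw s).2]) (hw s).1 (by ring)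

/-- The dual variable minimizing `lam * v + τ * lam² / 2` on an interval `[0, l]`. -/
def dualBest (τ l v : ℝ) : ℝ := max 0 (min l (-v / τ))

lemma dualBest_mem {τ l v : ℝ} (hl : 0 ≤ l) : dualBest τ l v ∈ Set.Icc 0 l :=
  ⟨le_max_left _ _, max_le hl (min_le_left _ _)⟩

/-- Completing the square, the objective is `τ / 2` times the squared distance to `-v / τ`, up to a
constant, and `dualBest` is the projection of that point on the interval. -/
lemma dualBest_le {τ l v x : ℝ} (hτ : 0 < τ) (hl : 0 ≤ l) (hx : x ∈ Set.Icc 0 l) :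
    dualBest τ l v * v + τ * (dualBest τ l v ^ 2 / 2) ≤ x * v + τ * (x ^ 2 / 2) := by
  have hv : v = -(τ * (-v / τ)) := by field_simp
  set y := -v / τ with hy
  have key : (dualBest τ l v - y) ^ 2 ≤ (x - y) ^ 2 := by
    rw [dualBest, ← hy]
    rcases le_total l y with h | h
    · rw [min_eq_left h, max_eq_right hl]
      nlinarith [hx.2]
    · rw [min_eq_right h]
      rcases le_total 0 y with h' | h'
      · rw [max_eq_right h']; nlinarith [sq_nonneg (x - y)]
      · rw [max_eq_left h']; nlinarith [hx.1]
  rw [hv] at key ⊢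
  have : dualBest τ l (-(τ * y)) = dualBest τ l v := by rw [← hv]
  rw [this]
  rw [← hv] at key
  nlinarith

lemma abs_dualBest_sub_le {τ l v v' : ℝ} (hτ : 0 < τ) :
    |dualBest τ l v' - dualBest τ l v| ≤ |v' - v| / τ := by
  simp only [dualBest]
  refine (abs_max_sub_max_le_max _ _ _ _).trans (max_le ?_ ?_)
  · simp only [sub_self, abs_zero]; positivity
  · refine (abs_min_sub_min_le_max _ _ _ _).trans (max_le ?_ ?_)
    · simp only [sub_self, abs_zero]; positivity
    · rw [← sub_div, abs_div, abs_of_pos hτ, neg_sub_neg, abs_sub_comm]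

/-- Maximize the function `min_lam L(π, lam)` over the compact set of restricted policies. The
Lagrangian is concave along occupancy mixtures and its best multiplier moves by `O(θ)` along a
mixture of weight `θ`, so replacing the moving multiplier by the fixed one costs `O(θ²)`. Letting
`θ` tend to zero shows that the maximizer is also optimal against its own multiplier. -/
lemma exists_restricted_saddle {ε₀ τ ξ' : ℝ} (hε : 0 < ε₀) (hε1 : ε₀ ≤ 1) (hτ : 0 < τ) (hξ' : 0 < ξ')
    (hne : (policies S A).Nonempty) (h : S → A → ℝ) :
    ∃ πo ∈ restrictedPolicies S A ε₀, ∃ lamo ∈ M.Λ ξ',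
      (∀ π ∈ restrictedPolicies S A ε₀, M.L h τ π lamo ≤ M.L h τ πo lamo) ∧
      (∀ lam ∈ M.Λ ξ', M.L h τ πo lamo ≤ M.L h τ πo lam) := by
  obtain ⟨π₁, hπ₁⟩ := hne
  have := M.nonempty_action hπ₁
  have hg := M.one_sub_γ_pos
  set l := 1 / ((1 - M.γ) * ξ') with hl
  have hl0 : 0 ≤ l := by positivity
  set lb : (S → A → ℝ) → ℝ := fun π => dualBest τ l (M.V h π) with hlb
  have hlb_mem : ∀ π, lb π ∈ M.Λ ξ' := fun π => dualBest_mem hl0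
  have hbest : ∀ π ∈ policies S A, ∀ lam ∈ M.Λ ξ', M.L h τ π (lb π) ≤ M.L h τ π lam := by
    intro π hπ lam hlam
    rw [M.L_eq hπ, M.L_eq hπ]
    have := dualBest_le (v := M.V h π) hτ hl0 hlam
    simp only [hlb]
    linarith
  have hcV : ContinuousOn (fun π => M.V h π) (restrictedPolicies S A ε₀) :=
    M.continuousOn_V (fun π hπ => restricted_subset hπ) fun s a => continuousOn_const
  have hcont : ContinuousOn (fun π => M.L h τ π (lb π)) (restrictedPolicies S A ε₀) := by
    have hclb : ContinuousOn lb (restrictedPolicies S A ε₀) := by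
      have : Continuous fun v : ℝ => dualBest τ l v := by
        simp only [dualBest]; fun_prop
      exact this.comp_continuousOn hcV
    refine (M.continuousOn_V (c := fun π => M.lagr h (lb π)) (fun π hπ => restricted_subset hπ)
      fun s a => continuousOn_const.add (hclb.mul continuousOn_const)).add
      (continuousOn_const.mul (ContinuousOn.add ?_ ((hclb.pow 2).div_const 2)))
    refine M.continuousOn_V (fun π hπ => restricted_subset hπ) fun s a => ?_
    refine ContinuousOn.neg (ContinuousOn.log (Continuous.continuousOn (by fun_prop)) ?_)
    exact fun π hπ => (restricted_pos hε (hπ s) a).ne'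
  have hnonempty : (restrictedPolicies S A ε₀).Nonempty :=
    ⟨fun s => unifMix ε₀ (π₁ s), fun s => unifMix_mem hε.le hε1 (hπ₁ s)⟩
  obtain ⟨πo, hπo, hmax⟩ := (isCompact_restrictedPolicies ε₀).exists_isMaxOn hnonempty hcont
  refine ⟨πo, hπo, lb πo, hlb_mem πo, fun π hπ => ?_, hbest πo (restricted_subset hπo)⟩
  have hπo' := restricted_subset hπo
  have hπ' := restricted_subset hπ
  set dv := M.V h π - M.V h πo with hdv
  -- A bound for the Lipschitz constant of the dual objective at `π`, times the speed `|dv| / τ` of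
  -- the best multiplier along the mixture.
  set C := |dv| / τ * (|M.V h π| + τ * l) with hC
  have hC0 : 0 ≤ C := by positivity
  have key : ∀ θ : ℝ, 0 < θ → θ ≤ 1 →
      0 ≤ θ * (M.L h τ πo (lb πo) - M.L h τ π (lb πo)) + θ ^ 2 * C := by
    intro θ h0 h1
    obtain ⟨w, hw, -, hmem, hV⟩ := M.exists_mixture hπo' hπ' ⟨h0.le, h1⟩
    set πθ : S → A → ℝ := fun s a => (1 - w s) * πo s a + w s * π s a with hπθ
    have hπθr : πθ ∈ restrictedPolicies S A ε₀ := restrictedPolicies_mix hπo hπ hw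
    have hpos : ∀ s a, 0 < πθ s a := fun s => restricted_pos hε (hπθr s)
    -- Cross entropy dominates entropy. Since the value of the fixed function `-log πθ` is affine
    -- along the mixture, this yields concavity of the entropy.
    have hcross : ∀ π'' ∈ policies S A, M.entropy π'' ≤ M.V (fun s a => -Real.log (πθ s a)) π'' := by
      intro π'' hπ''
      rw [M.V_neg_log hπ'' hpos]
      have : 0 ≤ ∑ s, M.socc π'' s * klVec (π'' s) (πθ s) := Finset.sum_nonneg fun s _ =>
        mul_nonneg (M.socc_nonneg hπ'' s) (klVec_nonneg (hπ'' s) (hmem s) (hpos s))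
      linarith
    have hent : (1 - θ) * M.entropy πo + θ * M.entropy π ≤ M.entropy πθ := by
      have e1 : M.entropy πθ = _ := hV (fun s a => -Real.log (πθ s a))
      rw [e1]
      exact add_le_add (mul_le_mul_of_nonneg_left (hcross πo hπo') (by linarith))
        (mul_le_mul_of_nonneg_left (hcross π hπ') h0.le)
    have hconc : (1 - θ) * M.L h τ πo (lb πθ) + θ * M.L h τ π (lb πθ) ≤ M.L h τ πθ (lb πθ) := by
      rw [M.L_eq hπo', M.L_eq hπ', M.L_eq hmem, hV, hV]
      have := mul_le_mul_of_nonneg_left hent hτ.le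
      nlinarith
    have e1 : M.L h τ πθ (lb πθ) ≤ M.L h τ πo (lb πo) := isMaxOn_iff.1 hmax _ hπθr
    have e2 := mul_le_mul_of_nonneg_left (hbest πo hπo' _ (hlb_mem πθ)) (by linarith : 0 ≤ 1 - θ)
    have e3 : |lb πθ - lb πo| ≤ θ * (|dv| / τ) := by
      refine (abs_dualBest_sub_le hτ).trans (le_of_eq ?_)
      have : M.V h πθ - M.V h πo = θ * dv := by rw [hV, hdv]; ring
      rw [this, abs_mul, abs_of_pos h0]
      ring
    have e4 : M.L h τ π (lb πo) - M.L h τ π (lb πθ) ≤ θ * C := by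
      rw [M.L_eq hπ', M.L_eq hπ']
      have e5 : lb πo * M.V h π + τ * (lb πo ^ 2 / 2)
          - (lb πθ * M.V h π + τ * (lb πθ ^ 2 / 2))
          = (lb πo - lb πθ) * (M.V h π + τ * ((lb πo + lb πθ) / 2)) := by ring
      have e6 : |M.V h π + τ * ((lb πo + lb πθ) / 2)| ≤ |M.V h π| + τ * l := by
        refine (abs_add_le _ _).trans (add_le_add le_rfl ?_)
        have h1' := hlb_mem πo
        have h2' := hlb_mem πθ
        rw [abs_of_nonneg (mul_nonneg hτ.le (by linarith [h1'.1, h2'.1]))]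
        exact mul_le_mul_of_nonneg_left (by linarith [h1'.2, h2'.2]) hτ.le
      have e7 : (lb πo - lb πθ) * (M.V h π + τ * ((lb πo + lb πθ) / 2)) ≤ θ * C := by
        refine (le_abs_self _).trans ?_
        rw [abs_mul, hC, ← mul_assoc, abs_sub_comm]
        exact mul_le_mul e3 e6 (abs_nonneg _) (by positivity)
      linarith
    have e8 := mul_le_mul_of_nonneg_left e4 h0.le
    nlinarith
  have := nonneg_of_forall_quadratic key
  linarith

end CMDP

/-! ### Zero violation of RPG-PD -/

lemma l1_le_klVec {A : Type uA} [Fintype A] {p q : A → ℝ} (hp : p ∈ stdSimplex ℝ A)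
    (hq : q ∈ stdSimplex ℝ A) (hq0 : ∀ a, 0 < q a) {ε : ℝ} (hε : 0 < ε) :
    ∑ a, |p a - q a| ≤ klVec p q / ε + ε := by
  have h := sq_l1_le_klVec hp hq hq0
  rw [div_add' _ _ _ hε.ne', le_div_iff₀ hε]
  nlinarith [sq_nonneg (∑ a, |p a - q a| - 2 * ε)]

/-- The assumption `3 ε ≤ 1` makes `log (1/ε)` at least one, so its square dominates it. The fourth
power leaves room for an initial potential of order `1/ε`. -/
lemma exp_neg_le_pow_four {ε k κ t : ℝ} (hε : 0 < ε) (hε3 : 3 * ε ≤ 1) (hκ : 0 < κ)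
    (hk : κ * ε ^ 6 ≤ k) (ht : 4 / κ * (1 / ε ^ 6 * Real.log (1 / ε) ^ 2) ≤ t) :
    Real.exp (-(k * t)) ≤ ε ^ 4 := by
  have hlog : 1 ≤ Real.log (1 / ε) := by
    rw [Real.le_log_iff_exp_le (by positivity), le_div_iff₀ hε]
    nlinarith [Real.exp_one_lt_d9]
  have h0 : 0 ≤ 4 / κ * (1 / ε ^ 6 * Real.log (1 / ε) ^ 2) := by positivity
  have h1 : 4 * Real.log (1 / ε) ^ 2 ≤ k * t := by
    calc 4 * Real.log (1 / ε) ^ 2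
        = κ * ε ^ 6 * (4 / κ * (1 / ε ^ 6 * Real.log (1 / ε) ^ 2)) := by field_simp
      _ ≤ k * t := mul_le_mul hk ht h0 ((by positivity : 0 ≤ κ * ε ^ 6).trans hk)
  have h2 : 4 * Real.log (1 / ε) ≤ k * t := by nlinarith
  calc Real.exp (-(k * t)) ≤ Real.exp (-(4 * Real.log (1 / ε))) := Real.exp_le_exp.2 (by linarith)
    _ = ε ^ 4 := by
      rw [one_div, Real.log_inv, show -(4 * -Real.log ε) = (4 : ℕ) * Real.log ε by push_cast; ring,
        Real.exp_nat_mul, Real.exp_log hε]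

namespace CMDP

variable {S : Type uS} {A : Type uA} [Fintype S] [Fintype A] (M : CMDP S A)

lemma dual_bound {ξ δ lam : ℝ} (hξ : 0 < ξ) (hδ : δ ≤ ξ / 2) (hlam : lam ∈ M.Λ (ξ - δ)) :
    |lam| ≤ 2 / ((1 - M.γ) * ξ) := by
  have hg := M.one_sub_γ_pos
  rw [abs_of_nonneg hlam.1]
  refine hlam.2.trans ?_
  rw [div_le_div_iff₀ (mul_pos hg (by linarith)) (by positivity)]
  nlinarith

lemma dual_length_le {ξ δ : ℝ} (hξ : 0 < ξ) (hδ : δ ≤ ξ / 2) :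
    1 / ((1 - M.γ) * (ξ - δ)) ≤ 2 / ((1 - M.γ) * ξ) := by
  have hg := M.one_sub_γ_pos
  rw [div_le_div_iff₀ (mul_pos hg (by linarith)) (by positivity)]
  nlinarith

lemma abs_r_le (s : S) (a : A) : |M.r s a| ≤ 1 := by
  rw [abs_of_nonneg (M.r_mem s a).1]; exact (M.r_mem s a).2

lemma abs_lagr_le {h : S → A → ℝ} (hh : ∀ s a, |h s a| ≤ 1) {lam l : ℝ} (hl : |lam| ≤ l) (s : S)
    (a : A) : |M.lagr h lam s a| ≤ 1 + l := by
  refine (abs_add_le _ _).trans (add_le_add (M.abs_r_le s a) ?_)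
  rw [abs_mul]
  calc |lam| * |h s a| ≤ l * 1 :=
        mul_le_mul hl (hh s a) (abs_nonneg _) ((abs_nonneg _).trans hl)
    _ = l := mul_one l

/-- Deviation of values in terms of the Lyapunov function. -/
lemma abs_V_sub_le_of_kl {ε ε₀ e Φ : ℝ} (hε : 0 < ε) (hε₀ : 0 < ε₀) {πo po π : S → A → ℝ}
    (hπo : πo ∈ policies S A) (hpo : ∀ s, po s ∈ restrictedSimplex A ε₀)
    (hπ : ∀ s, π s ∈ restrictedSimplex A ε₀) (he : ∀ s, ∑ a, |po s a - πo s a| ≤ e)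
    (hΦ : ∑ s, M.socc πo s * klVec (po s) (π s) ≤ Φ) {c : S → A → ℝ} (hc : ∀ s a, |c s a| ≤ 1) :
    |M.V c πo - M.V c π| ≤ 1 / (1 - M.γ) * (Φ / ε + (ε + e) / (1 - M.γ)) := by
  have hπp : π ∈ policies S A := fun s => (hπ s).1
  refine (M.abs_V_sub_le hπp hπo hc).trans ?_
  refine mul_le_mul_of_nonneg_left ?_ (div_nonneg one_pos.le M.one_sub_γ_pos.le)
  have h1 : ∀ s, ∑ a, |πo s a - π s a| ≤ klVec (po s) (π s) / ε + (ε + e) := by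
    intro s
    have h2 := l1_le_klVec (hpo s).1 (hπ s).1 (restricted_pos hε₀ (hπ s)) hε
    have h3 : ∑ a, |πo s a - π s a| ≤ ∑ a, |po s a - πo s a| + ∑ a, |po s a - π s a| := by
      rw [← Finset.sum_add_distrib]
      refine Finset.sum_le_sum fun a _ => ?_
      rw [abs_sub_comm (po s a)]
      exact abs_sub_le _ _ _
    linarith [he s]
  calc _ ≤ ∑ s, M.socc πo s * (klVec (po s) (π s) / ε + (ε + e)) := Finset.sum_le_sum fun s _ =>
        mul_le_mul_of_nonneg_left (h1 s) (M.socc_nonneg hπo s)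
    _ = (∑ s, M.socc πo s * klVec (po s) (π s)) / ε + (ε + e) / (1 - M.γ) := by
        simp only [mul_add, Finset.sum_add_distrib, ← Finset.sum_mul, M.sum_socc hπo]
        rw [Finset.sum_div, Finset.sum_congr rfl fun s _ => (mul_div_assoc _ _ _).symm]
        ring
    _ ≤ _ := by
        have := div_le_div_of_nonneg_right hΦ hε.le
        linarith

lemma regPotential_nonneg {ε₀ : ℝ} (hε₀ : 0 < ε₀) {πo po π : S → A → ℝ}
    (hπo : πo ∈ policies S A) (hpo : ∀ s, po s ∈ restrictedSimplex A ε₀)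
    (hπ : ∀ s, π s ∈ restrictedSimplex A ε₀) (lamo lam : ℝ) :
    0 ≤ M.regPotential πo po lamo π lam :=
  add_nonneg (Finset.sum_nonneg fun s _ => mul_nonneg (M.socc_nonneg hπo s)
    (klVec_nonneg (hpo s).1 (hπ s).1 (restricted_pos hε₀ (hπ s)))) (by positivity)

lemma regPotential_le {ε₀ B l : ℝ} (hε₀ : 0 < ε₀) {πo po π : S → A → ℝ}
    (hπo : πo ∈ policies S A) (hpo : ∀ s, po s ∈ restrictedSimplex A ε₀)
    (hπ : ∀ s, π s ∈ restrictedSimplex A ε₀) (hB : ∀ s a, -Real.log (π s a) ≤ B) {lamo lam : ℝ}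
    (hlamo : lamo ∈ Set.Icc 0 l) (hlam : lam ∈ Set.Icc 0 l) :
    M.regPotential πo po lamo π lam ≤ B / (1 - M.γ) + l ^ 2 / 2 := by
  refine add_le_add (M.sum_socc_mul_le hπo fun s =>
    klVec_le_of_neg_log_le (hpo s).1 (restricted_pos hε₀ (hπ s)) (hB s)) ?_
  have : (lam - lamo) ^ 2 ≤ l ^ 2 :=
    sq_le_sq' (by linarith [hlamo.2, hlam.1]) (by linarith [hlamo.1, hlam.2])
  linarith

-- Compare with a restricted regularized saddle point; the comparator errors of `regPotential_step`
-- then vanish. After the transient the potential is at most `CΦ ε²`, all values are within `Kd ε`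
-- of those of the saddle point, and the margin `K2 ε` covers this together with the cost of
-- restriction and regularization.
set_option maxHeartbeats 1000000 in
theorem exists_rpgZeroViolation {ξ : ℝ} (hξ : 0 < ξ)
    (hslater : ∃ πbar ∈ policies S A, ξ ≤ M.V M.g πbar) {a₁ a₂ b₁ b₂ c : ℝ} (ha₁ : 0 < a₁)
    (ha : a₁ ≤ a₂) (hb₁ : 0 < b₁) (hb : b₁ ≤ b₂) (hc : 0 < c) :
    ∃ K > 0, M.RPGZeroViolation ξ K a₁ a₂ b₁ b₂ c := by
  obtain ⟨πbar, hπbar, hbar⟩ := hslater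
  have := M.nonempty_action hπbar
  have ha₂ : 0 < a₂ := ha₁.trans_le ha
  have hb₂ : 0 < b₂ := hb₁.trans_le hb
  have hg := M.one_sub_γ_pos
  obtain ⟨n, hn⟩ : ∃ x, x = (Fintype.card A : ℝ) := ⟨_, rfl⟩
  have hn1 : 1 ≤ n := by rw [hn]; exact_mod_cast (Fintype.card_pos : 0 < Fintype.card A)
  obtain ⟨Lm, hLm⟩ : ∃ x, x = 2 / ((1 - M.γ) * ξ) := ⟨_, rfl⟩
  have hLm0 : 0 < Lm := by rw [hLm]; positivity
  obtain ⟨Bq, hBq⟩ : ∃ x, x = (2 + Lm) / (1 - M.γ) := ⟨_, rfl⟩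
  obtain ⟨Bv, hBv⟩ : ∃ x, x = 1 / (1 - M.γ) + Lm := ⟨_, rfl⟩
  obtain ⟨CB, hCB⟩ : ∃ x, x = Bq ^ 2 / (1 - M.γ) + Bv ^ 2 / 2 := ⟨_, rfl⟩
  have hCB0 : 0 ≤ CB := by rw [hCB]; positivity
  -- The summand 1 pays for the decayed initial potential, the other one for the stationary level `η
  -- / τ * CB`.
  obtain ⟨CΦ, hCΦ⟩ : ∃ x, x = 1 + a₂ / b₁ * CB := ⟨_, rfl⟩
  have hCΦ0 : 0 < CΦ := by rw [hCΦ]; positivity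
  obtain ⟨Kd, hKd⟩ : ∃ x, x = 1 / (1 - M.γ) * (CΦ + 1 / (1 - M.γ)) := ⟨_, rfl⟩
  obtain ⟨K0, hK0⟩ : ∃ x, x = 1 / (1 - M.γ) * (2 * c / (1 - M.γ)) := ⟨_, rfl⟩
  obtain ⟨K1, hK1⟩ : ∃ x, x = K0 + b₂ * (n / (1 - M.γ)) + b₂ * Lm := ⟨_, rfl⟩
  -- The coefficient of the margin: `K1` is the possible violation of the tightened constraint at
  -- the saddle point, `Kd` the distance of the iterate from the saddle point in value.
  obtain ⟨K2, hK2⟩ : ∃ x, x = K1 + Kd := ⟨_, rfl⟩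
  have hKd0 : 0 < Kd := by rw [hKd]; positivity
  have hK00 : 0 < K0 := by rw [hK0]; positivity
  have hK10 : 0 < K1 := by rw [hK1]; positivity
  have hK20 : 0 < K2 := by rw [hK2]; positivity
  -- The sum of all quantities `x` for which `x * ε ≤ 1` will be needed, so that `ε < 1 / k` implies
  -- each of them.
  obtain ⟨k, hk⟩ : ∃ x, x = 3 + c + b₂ + a₂ * b₂ + 2 * K2 / ξ + b₂ * (n / c) + (n / c / (1 - M.γ) + Lm ^ 2 / 2) := ⟨_, rfl⟩
  have hk0 : 0 < k := by rw [hk]; positivity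
  have hkle : ∀ ε : ℝ, 0 < ε → ε < 1 / k → ∀ x, x ≤ k → x * ε ≤ 1 := by
    intro ε h0 h1 x hx
    rw [lt_div_iff₀ hk0] at h1
    exact (mul_le_mul_of_nonneg_right hx h0.le).trans (by linarith only [h1])
  have hp1 : 0 < a₂ * b₂ := by positivity
  have hp2 : 0 < 2 * K2 / ξ := by positivity
  have hp3 : 0 < b₂ * (n / c) := by positivity
  have hp4 : 0 < n / c / (1 - M.γ) := by positivity
  have hp5 : 0 < Lm ^ 2 / 2 := by positivity
  refine ⟨Kd + K0 + Lm * (K2 + K0) + b₂ * (n / (1 - M.γ)), by positivity,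
    4 / (a₁ * b₁), by positivity, 1 / k, by positivity, fun ε hε hεk => ?_⟩
  have hε3 : 3 * ε ≤ 1 := hkle ε hε hεk _ (by rw [hk]; linarith)
  have hε1 : ε ≤ 1 := by linarith
  have hεc : c * ε ≤ 1 := hkle ε hε hεk _ (by rw [hk]; linarith)
  have hεb : b₂ * ε ≤ 1 := hkle ε hε hεk _ (by rw [hk]; linarith)
  have hεab : a₂ * b₂ * ε ≤ 1 := hkle ε hε hεk _ (by rw [hk]; linarith)
  have hεδ : 2 * K2 / ξ * ε ≤ 1 := hkle ε hε hεk _ (by rw [hk]; linarith)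
  have hεl : b₂ * (n / c) * ε ≤ 1 := hkle ε hε hεk _ (by rw [hk]; linarith)
  have hεΦ : (n / c / (1 - M.γ) + Lm ^ 2 / 2) * ε ≤ 1 := hkle ε hε hεk _ (by rw [hk]; linarith)
  have hδ0 : 0 < K2 * ε := by positivity
  have hδ : K2 * ε ≤ ξ / 2 := by
    have : 2 * K2 / ξ * ε = K2 * ε / (ξ / 2) := by field_simp
    rw [this, div_le_one (by positivity)] at hεδ
    exact hεδ
  have hsq : ε ^ 2 ≤ ε := pow_le_of_le_one hε.le hε1 two_ne_zero
  have hε₀ : 0 < c * ε := by positivity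
  refine ⟨K2 * ε, hδ0, by linarith, fun η τ hη hτ π lam hrpg t ht => ?_⟩
  have hη0 : 0 < η := lt_of_lt_of_le (by positivity) hη.1
  have hτ0 : 0 < τ := lt_of_lt_of_le (by positivity) hτ.1
  have hτε : τ ≤ b₂ * ε := hτ.2.trans (mul_le_mul_of_nonneg_left hsq hb₂.le)
  have hξδ : 0 < ξ - K2 * ε := by linarith
  obtain ⟨h, hh⟩ : ∃ x, x = M.gTight (K2 * ε) := ⟨_, rfl⟩
  rw [← hh] at hrpg
  have hh1 : ∀ s a, |h s a| ≤ 1 := hh ▸ M.abs_gTight_le hδ0.le (by linarith) ⟨πbar, hπbar, hbar⟩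
  have hπr : ∀ t s, π t s ∈ restrictedSimplex A (c * ε) := by
    intro t s
    cases t with
    | zero => exact hrpg.init_π s
    | succ t => exact (hrpg.step_π t s).1
  have hlam : ∀ t, lam t ∈ M.Λ (ξ - K2 * ε) := by
    intro t
    cases t with
    | zero => exact hrpg.init_lam
    | succ t => exact (hrpg.step_lam t).1
  have hπp : ∀ t, π t ∈ policies S A := fun t s => (hπr t s).1
  obtain ⟨πo, hπo, lamo, hlamo, hmax, hmin⟩ :=
    M.exists_restricted_saddle hε₀ hεc hτ0 hξδ ⟨πbar, hπbar⟩ h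
  have hπo' := restricted_subset hπo
  have hlamb : ∀ t, |lam t| ≤ Lm := fun t => hLm ▸ M.dual_bound hξ hδ (hlam t)
  -- A linear bound in place of the logarithm suffices: it meets the factor `τ = O(ε²)` in the
  -- action values and the factor `ε ^ 4` in the transient.
  have hloglin : Real.log (n / (c * ε)) ≤ n / c / ε := by
    have := Real.log_le_sub_one_of_pos (show 0 < n / (c * ε) by positivity)
    have e : n / (c * ε) = n / c / ε := by field_simp
    rw [e] at this ⊢
    linarith
  have hlog0 : ∀ t s a, 0 ≤ -Real.log (π t s a) := fun t s a =>
    neg_nonneg.2 (Real.log_nonpos ((hπp t s).1 a) (coord_le_one (hπp t s) a))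
  have hlogle : ∀ t s a, -Real.log (π t s a) ≤ n / c / ε := fun t s a =>
    (hn ▸ neg_log_restricted_le hε₀ (hπr t s) a).trans hloglin
  have hQ : ∀ t s a, |M.Q (M.regLagr h τ (lam t) (π t)) (π t) s a| ≤ Bq := by
    intro t s a
    rw [hBq]
    refine M.abs_Q_le (hπp t) (fun s a => ?_) s a
    have e1 := M.abs_lagr_le hh1 (hlamb t) s a
    have e2 : τ * -Real.log (π t s a) ≤ 1 := by
      calc τ * -Real.log (π t s a) ≤ (b₂ * ε ^ 2) * (n / c / ε) :=
            mul_le_mul hτ.2 (hlogle t s a) (hlog0 t s a) (by positivity)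
        _ = b₂ * (n / c) * ε := by field_simp
        _ ≤ 1 := hεl
    have e3 : |τ * -Real.log (π t s a)| ≤ 1 := by
      rw [abs_of_nonneg (mul_nonneg hτ0.le (hlog0 t s a))]; exact e2
    calc _ ≤ |M.lagr h (lam t) s a| + |τ * -Real.log (π t s a)| := abs_add_le _ _
      _ ≤ 2 + Lm := by linarith
  have hBv' : ∀ t, |M.V h (π t) + τ * lam t| ≤ Bv := by
    intro t
    rw [hBv]
    refine (abs_add_le _ _).trans (add_le_add (M.abs_V_le (hπp t) hh1) ?_)
    rw [abs_mul, abs_of_pos hτ0]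
    calc τ * |lam t| ≤ 1 * Lm := mul_le_mul (by linarith) (hlamb t) (abs_nonneg _) one_pos.le
      _ = Lm := one_mul _
  have hητ1 : η * τ ≤ 1 := by
    calc η * τ ≤ (a₂ * ε ^ 4) * (b₂ * ε ^ 2) := mul_le_mul hη.2 hτ.2 hτ0.le (by positivity)
      _ = a₂ * b₂ * ε * ε ^ 5 := by ring
      _ ≤ 1 * 1 := mul_le_mul hεab (pow_le_one₀ hε.le hε1) (by positivity) one_pos.le
      _ = 1 := one_mul 1
  obtain ⟨Φ, hΦ⟩ : ∃ Φ : ℕ → ℝ, ∀ t, Φ t = M.regPotential πo πo lamo (π t) (lam t) :=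
    ⟨_, fun _ => rfl⟩
  have hrec : ∀ t, Φ (t + 1) ≤ (1 - η * τ) * Φ t + η * τ * (η / τ * CB) := by
    intro t
    have := M.regPotential_step (eD := 0) (eK := 0) hη0 hε₀ hτ0.le hπo' hπo (hπr t) hlamo
      ((hmax (π t) (hπr t)).trans (hmin _ (hlam t))) (hQ t) (hrpg.step_π t) (hrpg.step_lam t)
      (hBv' t) (fun s => by linarith) (by linarith)
    rw [hΦ, hΦ]
    refine this.trans (le_of_eq ?_)
    simp only [hCB, zero_div, mul_zero, add_zero]
    field_simp
  have hΦ0 : Φ 0 ≤ n / c / ε / (1 - M.γ) + Lm ^ 2 / 2 := by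
    have hl := M.dual_length_le hξ hδ
    rw [← hLm] at hl
    rw [hΦ]
    exact M.regPotential_le hε₀ hπo' hπo (hπr 0) (hlogle 0)
      ⟨hlamo.1, hlamo.2.trans hl⟩ ⟨(hlam 0).1, (hlam 0).2.trans hl⟩
  have hηdτ : η / τ ≤ a₂ / b₁ * ε ^ 2 := by
    rw [div_le_iff₀ hτ0]
    calc η ≤ a₂ * ε ^ 4 := hη.2
      _ = a₂ / b₁ * ε ^ 2 * (b₁ * ε ^ 2) := by field_simp
      _ ≤ _ := mul_le_mul_of_nonneg_left hτ.1 (by positivity)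
  have hΦ00 : 0 ≤ Φ 0 := by
    rw [hΦ]
    exact M.regPotential_nonneg hε₀ hπo' hπo (hπr 0) _ _
  have hΦt : Φ t ≤ CΦ * ε ^ 2 := by
    have h1 := le_of_geometric_recursion hητ1 hrec (by positivity) hΦ00 t
    have h2 : Real.exp (-(η * τ * t)) ≤ ε ^ 4 :=
      exp_neg_le_pow_four hε hε3 (κ := a₁ * b₁) (by positivity) (by
        calc a₁ * b₁ * ε ^ 6 = (a₁ * ε ^ 4) * (b₁ * ε ^ 2) := by ring
          _ ≤ η * τ := mul_le_mul hη.1 hτ.1 (by positivity) hη0.le) ht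
    have h3 : Real.exp (-(η * τ * t)) * Φ 0 ≤ ε ^ 2 := by
      calc _ ≤ ε ^ 4 * (n / c / ε / (1 - M.γ) + Lm ^ 2 / 2) :=
            mul_le_mul h2 hΦ0 hΦ00 (by positivity)
        _ = ε ^ 2 * (ε * (n / c / (1 - M.γ) + ε * (Lm ^ 2 / 2))) := by field_simp
        _ ≤ ε ^ 2 * ((n / c / (1 - M.γ) + Lm ^ 2 / 2) * ε) := by
            refine mul_le_mul_of_nonneg_left ?_ (by positivity)
            have := mul_le_of_le_one_left hp5.le hε1
            rw [mul_comm ε]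
            exact mul_le_mul_of_nonneg_right (add_le_add le_rfl this) hε.le
        _ ≤ ε ^ 2 * 1 := mul_le_mul_of_nonneg_left hεΦ (by positivity)
        _ = ε ^ 2 := mul_one _
    have h4 : η / τ * CB ≤ a₂ / b₁ * ε ^ 2 * CB := mul_le_mul_of_nonneg_right hηdτ hCB0
    have : CΦ * ε ^ 2 = ε ^ 2 + a₂ / b₁ * ε ^ 2 * CB := by rw [hCΦ]; ring
    linarith
  -- The `ℓ¹` distance is bounded by the divergence over `ε`, plus `ε`; with a divergence of order
  -- `ε²` both terms are of order `ε`.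
  have hdev : ∀ f : S → A → ℝ, (∀ s a, |f s a| ≤ 1) → |M.V f πo - M.V f (π t)| ≤ Kd * ε := by
    intro f hf
    have hkl : ∑ s, M.socc πo s * klVec (πo s) (π t s) ≤ CΦ * ε ^ 2 := by
      have : Φ t = ∑ s, M.socc πo s * klVec (πo s) (π t s) + (lam t - lamo) ^ 2 / 2 := hΦ t
      linarith only [sq_nonneg (lam t - lamo), this, hΦt]
    refine (M.abs_V_sub_le_of_kl (e := 0) hε hε₀ hπo' hπo (hπr t) (fun s => by simp) hkl
      hf).trans (le_of_eq ?_)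
    rw [hKd]
    field_simp
    ring
  have hmixV : ∀ π' ∈ policies S A, ∀ f : S → A → ℝ, (∀ s a, |f s a| ≤ 1) →
      |M.V f (fun s => unifMix (c * ε) (π' s)) - M.V f π'| ≤ K0 * ε := by
    intro π' hπ' f hf
    refine (M.abs_V_unifMix_sub_le hπ' hε₀.le hεc one_pos.le hf).trans (le_of_eq ?_)
    rw [hK0]; field_simp
  have hmixmem : ∀ π' ∈ policies S A,
      (fun s => unifMix (c * ε) (π' s)) ∈ restrictedPolicies S A (c * ε) :=
    fun π' hπ' s => unifMix_mem hε₀.le hεc (hπ' s)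
  have hVhg : ∀ π' ∈ policies S A, M.V h π' = M.V M.g π' - K2 * ε := fun π' hπ' =>
    hh ▸ M.V_gTight hπ' _
  have hng : τ * (n / (1 - M.γ)) ≤ b₂ * (n / (1 - M.γ)) * ε := by
    have := mul_le_mul_of_nonneg_right hτε (by positivity : 0 ≤ n / (1 - M.γ))
    linarith
  constructor
  · intro πstar hstar
    have e1 := abs_le.1 (hmixV πstar hstar.1 M.r M.abs_r_le)
    have e2 := abs_le.1 (hmixV πstar hstar.1 h hh1)
    have e3 := abs_le.1 (hdev M.r M.abs_r_le)
    rw [hVhg πstar hstar.1] at e2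
    have e4 := M.V_r_saddle_ge (e := (K2 + K0) * ε) hτ0.le (by positivity) hξδ hπo'
      (restricted_subset (hmixmem πstar hstar.1)) hlamo (hmax _ (hmixmem πstar hstar.1)) hmin
      (by linarith [hstar.2.1])
    rw [← hn] at e4
    have e5 := mul_le_mul_of_nonneg_right (hLm ▸ M.dual_length_le hξ hδ)
      (by positivity : 0 ≤ (K2 + K0) * ε)
    have e6 : Lm * ((K2 + K0) * ε) = Lm * (K2 + K0) * ε := by ring
    have e7 : (Kd + K0 + Lm * (K2 + K0) + b₂ * (n / (1 - M.γ))) * ε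
        = Kd * ε + K0 * ε + Lm * (K2 + K0) * ε + b₂ * (n / (1 - M.γ)) * ε := by ring
    linarith
  · have e1 := abs_le.1 (hmixV πbar hπbar h hh1)
    have e2 := abs_le.1 (hdev h hh1)
    rw [hVhg πbar hπbar] at e1
    rw [hVhg (π t) (hπp t)] at e2
    have hξ1 : (1 - M.γ) * (ξ - K2 * ε) ≤ 1 := by
      have e3 := M.add_le_of_slater hπbar hbar
      have e4 := mul_pos hg M.b_mem.1
      have e5 := mul_pos hg hδ0
      have e6 : (1 - M.γ) * (ξ - K2 * ε)
          = (1 - M.γ) * (M.b + ξ) - (1 - M.γ) * M.b - (1 - M.γ) * (K2 * ε) := by ring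
      rw [e6]
      linarith only [e3, e4, e5]
    have e3 := M.V_saddle_ge (e := K0 * ε) hξδ hξ1 hτ0.le (by positivity) hπo'
      (restricted_subset (hmixmem πbar hπbar)) hlamo (hmax _ (hmixmem πbar hπbar)) hmin
      (by linarith)
    rw [← hn] at e3
    have e4 := mul_le_mul_of_nonneg_left (hLm ▸ M.dual_length_le hξ hδ) hτ0.le
    have e5 := mul_le_mul_of_nonneg_right hτε hLm0.le
    have e6 : K2 * ε = K0 * ε + b₂ * (n / (1 - M.γ)) * ε + b₂ * ε * Lm + Kd * ε := by
      rw [hK2, hK1]; ring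
    linarith

lemma rescaled_time_le {C K ε : ℝ} (hC : 0 < C) (hK : 0 < K) (hε : 0 < ε) (h1 : ε < K)
    (h2 : K * ε < 1) :
    C * (1 / (ε / K) ^ 6 * Real.log (1 / (ε / K)) ^ 2)
      ≤ 4 * C * K ^ 6 * (1 / ε ^ 6 * Real.log (1 / ε) ^ 2) := by
  have e : Real.log (1 / (ε / K)) = Real.log K + Real.log (1 / ε) := by
    rw [← Real.log_mul hK.ne' (by positivity)]
    congr 1
    field_simp
  have h3 : 0 ≤ Real.log (1 / (ε / K)) :=
    Real.log_nonneg (by rw [one_div_div, le_div_iff₀ hε]; linarith)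
  have h4 : Real.log K ≤ Real.log (1 / ε) :=
    Real.log_le_log hK (by rw [le_div_iff₀ hε]; exact h2.le)
  have h5 : Real.log (1 / (ε / K)) ^ 2 ≤ 4 * Real.log (1 / ε) ^ 2 := by
    rw [e] at h3 ⊢
    nlinarith
  calc _ ≤ C * (1 / (ε / K) ^ 6 * (4 * Real.log (1 / ε) ^ 2)) := by gcongr
    _ = _ := by field_simp

/-- Substituting `ε / K` for `ε` turns the gap `K ε` into `ε`; the powers of `K` in the parameters
are those by which `ε` enters them. The iteration bound keeps its form by `rescaled_time_le`. -/
lemma rpgZeroViolation_one {ξ K : ℝ} (hK : 0 < K) (h : M.RPGZeroViolation ξ K 1 1 1 1 1) :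
    M.RPGZeroViolation ξ 1 (1 / K ^ 4) (1 / K ^ 4) (1 / K ^ 2) (1 / K ^ 2) (1 / K) := by
  obtain ⟨C, hC, εbar, hεbar, h⟩ := h
  refine ⟨4 * C * K ^ 6, by positivity, min (K * εbar) (min K (1 / K)), by positivity,
    fun ε hε hlt => ?_⟩
  simp only [lt_min_iff] at hlt
  obtain ⟨hl1, hl2, hl3⟩ := hlt
  rw [lt_div_iff₀ hK] at hl3
  obtain ⟨δ, hδ, hδξ, H⟩ := h (ε / K) (by positivity) (by rw [div_lt_iff₀ hK]; linarith)
  refine ⟨δ, hδ, hδξ, fun η τ hη hτ π lam hrpg t ht => ?_⟩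
  have e4 : 1 / K ^ 4 * ε ^ 4 = 1 * (ε / K) ^ 4 := by field_simp
  have e2 : 1 / K ^ 2 * ε ^ 2 = 1 * (ε / K) ^ 2 := by field_simp
  have e1 : 1 / K * ε = 1 * (ε / K) := by field_simp
  rw [e4] at hη
  rw [e2] at hτ
  rw [e1] at hrpg
  have := H η τ hη hτ π lam hrpg t
    ((rescaled_time_le hC hK hε hl2 (by linarith)).trans ht)
  rwa [mul_div_cancel₀ ε hK.ne', ← one_mul ε] at this

end CMDP

namespace CMDP

variable {S : Type uS} {A : Type uA} [Fintype S] [Fintype A] (M : CMDP S A)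

/-! ### Linear features: covariance, condition number, transfer of errors -/

section Features

variable {d : ℕ} (φ : S → A → EuclideanSpace ℝ (Fin d))

lemma covForm_nonneg {μ : S × A → ℝ} (hμ : ∀ x, 0 ≤ μ x) (w : EuclideanSpace ℝ (Fin d)) :
    0 ≤ covForm φ μ w := Finset.sum_nonneg fun x _ => mul_nonneg (hμ x) (sq_nonneg _)

/-- A feature vanishing on the kernel of the covariance is dominated by the covariance. -/
lemma exists_sq_inner_le_covForm {ν : S × A → ℝ} (hν : ∀ x, 0 ≤ ν x)
    (v : EuclideanSpace ℝ (Fin d)) (hv : ∀ w, covForm φ ν w = 0 → inner ℝ v w = 0) :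
    ∃ κ : ℝ, 0 ≤ κ ∧ ∀ w, inner ℝ v w ^ 2 ≤ κ * covForm φ ν w := by
  set L : S × A → Module.Dual ℝ (EuclideanSpace ℝ (Fin d)) := fun x =>
    √(ν x) • (innerSL ℝ (φ x.1 x.2)).toLinearMap with hL
  have hLx : ∀ x w, L x w = √(ν x) * inner ℝ (φ x.1 x.2) w := fun x w => rfl
  have hcov : ∀ w, covForm φ ν w = ∑ x, L x w ^ 2 := fun w =>
    Finset.sum_congr rfl fun x _ => by rw [hLx, mul_pow, Real.sq_sqrt (hν x)]
  -- The kernel of the covariance form is the common kernel of the weighted features. A linear form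
  -- vanishing on it is a combination of those features, and Cauchy-Schwarz gives the bound.
  have hker : (⨅ x, LinearMap.ker (L x)) ≤ LinearMap.ker (innerSL ℝ v).toLinearMap := by
    intro w hw
    rw [Submodule.mem_iInf] at hw
    refine hv w ?_
    rw [hcov]
    exact Finset.sum_eq_zero fun x _ => by
      rw [LinearMap.mem_ker.1 (hw x)]; ring
  obtain ⟨k, hk⟩ := (Submodule.mem_span_range_iff_exists_fun ℝ).1 (mem_span_of_iInf_ker_le_ker hker)
  refine ⟨∑ x, k x ^ 2, Finset.sum_nonneg fun x _ => sq_nonneg _, fun w => ?_⟩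
  have e : inner ℝ v w = ∑ x, k x * L x w := by
    have := congrArg (fun f : Module.Dual ℝ (EuclideanSpace ℝ (Fin d)) => f w) hk
    simp only [LinearMap.sum_apply, LinearMap.smul_apply, smul_eq_mul] at this
    exact this.symm
  rw [e, hcov]
  exact Finset.sum_mul_sq_le_sq_mul_sq _ _ _

lemma covForm_eq_zero_of_relCond {μ ν : S × A → ℝ} (hμ : ∀ x, 0 ≤ μ x)
    (h : relCond φ μ ν < ⊤) {w : EuclideanSpace ℝ (Fin d)} (hw : covForm φ ν w = 0) :
    covForm φ μ w = 0 := by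
  by_contra hne
  have hpos : 0 < covForm φ μ w := lt_of_le_of_ne (covForm_nonneg φ hμ w) (Ne.symm hne)
  have h1 : ENNReal.ofReal (covForm φ μ w) / ENNReal.ofReal (covForm φ ν w) = ⊤ := by
    rw [hw, ENNReal.ofReal_zero]
    exact ENNReal.div_zero (ENNReal.ofReal_pos.2 hpos).ne'
  have h2 : ENNReal.ofReal (covForm φ μ w) / ENNReal.ofReal (covForm φ ν w) ≤ relCond φ μ ν :=
    le_iSup (fun w => ENNReal.ofReal (covForm φ μ w) / ENNReal.ofReal (covForm φ ν w)) w
  rw [h1] at h2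
  exact absurd h (not_lt.2 h2)

/-- A bound on the relative condition number that is uniform over the target distribution. -/
lemma exists_covForm_le {ν : S × A → ℝ} (hν : ∀ x, 0 ≤ ν x) :
    ∃ κ : ℝ, 0 ≤ κ ∧ ∀ μ : S × A → ℝ, (∀ x, 0 ≤ μ x) → (∀ x, μ x ≤ 1) → relCond φ μ ν < ⊤ →
      ∀ w, covForm φ μ w ≤ κ * covForm φ ν w := by
  -- The constants are chosen pair by pair, before any target distribution is given; pairs whose
  -- feature is not dominated get the value zero and will carry no mass.
  have hex : ∀ x : S × A, ∃ κ : ℝ, 0 ≤ κ ∧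
      ((∀ w, covForm φ ν w = 0 → inner ℝ (φ x.1 x.2) w = 0) →
        ∀ w, inner ℝ (φ x.1 x.2) w ^ 2 ≤ κ * covForm φ ν w) := by
    intro x
    by_cases hx : ∀ w, covForm φ ν w = 0 → inner ℝ (φ x.1 x.2) w = 0
    · obtain ⟨κ, h0, h⟩ := exists_sq_inner_le_covForm φ hν _ hx
      exact ⟨κ, h0, fun _ => h⟩
    · exact ⟨0, le_rfl, fun h => absurd h hx⟩
  choose κ hκ0 hκ using hex
  refine ⟨∑ x, κ x, Finset.sum_nonneg fun x _ => hκ0 x, fun μ hμ0 hμ1 hrel w => ?_⟩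
  rw [Finset.sum_mul]
  refine Finset.sum_le_sum fun x _ => ?_
  rcases (hμ0 x).eq_or_lt with h | h
  · rw [← h, zero_mul]
    exact mul_nonneg (hκ0 x) (covForm_nonneg φ hν w)
  -- Finiteness of the condition number forces every feature in the support of `μ` to vanish on the
  -- kernel of the covariance of `ν`.
  · have h1 := hκ x (fun w hw => by
      have h2 := covForm_eq_zero_of_relCond φ hμ0 hrel hw
      rw [covForm, Finset.sum_eq_zero_iff_of_nonneg fun x _ =>
        mul_nonneg (hμ0 x) (sq_nonneg _)] at h2
      have h3 := h2 x (Finset.mem_univ x)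
      exact pow_eq_zero_iff two_ne_zero |>.1 ((mul_eq_zero.1 h3).resolve_left h.ne')) w
    calc _ ≤ 1 * inner ℝ (φ x.1 x.2) w ^ 2 := mul_le_mul_of_nonneg_right (hμ1 x) (sq_nonneg _)
      _ ≤ _ := by rw [one_mul]; exact h1

/-- Excess error over a minimizer dominates the covariance of the difference. -/
lemma covForm_sub_le {μ : S × A → ℝ} {q : S → A → ℝ} {wstar : EuclideanSpace ℝ (Fin d)}
    (hmin : ∀ v, approxError φ wstar q μ ≤ approxError φ v q μ) (w : EuclideanSpace ℝ (Fin d)) :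
    covForm φ μ (w - wstar) ≤ approxError φ w q μ - approxError φ wstar q μ := by
  set cr := ∑ x : S × A, μ x * (2 * (inner ℝ (φ x.1 x.2) wstar - q x.1 x.2)
    * inner ℝ (φ x.1 x.2) (w - wstar)) with hcr
  have hexp : ∀ θ : ℝ, approxError φ (wstar + θ • (w - wstar)) q μ
      = approxError φ wstar q μ + θ * cr + θ ^ 2 * covForm φ μ (w - wstar) := by
    intro θ
    simp only [approxError, covForm, hcr, Finset.mul_sum, ← Finset.sum_add_distrib, inner_add_right,
      inner_smul_right]
    exact Finset.sum_congr rfl fun x _ => by ring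
  -- First-order optimality: the error is quadratic along the segment towards `w`, so its linear
  -- coefficient at the minimizer is nonnegative.
  have h0 : 0 ≤ cr := nonneg_of_forall_quadratic (b := covForm φ μ (w - wstar)) fun θ _ _ => by
    have := hmin (wstar + θ • (w - wstar))
    rw [hexp] at this
    linarith
  have h1 := hexp 1
  rw [one_smul, add_sub_cancel] at h1
  linarith

/-- The time-zero term of the visitation distribution. It lets the on-policy covariance dominate
that of `ν`. -/
lemma le_saVisit {π : S → A → ℝ} (hπ : π ∈ policies S A) {ν : S × A → ℝ}
    (hν : ν ∈ stdSimplex ℝ (S × A)) (x : S × A) : (1 - M.γ) * ν x ≤ M.saVisit π ν x := by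
  rw [saVisit_eq, M.occ_flow hπ hν]
  refine mul_le_mul_of_nonneg_left ?_ M.one_sub_γ_pos.le
  have := mul_nonneg (mul_nonneg M.γ_mem.1 (Finset.sum_nonneg fun (y : S × A)
    (_ : y ∈ Finset.univ) => mul_nonneg (M.occ_nonneg hπ hν.1 y) ((M.P_mem y.1 y.2).1 x.1)))
    ((hπ x.1).1 x.2)
  linarith

/-- Error under the target distribution in terms of the transfer and the statistical errors. -/
lemma approxError_transfer_le {π : S → A → ℝ} (hπ : π ∈ policies S A) {ν μ : S × A → ℝ}
    (hν : ν ∈ stdSimplex ℝ (S × A)) (hμ : ∀ x, 0 ≤ μ x) {κ : ℝ} (hκ : 0 ≤ κ)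
    (hcov : ∀ w, covForm φ μ w ≤ κ * covForm φ ν w) {q : S → A → ℝ}
    {w wstar : EuclideanSpace ℝ (Fin d)}
    (hmin : ∀ v, approxError φ wstar q (M.saVisit π ν) ≤ approxError φ v q (M.saVisit π ν)) :
    approxError φ w q μ ≤ 2 * approxError φ wstar q μ + 2 * (κ / (1 - M.γ)) *
      (approxError φ w q (M.saVisit π ν) - approxError φ wstar q (M.saVisit π ν)) := by
  have h1 : approxError φ w q μ ≤ 2 * approxError φ wstar q μ + 2 * covForm φ μ (w - wstar) := by
    simp only [approxError, covForm, Finset.mul_sum, ← Finset.sum_add_distrib]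
    refine Finset.sum_le_sum fun x _ => ?_
    rw [inner_sub_right]
    have := mul_nonneg (hμ x) (sq_nonneg ((inner ℝ (φ x.1 x.2) wstar - q x.1 x.2)
      - (inner ℝ (φ x.1 x.2) w - inner ℝ (φ x.1 x.2) wstar)))
    nlinarith
  have h2 : (1 - M.γ) * covForm φ ν (w - wstar) ≤ covForm φ (M.saVisit π ν) (w - wstar) := by
    rw [covForm, covForm, Finset.mul_sum]
    refine Finset.sum_le_sum fun x _ => ?_
    rw [← mul_assoc]
    exact mul_le_mul_of_nonneg_right (M.le_saVisit hπ hν x) (sq_nonneg _)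
  have h3 := h2.trans (covForm_sub_le φ hmin w)
  have h4 : κ * covForm φ ν (w - wstar) ≤ κ / (1 - M.γ) *
      (approxError φ w q (M.saVisit π ν) - approxError φ wstar q (M.saVisit π ν)) := by
    rw [div_mul_eq_mul_div, le_div_iff₀ M.one_sub_γ_pos]
    nlinarith
  linarith [hcov (w - wstar)]

lemma nuStar_mem_Icc {π : S → A → ℝ} (hπ : π ∈ policies S A) (x : S × A) :
    M.nuStar π x ∈ Set.Icc (0 : ℝ) 1 := by
  have hg := M.one_sub_γ_pos
  have h0 := M.socc_nonneg hπ x.1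
  have h1 := M.socc_le hπ x.1
  have hc : (1 : ℝ) ≤ Fintype.card A := by exact_mod_cast Fintype.card_pos_iff.2 ⟨x.2⟩
  rw [nuStar, dρ_eq]
  rw [le_div_iff₀ hg] at h1
  refine ⟨by positivity, mul_le_one₀ (by linarith) (by positivity) ?_⟩
  rw [div_le_one (by linarith)]
  exact hc

lemma socc_eq_nuStar [Nonempty A] (π : S → A → ℝ) (s : S) (a : A) :
    M.socc π s = Fintype.card A / (1 - M.γ) * M.nuStar π (s, a) := by
  have hg := M.one_sub_γ_pos.ne'
  rw [nuStar, dρ_eq]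
  field_simp

/-- Cost of replacing the action values by a linear direction and the comparator by its mixture with
the uniform policy. -/
lemma direction_error [Nonempty A] {W ε₀ α : ℝ} (hα : 0 < α) (hε₀ : 0 ≤ ε₀)
    {πo π : S → A → ℝ} (hπo : πo ∈ policies S A) (hπ : π ∈ policies S A)
    {w : EuclideanSpace ℝ (Fin d)} (hw : ∀ s a, |inner ℝ (φ s a) w| ≤ W) (hW : 0 ≤ W)
    (q : S → A → ℝ) :
    ∑ s, M.socc πo s * ∑ a, (πo s a - π s a) * q s a
      - (Fintype.card A / (1 - M.γ) * (approxError φ w q (M.nuStar πo) / (2 * α) + α / 2)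
        + W * (2 * ε₀) / (1 - M.γ))
    ≤ ∑ s, M.socc πo s * ∑ a, (unifMix ε₀ (πo s) a - π s a) * inner ℝ (φ s a) w := by
  have h1 : ∀ s, ∑ a, (πo s a - π s a) * q s a
      - (∑ a, ((inner ℝ (φ s a) w - q s a) ^ 2 / (2 * α) + α / 2)) - W * (2 * ε₀)
      ≤ ∑ a, (unifMix ε₀ (πo s) a - π s a) * inner ℝ (φ s a) w := by
    intro s
    have e1 : ∑ a, (unifMix ε₀ (πo s) a - π s a) * inner ℝ (φ s a) w
        = ∑ a, (πo s a - π s a) * q s a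
          + ∑ a, (πo s a - π s a) * (inner ℝ (φ s a) w - q s a)
          + ∑ a, (unifMix ε₀ (πo s) a - πo s a) * inner ℝ (φ s a) w := by
      rw [← Finset.sum_add_distrib, ← Finset.sum_add_distrib]
      exact Finset.sum_congr rfl fun a _ => by ring
    have e2 := neg_le_of_abs_le (abs_sum_mul_le (x := fun a => unifMix ε₀ (πo s) a - πo s a) (hw s))
    have e3 := mul_le_mul_of_nonneg_left (l1_unifMix_sub_le hε₀ (hπo s)) hW
    have e4 : -∑ a, ((inner ℝ (φ s a) w - q s a) ^ 2 / (2 * α) + α / 2)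
        ≤ ∑ a, (πo s a - π s a) * (inner ℝ (φ s a) w - q s a) := by
      rw [← Finset.sum_neg_distrib]
      refine Finset.sum_le_sum fun a _ => ?_
      set y := inner ℝ (φ s a) w - q s a
      have h5 : |πo s a - π s a| ≤ 1 := abs_le.2
        ⟨by linarith [(hπo s).1 a, coord_le_one (hπ s) a],
          by linarith [(hπ s).1 a, coord_le_one (hπo s) a]⟩
      have h6 : |(πo s a - π s a) * y| ≤ |y| := by
        rw [abs_mul]; exact mul_le_of_le_one_left (abs_nonneg _) h5
      -- Young's inequality with a free parameter `α`. The bound is then affine in the squared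
      -- error, so expectations can be taken without Jensen's inequality.
      have h7 : |y| ≤ y ^ 2 / (2 * α) + α / 2 := by
        rw [← sq_abs, div_add' _ _ _ (by positivity), le_div_iff₀ (by positivity)]
        nlinarith [sq_nonneg (|y| - α)]
      linarith [neg_le_of_abs_le h6]
    rw [e1]
    linarith
  have h2 := Finset.sum_le_sum fun s (_ : s ∈ Finset.univ) =>
    mul_le_mul_of_nonneg_left (h1 s) (M.socc_nonneg hπo s)
  refine le_trans (le_of_eq ?_) h2
  simp only [mul_sub, Finset.sum_sub_distrib, ← Finset.sum_mul, M.sum_socc hπo]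
  have e5 : ∑ s, M.socc πo s * ∑ a, ((inner ℝ (φ s a) w - q s a) ^ 2 / (2 * α) + α / 2)
      = Fintype.card A / (1 - M.γ) * (approxError φ w q (M.nuStar πo) / (2 * α) + α / 2) := by
    simp only [Finset.sum_add_distrib, mul_add, Finset.sum_const, Finset.card_univ, nsmul_eq_mul]
    rw [← Finset.sum_mul, M.sum_socc hπo]
    congr 1
    · rw [approxError, Fintype.sum_prod_type, Finset.sum_div, Finset.mul_sum]
      refine Finset.sum_congr rfl fun s _ => ?_
      rw [Finset.mul_sum, Finset.sum_div, Finset.mul_sum]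
      refine Finset.sum_congr rfl fun a _ => ?_
      rw [M.socc_eq_nuStar πo s a]
      ring
    · ring
  rw [e5]
  ring

/-- The bound does not involve `ε₀`: the initial potential stays bounded although the restricted
simplex may be arbitrarily close to the full one. -/
lemma neg_log_logLinear_le [Nonempty A] (hφ : ∀ s a, ‖φ s a‖ ≤ 1) (θ : EuclideanSpace ℝ (Fin d))
    (s : S) (a : A) : -Real.log (logLinear φ θ s a) ≤ 2 * ‖θ‖ + Fintype.card A := by
  have hin : ∀ a, |inner ℝ (φ s a) θ| ≤ ‖θ‖ := fun a =>
    (abs_real_inner_le_norm _ _).trans (mul_le_of_le_one_left (norm_nonneg _) (hφ s a))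
  have hsum : 0 < ∑ a', Real.exp (inner ℝ (φ s a') θ) :=
    Finset.sum_pos (fun _ _ => Real.exp_pos _) Finset.univ_nonempty
  rw [logLinear, Real.log_div (Real.exp_pos _).ne' hsum.ne', Real.log_exp]
  have hn : (0 : ℝ) < Fintype.card A := by exact_mod_cast Fintype.card_pos
  have h1 : ∑ a', Real.exp (inner ℝ (φ s a') θ) ≤ Fintype.card A * Real.exp ‖θ‖ := by
    calc _ ≤ ∑ _a' : A, Real.exp ‖θ‖ := Finset.sum_le_sum fun a' _ =>
          Real.exp_le_exp.2 ((le_abs_self _).trans (hin a'))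
      _ = _ := by simp
  have h2 := Real.log_le_log hsum h1
  rw [Real.log_mul hn.ne' (Real.exp_pos _).ne', Real.log_exp] at h2
  have h3 := Real.log_le_sub_one_of_pos hn
  have h4 := neg_le_of_abs_le (hin a)
  linarith

end Features

/-! ### Measurability and integrability along random iterates -/

section Random

variable {Ω : Type uΩ} [MeasurableSpace Ω]

/-- The partial sums of the occupancy series are continuous in the policy, and they converge
pointwise. -/
lemma measurable_V {π : Ω → S → A → ℝ} (hm : ∀ s a, Measurable fun ω => π ω s a)
    (hπ : ∀ ω, π ω ∈ policies S A) (c : S → A → ℝ) : Measurable fun ω => M.V c (π ω) := by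
  have hm' : Measurable π := measurable_pi_lambda _ fun s => measurable_pi_lambda _ fun a => hm s a
  have hocc : ∀ x, Measurable fun ω => M.occ (π ω) (M.start (π ω)) x := by
    intro x
    refine measurable_of_tendsto_metrizable (f := fun n ω =>
      ∑ t ∈ Finset.range n, M.γ ^ t * M.law (π ω) (M.start (π ω)) t x) (fun n => ?_) ?_
    · exact Finset.measurable_fun_sum _ fun t _ =>
        ((M.continuousOn_law x t).measurable.comp hm').const_mul _
    · rw [tendsto_pi_nhds]
      exact fun ω => (M.summable_law (hπ ω) (M.start_mem (hπ ω)) x).hasSum.tendsto_sum_nat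
  have e : (fun ω => M.V c (π ω))
      = fun ω => ∑ x : S × A, M.occ (π ω) (M.start (π ω)) x * c x.1 x.2 := by
    funext ω
    exact M.discountedSum_eq (hπ ω) (M.start_mem (hπ ω)) c
  rw [e]
  exact Finset.measurable_fun_sum _ fun x _ => (hocc x).mul_const _

lemma integrable_V {Pr : Measure Ω} [IsFiniteMeasure Pr] {π : Ω → S → A → ℝ}
    (hm : ∀ s a, Measurable fun ω => π ω s a) (hπ : ∀ ω, π ω ∈ policies S A) {c : S → A → ℝ}
    (hc : ∀ s a, |c s a| ≤ 1) : Integrable (fun ω => M.V c (π ω)) Pr :=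
  Integrable.of_bound (M.measurable_V hm hπ c).aestronglyMeasurable (1 / (1 - M.γ))
    (Filter.Eventually.of_forall fun ω => M.abs_V_le (hπ ω) hc)

lemma integrable_regPotential {Pr : Measure Ω} [IsFiniteMeasure Pr] {ε₀ l : ℝ} (hε₀ : 0 < ε₀)
    {πo po : S → A → ℝ} {π : Ω → S → A → ℝ} {lamo : ℝ} {lam : Ω → ℝ}
    (hm : ∀ s a, Measurable fun ω => π ω s a) (hlm : Measurable lam)
    (hπo : πo ∈ policies S A) (hpo : ∀ s, po s ∈ restrictedSimplex A ε₀)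
    (hπ : ∀ ω s, π ω s ∈ restrictedSimplex A ε₀) (hlamo : lamo ∈ Set.Icc 0 l)
    (hlam : ∀ ω, lam ω ∈ Set.Icc 0 l) :
    Integrable (fun ω => M.regPotential πo po lamo (π ω) (lam ω)) Pr := by
  refine Integrable.of_bound (Measurable.aestronglyMeasurable ?_)
    (Real.log (Fintype.card A / ε₀) / (1 - M.γ) + l ^ 2 / 2)
    (Filter.Eventually.of_forall fun ω => ?_)
  · simp only [regPotential, klVec]
    refine Measurable.add (Finset.measurable_fun_sum _ fun s _ => Measurable.const_mul
      (Finset.measurable_fun_sum _ fun a _ => Measurable.const_mul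
        (Real.measurable_log.comp ((hm s a).const_div _)) _) _) ?_
    exact ((hlm.sub_const _).pow_const 2).div_const 2
  · rw [Real.norm_eq_abs, abs_of_nonneg (M.regPotential_nonneg hε₀ hπo hpo (hπ ω) _ _)]
    exact M.regPotential_le hε₀ hπo hpo (hπ ω) (fun s a => neg_log_restricted_le hε₀ (hπ ω s) a)
      hlamo (hlam ω)

end Random

end CMDP

/-! ### Zero violation of inexact RPG-PD -/

namespace CMDP

variable {S : Type uS} {A : Type uA} [Fintype S] [Fintype A] (M : CMDP S A)

/-- Bounding the logarithm of `n / ε₀` by twice its square root leaves `2 √(n ε₀)`, which is at most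
`ε²` under the hypothesis. -/
lemma mul_log_div_le {n ε₀ ε : ℝ} (hn : 0 < n) (hε : 0 < ε) (hε₀ : 0 < ε₀)
    (h : ε₀ * (4 * n) ≤ ε ^ 4) : ε₀ * Real.log (n / ε₀) ≤ ε ^ 2 := by
  set y := √(n / ε₀) with hy
  have hy0 : 0 < y := Real.sqrt_pos.2 (by positivity)
  have hy2 : y ^ 2 = n / ε₀ := Real.sq_sqrt (by positivity)
  have h1 : Real.log (n / ε₀) ≤ 2 * y := by
    rw [← hy2, Real.log_pow]
    have := Real.log_le_sub_one_of_pos hy0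
    push_cast
    linarith
  have h2 : ε₀ * y ^ 2 = n := by rw [hy2]; field_simp
  have h3 : 2 * n ≤ ε ^ 2 * y := by
    refine (pow_le_pow_iff_left₀ (by positivity) (by positivity) two_ne_zero).1 ?_
    have : (ε ^ 2 * y) ^ 2 = ε ^ 4 * (n / ε₀) := by rw [mul_pow, hy2]; ring
    rw [this]
    calc (2 * n) ^ 2 = ε₀ * (4 * n) * (n / ε₀) := by field_simp; ring
      _ ≤ _ := mul_le_mul_of_nonneg_right h (by positivity)
  have h4 : ε₀ * (2 * y) * y ≤ ε ^ 2 * y := by nlinarith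
  have h5 := le_of_mul_le_mul_right h4 hy0
  exact (mul_le_mul_of_nonneg_left h1 hε₀.le).trans h5

section Expectation

variable {d : ℕ} {φ : S → A → EuclideanSpace ℝ (Fin d)} {Ω : Type uΩ} [MeasurableSpace Ω]

/-- The expected Lyapunov function of the inexact method contracts up to an error. -/
lemma inexact_expected_step [Nonempty A] (hφ : ∀ s a, ‖φ s a‖ ≤ 1) {W : ℝ} (hW : 0 ≤ W)
    {ν : S × A → ℝ} (hν : ν ∈ stdSimplex ℝ (S × A)) {θ₀ : EuclideanSpace ℝ (Fin d)}
    {h : S → A → ℝ} (hh : ∀ s a, |h s a| ≤ 1) {κ : ℝ} (hκ0 : 0 ≤ κ) {ξ τ η ε₀ α l εstat εbias : ℝ}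
    (hη : 0 < η) (hτ : 0 < τ) (hτ1 : τ ≤ 1) (hε₀ : 0 < ε₀) (hε₀1 : ε₀ ≤ 1) (hα : 0 < α)
    (hl : ∀ lam ∈ M.Λ ξ, |lam| ≤ l)
    {Pr : Measure Ω} [IsProbabilityMeasure Pr] {w wstar : ℕ → Ω → EuclideanSpace ℝ (Fin d)}
    {π : ℕ → Ω → S → A → ℝ} {lam : ℕ → Ω → ℝ} {πτ : S → A → ℝ} {lamτ : ℝ}
    (hsad : M.IsRegSaddle h ξ τ πτ lamτ)
    (hκ : ∀ w, covForm φ (M.nuStar πτ) w ≤ κ * covForm φ ν w)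
    (hrpg : M.IsInexactRPG φ W θ₀ h ξ τ η ε₀ w π lam)
    (herr : M.BoundedErrors φ ν h τ εstat εbias πτ Pr w wstar π lam) (t : ℕ) :
    ∫ ω, M.regPotential πτ (fun s => unifMix ε₀ (πτ s)) lamτ (π (t + 1) ω) (lam (t + 1) ω) ∂Pr
      ≤ (1 - η * τ)
          * ∫ ω, M.regPotential πτ (fun s => unifMix ε₀ (πτ s)) lamτ (π t ω) (lam t ω) ∂Pr
        + η * (Fintype.card A / (1 - M.γ)
            * ((2 * εbias + 2 * (κ / (1 - M.γ)) * εstat) / (2 * α) + α / 2)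
          + W * (2 * ε₀) / (1 - M.γ)
          + τ * (ε₀ * Real.log (Fintype.card A / ε₀) / (1 - M.γ)))
        + η ^ 2 * (W ^ 2 / (1 - M.γ) + (1 / (1 - M.γ) + l) ^ 2 / 2) := by
  obtain ⟨hπτ, hlamτ, hmax, hmin⟩ := hsad
  have hg := M.one_sub_γ_pos
  have hπr : ∀ t ω s, π t ω s ∈ restrictedSimplex A ε₀ := by
    intro t ω s
    cases t with
    | zero => exact hrpg.init_mem ω s
    | succ t => exact (hrpg.step_π t ω s).1
  have hlam : ∀ t ω, lam t ω ∈ M.Λ ξ := by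
    intro t ω
    cases t with
    | zero =>
      obtain ⟨lam₀, h0, h1⟩ := hrpg.init_lam
      rw [h1]; exact h0
    | succ t => exact (hrpg.step_lam t ω).1
  have hπp : ∀ t ω, π t ω ∈ policies S A := fun t ω s => (hπr t ω s).1
  have hpo : ∀ s, unifMix ε₀ (πτ s) ∈ restrictedSimplex A ε₀ := fun s =>
    unifMix_mem hε₀.le hε₀1 (hπτ s)
  have hwW : ∀ t ω s a, |inner ℝ (φ s a) (w t ω)| ≤ W := fun t ω s a =>
    (abs_real_inner_le_norm _ _).trans ((mul_le_of_le_one_left (norm_nonneg _) (hφ s a)).trans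
      (hrpg.norm_w t ω))
  obtain ⟨Φ, hΦ⟩ : ∃ Φ : ℕ → Ω → ℝ, ∀ t, Φ t = fun ω =>
      M.regPotential πτ (fun s => unifMix ε₀ (πτ s)) lamτ (π t ω) (lam t ω) := ⟨_, fun _ => rfl⟩
  have hint : ∀ t, Integrable (Φ t) Pr := fun t => by
    rw [hΦ]
    exact M.integrable_regPotential hε₀ (hrpg.meas_π t) (hrpg.meas_lam t) hπτ hpo (hπr t) hlamτ
      (hlam t)
  obtain ⟨q, hq⟩ : ∃ q : Ω → S → A → ℝ, ∀ ω, q ω = M.Q (M.regLagr h τ (lam t ω) (π t ω)) (π t ω) :=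
    ⟨_, fun _ => rfl⟩
  obtain ⟨X, hX⟩ : ∃ X : Ω → ℝ, X = fun ω => approxError φ (w t ω) (q ω) (M.saVisit (π t ω) ν)
    - approxError φ (wstar t ω) (q ω) (M.saVisit (π t ω) ν) := ⟨_, rfl⟩
  obtain ⟨Y, hY⟩ : ∃ Y : Ω → ℝ, Y = fun ω => approxError φ (wstar t ω) (q ω) (M.nuStar πτ) :=
    ⟨_, rfl⟩
  have hXi : Integrable X Pr := by simp only [hX, hq]; exact herr.integrable_stat t
  have hYi : Integrable Y Pr := by simp only [hY, hq]; exact herr.integrable_bias t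
  have hXle : ∫ ω, X ω ∂Pr ≤ εstat := by simp only [hX, hq]; exact herr.stat t
  have hYle : ∫ ω, Y ω ∂Pr ≤ εbias := by simp only [hY, hq]; exact herr.bias t
  have hn0 : (0 : ℝ) ≤ Fintype.card A / (1 - M.γ) := by positivity
  -- The step inequality holds for each outcome and is affine in the potential and in the two error
  -- variables `X`, `Y`; integrating it is all that remains.
  have hpt : ∀ ω, Φ (t + 1) ω ≤ (1 - η * τ) * Φ t ω
      + η * (Fintype.card A / (1 - M.γ)
            * ((2 * Y ω + 2 * (κ / (1 - M.γ)) * X ω) / (2 * α) + α / 2)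
          + W * (2 * ε₀) / (1 - M.γ)
          + τ * (ε₀ * Real.log (Fintype.card A / ε₀) / (1 - M.γ)))
      + η ^ 2 * (W ^ 2 / (1 - M.γ) + (1 / (1 - M.γ) + l) ^ 2 / 2) := by
    intro ω
    have htr := M.approxError_transfer_le φ (hπp t ω) hν (fun x => (M.nuStar_mem_Icc hπτ x).1) hκ0
      hκ (w := w t ω) (herr.minimizer t ω)
    rw [← hq] at htr
    have htr' : approxError φ (w t ω) (q ω) (M.nuStar πτ)
        ≤ 2 * Y ω + 2 * (κ / (1 - M.γ)) * X ω := by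
      simp only [hX, hY]; exact htr
    have hdir := M.direction_error φ hα hε₀.le hπτ (hπp t ω) (hwW t ω) hW (q ω)
    have hbv : |M.V h (π t ω) + τ * lam t ω| ≤ 1 / (1 - M.γ) + l := by
      refine (abs_add_le _ _).trans (add_le_add (M.abs_V_le (hπp t ω) hh) ?_)
      rw [abs_mul, abs_of_pos hτ]
      exact (mul_le_of_le_one_left (abs_nonneg _) hτ1).trans (hl _ (hlam t ω))
    have hs := M.regPotential_step hη hε₀ hτ.le hπτ hpo (hπr t ω) hlamτ
      ((hmax _ (hπp t ω)).trans (hmin _ (hlam t ω))) (hwW t ω) (hrpg.step_π t ω)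
      (hrpg.step_lam t ω) hbv (fun s => klVec_unifMix_le hε₀ hε₀1 (hπτ s) (hπr t ω s))
      (by rw [← hq]; exact hdir)
    rw [hΦ, hΦ]
    refine hs.trans ?_
    gcongr
  have hmono := integral_mono (hint (t + 1)) (by fun_prop) hpt
  rw [hΦ] at hmono
  refine hmono.trans ?_
  have hZi : Integrable (fun ω => 2 * Y ω + 2 * (κ / (1 - M.γ)) * X ω) Pr := by fun_prop
  have hZ : ∫ ω, (2 * Y ω + 2 * (κ / (1 - M.γ)) * X ω) ∂Pr
      ≤ 2 * εbias + 2 * (κ / (1 - M.γ)) * εstat := by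
    rw [integral_add (by fun_prop) (by fun_prop), integral_const_mul, integral_const_mul]
    gcongr
  have e : ∀ ω, (1 - η * τ) * Φ t ω
      + η * (Fintype.card A / (1 - M.γ)
            * ((2 * Y ω + 2 * (κ / (1 - M.γ)) * X ω) / (2 * α) + α / 2)
          + W * (2 * ε₀) / (1 - M.γ)
          + τ * (ε₀ * Real.log (Fintype.card A / ε₀) / (1 - M.γ)))
      + η ^ 2 * (W ^ 2 / (1 - M.γ) + (1 / (1 - M.γ) + l) ^ 2 / 2)
      = (1 - η * τ) * Φ t ω + η * (Fintype.card A / (1 - M.γ)) / (2 * α)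
          * (2 * Y ω + 2 * (κ / (1 - M.γ)) * X ω)
        + (η * (Fintype.card A / (1 - M.γ) * (α / 2) + W * (2 * ε₀) / (1 - M.γ)
          + τ * (ε₀ * Real.log (Fintype.card A / ε₀) / (1 - M.γ)))
      + η ^ 2 * (W ^ 2 / (1 - M.γ) + (1 / (1 - M.γ) + l) ^ 2 / 2)) := fun ω => by ring
  simp_rw [e]
  have hΦi := hint t
  rw [integral_add (by fun_prop) (by fun_prop), integral_add (by fun_prop) (by fun_prop),
    integral_const_mul, integral_const_mul, integral_const]
  simp only [probReal_univ, one_smul]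
  have := mul_le_mul_of_nonneg_left hZ
    (by positivity : 0 ≤ η * (Fintype.card A / (1 - M.γ)) / (2 * α))
  rw [hΦ]
  refine le_trans (add_le_add (add_le_add le_rfl this) le_rfl) (le_of_eq ?_)
  ring

/-- The comparator is the regularized saddle point over all policies, mixed with the uniform policy
so that it lies in the restricted simplex. The condition-number bound `κ` is fixed before `ε`, since
the saddle point varies with `τ` and `δ`. -/
theorem exists_inexactZeroViolation {ξ : ℝ} (hξ : 0 < ξ)
    (hslater : ∃ πbar ∈ policies S A, ξ ≤ M.V M.g πbar) (hφ : ∀ s a, ‖φ s a‖ ≤ 1) {W : ℝ}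
    (hW : 0 < W) {ν : S × A → ℝ} (hν : ν ∈ stdSimplex ℝ (S × A)) (θ₀ : EuclideanSpace ℝ (Fin d))
    {a₁ a₂ b₁ b₂ c : ℝ} (ha₁ : 0 < a₁) (ha : a₁ ≤ a₂) (hb₁ : 0 < b₁) (hb : b₁ ≤ b₂) (hc : 0 < c) :
    ∃ K > 0, CMDP.InexactZeroViolation.{uS, uA, uΩ} M φ W ν θ₀ ξ K a₁ a₂ b₁ b₂ c := by
  obtain ⟨πbar, hπbar, hbar⟩ := hslater
  have := M.nonempty_action hπbar
  have ha₂ : 0 < a₂ := ha₁.trans_le ha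
  have hb₂ : 0 < b₂ := hb₁.trans_le hb
  have hg := M.one_sub_γ_pos
  obtain ⟨κ, hκ0, hκ⟩ := exists_covForm_le φ hν.1
  obtain ⟨n, hn⟩ : ∃ x, x = (Fintype.card A : ℝ) := ⟨_, rfl⟩
  have hn1 : 1 ≤ n := by rw [hn]; exact_mod_cast (Fintype.card_pos : 0 < Fintype.card A)
  obtain ⟨Lm, hLm⟩ : ∃ x, x = 2 / ((1 - M.γ) * ξ) := ⟨_, rfl⟩
  have hLm0 : 0 < Lm := by rw [hLm]; positivity
  obtain ⟨CB, hCB⟩ : ∃ x, x = W ^ 2 / (1 - M.γ) + (1 / (1 - M.γ) + Lm) ^ 2 / 2 := ⟨_, rfl⟩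
  have hCB0 : 0 ≤ CB := by rw [hCB]; positivity
  -- With Young parameter `ε ^ 4`, errors of order `ε ^ 8` contribute order `ε ^ 4`. This is `τ`
  -- times order `ε ^ 2`, as the stationary level requires.
  obtain ⟨E₂, hE₂⟩ : ∃ x, x = n / (1 - M.γ) * ((1 + κ / (1 - M.γ)) * c + 1 / 2)
      + 2 * W / (1 - M.γ) := ⟨_, rfl⟩
  have hE₂0 : 0 < E₂ := by rw [hE₂]; positivity
  obtain ⟨CE, hCE⟩ : ∃ x, x = E₂ / b₁ + 1 / (1 - M.γ) + a₂ / b₁ * CB := ⟨_, rfl⟩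
  have hCE0 : 0 < CE := by rw [hCE]; positivity
  obtain ⟨B₀, hB₀⟩ : ∃ x, x = (2 * ‖θ₀‖ + n) / (1 - M.γ) + Lm ^ 2 / 2 := ⟨_, rfl⟩
  have hB₀0 : 0 < B₀ := by rw [hB₀]; positivity
  obtain ⟨Kd, hKd⟩ : ∃ x, x = 1 / (1 - M.γ) * (1 + CE + 3 / (1 - M.γ)) := ⟨_, rfl⟩
  have hKd0 : 0 < Kd := by rw [hKd]; positivity
  obtain ⟨K₂, hK₂⟩ : ∃ x, x = b₂ * (n / (1 - M.γ)) + b₂ * Lm + Kd := ⟨_, rfl⟩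
  have hK₂0 : 0 < K₂ := by rw [hK₂]; positivity
  obtain ⟨k, hk⟩ : ∃ x, x = 3 + b₂ + a₂ * b₂ + 2 * K₂ / ξ + B₀ := ⟨_, rfl⟩
  have hk0 : 0 < k := by rw [hk]; positivity
  have hkle : ∀ ε : ℝ, 0 < ε → ε < 1 / k → ∀ x, x ≤ k → x * ε ≤ 1 := by
    intro ε h0 h1 x hx
    rw [lt_div_iff₀ hk0] at h1
    exact (mul_le_mul_of_nonneg_right hx h0.le).trans (by linarith only [h1])
  have hp1 : 0 < a₂ * b₂ := by positivity
  have hp2 : 0 < 2 * K₂ / ξ := by positivity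
  refine ⟨Kd + Lm * K₂ + b₂ * (n / (1 - M.γ)), by positivity,
    4 / (a₁ * b₁), by positivity, 1 / k, by positivity, fun ε hε hεk => ?_⟩
  have hε3 : 3 * ε ≤ 1 := hkle ε hε hεk _ (by rw [hk]; linarith)
  have hε1 : ε ≤ 1 := by linarith
  have hεb : b₂ * ε ≤ 1 := hkle ε hε hεk _ (by rw [hk]; linarith)
  have hεab : a₂ * b₂ * ε ≤ 1 := hkle ε hε hεk _ (by rw [hk]; linarith)
  have hεδ : 2 * K₂ / ξ * ε ≤ 1 := hkle ε hε hεk _ (by rw [hk]; linarith)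
  have hεΦ : B₀ * ε ≤ 1 := hkle ε hε hεk _ (by rw [hk]; linarith)
  have hδ0 : 0 < K₂ * ε := by positivity
  have hδ : K₂ * ε ≤ ξ / 2 := by
    have : 2 * K₂ / ξ * ε = K₂ * ε / (ξ / 2) := by field_simp
    rw [this, div_le_one (by positivity)] at hεδ
    exact hεδ
  have hsq : ε ^ 2 ≤ ε := pow_le_of_le_one hε.le hε1 two_ne_zero
  -- This threshold makes the mixing cost `ε₀ log (n / ε₀)` at most `ε²` by `mul_log_div_le`, and in
  -- particular `ε₀ ≤ ε ^ 4`.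
  refine ⟨K₂ * ε, hδ0, by linarith, ε ^ 4 / (4 * n), by positivity, ?_⟩
  intro ε₀ hε₀ hε₀lt η τ hη hτ εstat εbias hstat0 hstat hbias0 hbias Ω _ Pr _ w wstar π lam πτ lamτ
    hsad hrpg herr t ht
  rw [lt_div_iff₀ (by positivity)] at hε₀lt
  have hε₀4 : ε₀ ≤ ε ^ 4 :=
    (le_mul_of_one_le_right hε₀.le (by linarith)).trans hε₀lt.le
  have hε₀ε : ε₀ ≤ ε := hε₀4.trans (pow_le_of_le_one hε.le hε1 (by norm_num))
  have hε₀1 : ε₀ ≤ 1 := hε₀ε.trans hε1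
  have hη0 : 0 < η := lt_of_lt_of_le (by positivity) hη.1
  have hτ0 : 0 < τ := lt_of_lt_of_le (by positivity) hτ.1
  have hτε : τ ≤ b₂ * ε := hτ.2.trans (mul_le_mul_of_nonneg_left hsq hb₂.le)
  have hξδ : 0 < ξ - K₂ * ε := by linarith
  obtain ⟨h, hh⟩ : ∃ x, x = M.gTight (K₂ * ε) := ⟨_, rfl⟩
  rw [← hh] at hrpg hsad herr
  have hh1 : ∀ s a, |h s a| ≤ 1 := hh ▸ M.abs_gTight_le hδ0.le (by linarith) ⟨πbar, hπbar, hbar⟩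
  have hπr : ∀ t ω s, π t ω s ∈ restrictedSimplex A ε₀ := by
    intro t ω s
    cases t with
    | zero => exact hrpg.init_mem ω s
    | succ t => exact (hrpg.step_π t ω s).1
  have hπp : ∀ t ω, π t ω ∈ policies S A := fun t ω s => (hπr t ω s).1
  have hlam : ∀ t ω, lam t ω ∈ M.Λ (ξ - K₂ * ε) := by
    intro t ω
    cases t with
    | zero =>
      obtain ⟨lam₀, h0, h1⟩ := hrpg.init_lam
      rw [h1]; exact h0
    | succ t => exact (hrpg.step_lam t ω).1
  have hlen : 1 / ((1 - M.γ) * (ξ - K₂ * ε)) ≤ Lm := hLm ▸ M.dual_length_le hξ hδ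
  have hκ' := hκ (M.nuStar πτ) (fun x => (M.nuStar_mem_Icc hsad.1 x).1)
    (fun x => (M.nuStar_mem_Icc hsad.1 x).2) herr.relCond_lt_top
  have hpo : ∀ s, unifMix ε₀ (πτ s) ∈ restrictedSimplex A ε₀ := fun s =>
    unifMix_mem hε₀.le hε₀1 (hsad.1 s)
  have hητ1 : η * τ ≤ 1 := by
    calc η * τ ≤ (a₂ * ε ^ 4) * (b₂ * ε ^ 2) := mul_le_mul hη.2 hτ.2 hτ0.le (by positivity)
      _ = a₂ * b₂ * ε * ε ^ 5 := by ring
      _ ≤ 1 * 1 := mul_le_mul hεab (pow_le_one₀ hε.le hε1) (by positivity) one_pos.le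
      _ = 1 := one_mul 1
  obtain ⟨Φ, hΦ⟩ : ∃ Φ : ℕ → Ω → ℝ, ∀ t ω, Φ t ω =
      M.regPotential πτ (fun s => unifMix ε₀ (πτ s)) lamτ (π t ω) (lam t ω) := ⟨_, fun _ _ => rfl⟩
  have hΦint : ∀ t, Integrable (Φ t) Pr := fun t => by
    rw [funext (hΦ t)]
    exact M.integrable_regPotential hε₀ (hrpg.meas_π t) (hrpg.meas_lam t) hsad.1 hpo (hπr t)
      hsad.2.1 (hlam t)
  have hΦnn : ∀ t ω, 0 ≤ Φ t ω := fun t ω => by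
    rw [hΦ]; exact M.regPotential_nonneg hε₀ hsad.1 hpo (hπr t ω) _ _
  have hηdτ : η / τ ≤ a₂ / b₁ * ε ^ 2 := by
    rw [div_le_iff₀ hτ0]
    calc η ≤ a₂ * ε ^ 4 := hη.2
      _ = a₂ / b₁ * ε ^ 2 * (b₁ * ε ^ 2) := by field_simp
      _ ≤ _ := mul_le_mul_of_nonneg_left hτ.1 (by positivity)
  have hε4τ : ε ^ 4 ≤ τ * ε ^ 2 / b₁ := by
    rw [le_div_iff₀ hb₁]
    calc ε ^ 4 * b₁ = b₁ * ε ^ 2 * ε ^ 2 := by ring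
      _ ≤ _ := mul_le_mul_of_nonneg_right hτ.1 (by positivity)
  have hrec : ∀ t, ∫ ω, Φ (t + 1) ω ∂Pr
      ≤ (1 - η * τ) * ∫ ω, Φ t ω ∂Pr + η * τ * (CE * ε ^ 2) := by
    intro t
    have hs := M.inexact_expected_step hφ hW.le hν hh1 hκ0 hη0 hτ0 (by linarith) hε₀ hε₀1
      (show (0 : ℝ) < ε ^ 4 by positivity) (l := Lm)
      (fun x hx => hLm ▸ M.dual_bound hξ hδ hx) hsad hκ' hrpg herr t
    simp only [← hΦ, ← hn, ← hCB] at hs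
    refine hs.trans ?_
    have hlog : ε₀ * Real.log (n / ε₀) / (1 - M.γ) ≤ ε ^ 2 / (1 - M.γ) :=
      div_le_div_of_nonneg_right (mul_log_div_le (by linarith) hε hε₀ hε₀lt.le) hg.le
    have hE : n / (1 - M.γ) * ((2 * εbias + 2 * (κ / (1 - M.γ)) * εstat) / (2 * ε ^ 4) + ε ^ 4 / 2)
        + W * (2 * ε₀) / (1 - M.γ) ≤ E₂ * ε ^ 4 := by
      calc _ ≤ n / (1 - M.γ) * ((2 * (c * ε ^ 8) + 2 * (κ / (1 - M.γ)) * (c * ε ^ 8)) / (2 * ε ^ 4)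
            + ε ^ 4 / 2) + W * (2 * ε ^ 4) / (1 - M.γ) := by gcongr
        _ = _ := by rw [hE₂]; field_simp
    have hE' : E₂ * ε ^ 4 ≤ τ * (E₂ / b₁ * ε ^ 2) := by
      calc E₂ * ε ^ 4 ≤ E₂ * (τ * ε ^ 2 / b₁) := mul_le_mul_of_nonneg_left hε4τ hE₂0.le
        _ = _ := by ring
    have hηη : η ^ 2 * CB ≤ η * τ * (a₂ / b₁ * CB * ε ^ 2) := by
      calc η ^ 2 * CB = η * τ * (η / τ * CB) := by field_simp
        _ ≤ η * τ * (a₂ / b₁ * ε ^ 2 * CB) := by gcongr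
        _ = _ := by ring
    have h1 := mul_le_mul_of_nonneg_left
      (add_le_add (hE.trans hE') (mul_le_mul_of_nonneg_left hlog hτ0.le)) hη0.le
    have e1 : η * τ * (CE * ε ^ 2) = η * (τ * (E₂ / b₁ * ε ^ 2) + τ * (ε ^ 2 / (1 - M.γ)))
        + η * τ * (a₂ / b₁ * CB * ε ^ 2) := by rw [hCE]; ring
    rw [e1]
    linarith only [h1, hηη]
  have hΦ0 : ∫ ω, Φ 0 ω ∂Pr ≤ B₀ := by
    have h1 : ∀ ω, Φ 0 ω ≤ B₀ := by
      intro ω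
      rw [hΦ, hB₀]
      refine M.regPotential_le hε₀ hsad.1 hpo (hπr 0 ω) (fun s a => ?_)
        ⟨hsad.2.1.1, hsad.2.1.2.trans hlen⟩ ⟨(hlam 0 ω).1, (hlam 0 ω).2.trans hlen⟩
      rw [hrpg.init_π, hn]
      exact neg_log_logLinear_le φ hφ θ₀ s a
    calc _ ≤ ∫ _ω : Ω, B₀ ∂Pr := integral_mono (hΦint 0) (integrable_const _) h1
      _ = B₀ := by simp
  have hΦt : ∫ ω, Φ t ω ∂Pr ≤ (1 + CE) * ε ^ 2 := by
    have h0 : 0 ≤ ∫ ω, Φ 0 ω ∂Pr := integral_nonneg (hΦnn 0)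
    have h1 := le_of_geometric_recursion (Φ := fun t => ∫ ω, Φ t ω ∂Pr) hητ1 hrec
      (by positivity) h0 t
    have h2 : Real.exp (-(η * τ * t)) ≤ ε ^ 4 :=
      exp_neg_le_pow_four hε hε3 (κ := a₁ * b₁) (by positivity) (by
        calc a₁ * b₁ * ε ^ 6 = (a₁ * ε ^ 4) * (b₁ * ε ^ 2) := by ring
          _ ≤ η * τ := mul_le_mul hη.1 hτ.1 (by positivity) hη0.le) ht
    have h3 : Real.exp (-(η * τ * t)) * ∫ ω, Φ 0 ω ∂Pr ≤ ε ^ 2 := by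
      calc _ ≤ ε ^ 4 * B₀ := mul_le_mul h2 hΦ0 h0 (by positivity)
        _ = ε ^ 3 * (B₀ * ε) := by ring
        _ ≤ ε ^ 3 * 1 := mul_le_mul_of_nonneg_left hεΦ (by positivity)
        _ ≤ ε ^ 2 := by rw [mul_one]; exact pow_le_pow_of_le_one hε.le hε1 (by norm_num)
    linarith only [h1, h3]
  have hVint : ∀ f : S → A → ℝ, (∀ s a, |f s a| ≤ 1) → Integrable (fun ω => M.V f (π t ω)) Pr :=
    fun f hf => M.integrable_V (hrpg.meas_π t) (hπp t) hf
  -- The pointwise deviation bound is linear in the potential, so its expectation only involves the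
  -- expected potential. The coefficient 3 is one `ε` from Pinsker and two from the uniform mixture.
  have hdev : ∀ f : S → A → ℝ, (∀ s a, |f s a| ≤ 1) →
      M.V f πτ - Kd * ε ≤ ∫ ω, M.V f (π t ω) ∂Pr := by
    intro f hf
    have h1 : ∀ ω, M.V f πτ - 1 / (1 - M.γ) * (Φ t ω / ε + 3 * ε / (1 - M.γ)) ≤ M.V f (π t ω) := by
      intro ω
      have hkl : ∑ s, M.socc πτ s * klVec (unifMix ε₀ (πτ s)) (π t ω s) ≤ Φ t ω := by
        have e : Φ t ω = ∑ s, M.socc πτ s * klVec (unifMix ε₀ (πτ s)) (π t ω s)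
          + (lam t ω - lamτ) ^ 2 / 2 := hΦ t ω
        linarith only [e, sq_nonneg (lam t ω - lamτ)]
      have h2 := (abs_le.1 (M.abs_V_sub_le_of_kl hε hε₀ hsad.1 hpo (hπr t ω)
        (fun s => l1_unifMix_sub_le hε₀.le (hsad.1 s)) hkl hf)).2
      have h3 : 1 / (1 - M.γ) * (Φ t ω / ε + (ε + 2 * ε₀) / (1 - M.γ))
          ≤ 1 / (1 - M.γ) * (Φ t ω / ε + 3 * ε / (1 - M.γ)) := by
        gcongr
        linarith only [hε₀ε]
      linarith only [h2, h3]
    have hΦi := hΦint t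
    have h2 := integral_mono (by fun_prop) (hVint f hf) h1
    refine le_trans ?_ h2
    have e : ∀ ω, M.V f πτ - 1 / (1 - M.γ) * (Φ t ω / ε + 3 * ε / (1 - M.γ))
        = (M.V f πτ - 1 / (1 - M.γ) * (3 * ε / (1 - M.γ))) - 1 / (1 - M.γ) / ε * Φ t ω :=
      fun ω => by ring
    simp_rw [e]
    rw [integral_sub (integrable_const _) (by fun_prop), integral_const_mul, integral_const]
    simp only [probReal_univ, one_smul]
    have h3 := mul_le_mul_of_nonneg_left hΦt (by positivity : 0 ≤ 1 / (1 - M.γ) / ε)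
    have e2 : 1 / (1 - M.γ) / ε * ((1 + CE) * ε ^ 2) + 1 / (1 - M.γ) * (3 * ε / (1 - M.γ))
        = Kd * ε := by rw [hKd]; field_simp
    linarith only [h3, e2]
  have hVhg : ∀ π' ∈ policies S A, M.V h π' = M.V M.g π' - K₂ * ε := fun π' hπ' =>
    hh ▸ M.V_gTight hπ' _
  have hng : τ * (n / (1 - M.γ)) ≤ b₂ * (n / (1 - M.γ)) * ε := by
    have := mul_le_mul_of_nonneg_right hτε (by positivity : 0 ≤ n / (1 - M.γ))
    linarith only [this]
  obtain ⟨hπτ, hlamτ, hmax, hmin⟩ := hsad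
  constructor
  · intro πstar hstar
    rw [integral_sub (integrable_const _) (hVint _ M.abs_r_le), integral_const]
    simp only [probReal_univ, one_smul]
    have e1 := hdev M.r M.abs_r_le
    have e2 := hVhg πstar hstar.1
    have e4 := M.V_r_saddle_ge (e := K₂ * ε) hτ0.le (by positivity) hξδ hπτ hstar.1 hlamτ
      (hmax _ hstar.1) hmin (by linarith only [e2, hstar.2.1])
    rw [← hn] at e4
    have e5 := mul_le_mul_of_nonneg_right hlen hδ0.le
    have e7 : (Kd + Lm * K₂ + b₂ * (n / (1 - M.γ))) * ε
        = Kd * ε + Lm * (K₂ * ε) + b₂ * (n / (1 - M.γ)) * ε := by ring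
    linarith only [e1, e4, e5, e7, hng]
  · have hξ1 : (1 - M.γ) * (ξ - K₂ * ε) ≤ 1 := by
      have e3 := M.add_le_of_slater hπbar hbar
      have e4 := mul_pos hg M.b_mem.1
      have e5 := mul_pos hg hδ0
      have e6 : (1 - M.γ) * (ξ - K₂ * ε)
          = (1 - M.γ) * (M.b + ξ) - (1 - M.γ) * M.b - (1 - M.γ) * (K₂ * ε) := by ring
      rw [e6]
      linarith only [e3, e4, e5]
    have e1 := hVhg πbar hπbar
    have e2 := hdev h hh1
    have e3 := M.V_saddle_ge (e := 0) hξδ hξ1 hτ0.le le_rfl hπτ hπbar hlamτ (hmax _ hπbar) hmin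
      (by linarith only [e1, hbar])
    rw [← hn] at e3
    have e4 := mul_le_mul_of_nonneg_left hlen hτ0.le
    have e5 := mul_le_mul_of_nonneg_right hτε hLm0.le
    have e6 : K₂ * ε = b₂ * (n / (1 - M.γ)) * ε + b₂ * ε * Lm + Kd * ε := by
      rw [hK₂]; ring
    have e7 : ∫ ω, M.V h (π t ω) ∂Pr ≤ ∫ ω, M.V M.g (π t ω) ∂Pr - K₂ * ε := by
      have hgV : (fun ω => M.V M.g (π t ω)) = fun ω => M.V h (π t ω) + K₂ * ε :=
        funext fun ω => by rw [hVhg _ (hπp t ω)]; ring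
      rw [hgV, integral_add (hVint h hh1) (integrable_const _), integral_const]
      simp
    rw [integral_neg]
    linarith only [e2, e3, e4, e5, e6, e7, hng]

lemma inexactZeroViolation_one {W : ℝ} {ν : S × A → ℝ} {θ₀ : EuclideanSpace ℝ (Fin d)} {ξ K : ℝ}
    (hK : 0 < K) (h : CMDP.InexactZeroViolation.{uS, uA, uΩ} M φ W ν θ₀ ξ K 1 1 1 1 1) :
    CMDP.InexactZeroViolation.{uS, uA, uΩ} M φ W ν θ₀ ξ 1 (1 / K ^ 4) (1 / K ^ 4) (1 / K ^ 2)
      (1 / K ^ 2) (1 / K ^ 8) := by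
  obtain ⟨C, hC, εbar, hεbar, h⟩ := h
  refine ⟨4 * C * K ^ 6, by positivity, min (K * εbar) (min K (1 / K)), by positivity,
    fun ε hε hlt => ?_⟩
  simp only [lt_min_iff] at hlt
  obtain ⟨hl1, hl2, hl3⟩ := hlt
  rw [lt_div_iff₀ hK] at hl3
  obtain ⟨δ, hδ, hδξ, εb, hεb, H⟩ := h (ε / K) (by positivity) (by rw [div_lt_iff₀ hK]; linarith)
  refine ⟨δ, hδ, hδξ, εb, hεb, ?_⟩
  intro ε₀ h0 h1 η τ hη hτ εstat εbias hs0 hs hb0 hb Ω _ Pr _ w wstar π lam πτ lamτ h2 h3 h4 t ht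
  have e8 : 1 / K ^ 8 * ε ^ 8 = 1 * (ε / K) ^ 8 := by field_simp
  have e4 : 1 / K ^ 4 * ε ^ 4 = 1 * (ε / K) ^ 4 := by field_simp
  have e2 : 1 / K ^ 2 * ε ^ 2 = 1 * (ε / K) ^ 2 := by field_simp
  rw [e4] at hη
  rw [e2] at hτ
  rw [e8] at hs hb
  have := H ε₀ h0 h1 η τ hη hτ εstat εbias hs0 hs hb0 hb Ω Pr w wstar π lam πτ lamτ h2 h3 h4 t
    ((rescaled_time_le hC hK hε hl2 (by linarith)).trans ht)
  rwa [mul_div_cancel₀ ε hK.ne', ← one_mul ε] at this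

end Expectation

end CMDP

/-! ### Minimizers of a maximum of affine functions -/

/-- The set of minimizers over `[0, ∞)` of a finite maximum of affine functions, one of which is
increasing. -/
lemma exists_minimizing_interval {ι : Type*} [Finite ι] (α β : ι → ℝ) (hpos : ∃ i, 0 < β i) :
    ∃ D s₁ s₂ : ℝ, 0 ≤ s₁ ∧ s₁ ≤ s₂ ∧ (∀ i, α i + s₁ * β i ≤ D) ∧ (∀ i, α i + s₂ * β i ≤ D) ∧
      (∃ i, D ≤ α i) ∧ (∃ i, α i + s₂ * β i = D ∧ 0 < β i) ∧
      (s₁ = 0 ∨ ∃ i, α i + s₁ * β i = D ∧ β i < 0) ∧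
      (s₁ < s₂ → ∃ i, α i = D ∧ β i = 0) := by
  have := Fintype.ofFinite ι
  obtain ⟨i₀, hi₀⟩ := hpos
  have hne : (Finset.univ : Finset ι).Nonempty := ⟨i₀, Finset.mem_univ _⟩
  set f : ℝ → ℝ := fun x => Finset.univ.sup' hne fun i => α i + x * β i with hf
  have hfc : Continuous f := Continuous.finset_sup'_apply hne fun i _ => by fun_prop
  have hle : ∀ x i, α i + x * β i ≤ f x := fun x i =>
    Finset.le_sup' (fun i => α i + x * β i) (Finset.mem_univ i)
  have hatt : ∀ x, ∃ i, f x = α i + x * β i := fun x => by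
    obtain ⟨i, -, hi⟩ := Finset.exists_mem_eq_sup' hne fun i => α i + x * β i
    exact ⟨i, hi⟩
  -- Beyond `R` the increasing affine function alone exceeds `f 0`, so every minimizer over `[0, ∞)`
  -- lies in the compact interval `[0, R]`.
  set R := max 0 ((f 0 - α i₀) / β i₀) with hR
  have hbig : ∀ x, R < x → f 0 < f x := by
    intro x hx
    have h1 : (f 0 - α i₀) / β i₀ < x := (le_max_right _ _).trans_lt hx
    rw [div_lt_iff₀ hi₀] at h1
    linarith [hle x i₀]
  obtain ⟨x₀, hx₀, hmin⟩ := isCompact_Icc.exists_isMinOn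
    (Set.nonempty_Icc.2 (le_max_left 0 ((f 0 - α i₀) / β i₀))) hfc.continuousOn
  have hmin' : ∀ x, 0 ≤ x → f x₀ ≤ f x := by
    intro x hx
    rcases le_or_gt x R with h | h
    · exact isMinOn_iff.1 hmin x ⟨hx, h⟩
    · exact (isMinOn_iff.1 hmin 0 ⟨le_rfl, le_max_left _ _⟩).trans (hbig x h).le
  set T : Set ℝ := Set.Icc 0 R ∩ {x | f x ≤ f x₀} with hT
  have hTc : IsCompact T := isCompact_Icc.inter_right (isClosed_le hfc continuous_const)
  have hTne : T.Nonempty := ⟨x₀, hx₀, (le_refl (f x₀) : f x₀ ≤ f x₀)⟩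
  have hTmem : ∀ x, 0 ≤ x → f x ≤ f x₀ → x ∈ T := fun x hx h =>
    ⟨⟨hx, le_of_not_gt fun hR => by
      have := hbig x hR
      linarith [hmin' 0 le_rfl]⟩, h⟩
  have h1 := hTc.sInf_mem hTne
  have h2 := hTc.sSup_mem hTne
  set s₁ := sInf T
  set s₂ := sSup T
  have h12 : s₁ ≤ s₂ := csInf_le_csSup hTne hTc.bddBelow hTc.bddAbove
  have hlin : ∀ (i : ι) (s : ℝ), α i + s * β i < f x₀ →
      ∀ᶠ x in nhds s, α i + x * β i ≤ f x₀ := fun i s h =>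
    ((Continuous.tendsto (by fun_prop) s).eventually (gt_mem_nhds h)).mono fun x hx => le_of_lt hx
  refine ⟨f x₀, s₁, s₂, h1.1.1, h12, fun i => (hle _ i).trans h1.2, fun i => (hle _ i).trans h2.2,
    ?_, ?_, ?_, ?_⟩
  · obtain ⟨i, hi⟩ := hatt 0
    exact ⟨i, by have := hmin' 0 le_rfl; linarith⟩
  -- If no active function increased at `s₂`, points slightly to its right would still be
  -- minimizers. The left endpoint is treated symmetrically unless it is zero.
  · by_contra hcon
    push Not at hcon
    have hev : ∀ i, ∀ᶠ x in nhdsWithin s₂ (Set.Ioi s₂), α i + x * β i ≤ f x₀ := by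
      intro i
      rcases ((hle s₂ i).trans h2.2).lt_or_eq with h | h
      · exact (hlin i s₂ h).filter_mono nhdsWithin_le_nhds
      · have hβ := hcon i h
        filter_upwards [self_mem_nhdsWithin] with x hx
        have := mul_le_mul_of_nonpos_right (le_of_lt (Set.mem_Ioi.1 hx)) hβ
        linarith
    obtain ⟨x, hx, hxs⟩ := ((Filter.eventually_all.2 hev).and self_mem_nhdsWithin).exists
    have hxT : x ∈ T := hTmem x (h2.1.1.trans (le_of_lt hxs)) (Finset.sup'_le hne _ fun i _ => hx i)
    exact absurd (le_csSup hTc.bddAbove hxT) (not_le.2 hxs)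
  · rcases h1.1.1.eq_or_lt with h0 | h0
    · exact Or.inl h0.symm
    right
    by_contra hcon
    push Not at hcon
    have hev : ∀ i, ∀ᶠ x in nhdsWithin s₁ (Set.Iio s₁), α i + x * β i ≤ f x₀ := by
      intro i
      rcases ((hle s₁ i).trans h1.2).lt_or_eq with h | h
      · exact (hlin i s₁ h).filter_mono nhdsWithin_le_nhds
      · have hβ := hcon i h
        filter_upwards [self_mem_nhdsWithin] with x hx
        have := mul_le_mul_of_nonneg_right (le_of_lt (Set.mem_Iio.1 hx)) hβ
        linarith
    have hnn : ∀ᶠ x in nhdsWithin s₁ (Set.Iio s₁), 0 < x :=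
      (lt_mem_nhds h0).filter_mono nhdsWithin_le_nhds
    obtain ⟨x, ⟨hx, hx0⟩, hxs⟩ :=
      (((Filter.eventually_all.2 hev).and hnn).and self_mem_nhdsWithin).exists
    have hxT : x ∈ T := hTmem x hx0.le (Finset.sup'_le hne _ fun i _ => hx i)
    exact absurd (csInf_le hTc.bddBelow hxT) (not_le.2 hxs)
  · intro hlt
    -- A function active at the midpoint stays below the minimum at both ends, so it is constant.
    obtain ⟨i, hi⟩ := hatt ((s₁ + s₂) / 2)
    have e1 := (hle s₁ i).trans h1.2
    have e2 := (hle s₂ i).trans h2.2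
    have e3 := hmin' ((s₁ + s₂) / 2) (by linarith [h1.1.1])
    rw [hi] at e3
    have e4 : (s₂ - s₁) * β i ≤ 0 := by nlinarith
    have e5 : 0 ≤ (s₂ - s₁) * β i := by nlinarith
    have e6 : β i = 0 := by
      rcases mul_eq_zero.1 (le_antisymm e4 e5) with h | h
      · linarith
      · exact h
    rw [e6] at e1 e3
    exact ⟨i, by linarith, e6⟩

namespace CMDP

variable {S : Type uS} {A : Type uA} [Fintype S] [Fintype A] (M : CMDP S A)

/-! ### Optimal policies without constraints -/

open Classical in
/-- The deterministic policy with the given action choice. -/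
def detPolicy (σ : S → A) : S → A → ℝ := fun s => Pi.single (σ s) 1

lemma detPolicy_mem (σ : S → A) : detPolicy σ ∈ policies S A := fun s => by
  classical
  refine ⟨fun a => ?_, ?_⟩
  · simp only [detPolicy, Pi.single_apply]
    split_ifs <;> norm_num
  · simp [detPolicy, Pi.single_apply]

lemma sum_detPolicy (σ : S → A) (s : S) (f : A → ℝ) : ∑ a, detPolicy σ s a * f a = f (σ s) := by
  classical
  simp [detPolicy, Pi.single_apply]

lemma performance_difference_vf {π π' : S → A → ℝ} (hπ : π ∈ policies S A)
    (hπ' : π' ∈ policies S A) (c : S → A → ℝ) :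
    M.V c π' - M.V c π = ∑ s, M.socc π' s * (∑ a, π' s a * M.Q c π s a - M.vf c π s) := by
  rw [M.performance_difference hπ hπ']
  refine Finset.sum_congr rfl fun s _ => ?_
  simp only [sub_mul, Finset.sum_sub_distrib, vf]

/-- Policy improvement: a policy greedy for the action values of `π` is at least as good. This
reduces the dual function to finitely many affine pieces. -/
lemma exists_detPolicy_ge {π : S → A → ℝ} (hπ : π ∈ policies S A) (c : S → A → ℝ) :
    ∃ σ : S → A, M.V c π ≤ M.V c (detPolicy σ) := by
  have := M.nonempty_action hπ
  choose σ hσ using fun s => Finite.exists_max fun a => M.Q c π s a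
  refine ⟨σ, ?_⟩
  rw [← sub_nonneg, M.performance_difference_vf hπ (detPolicy_mem σ)]
  refine Finset.sum_nonneg fun s _ => mul_nonneg (M.socc_nonneg (detPolicy_mem σ) s) ?_
  rw [sum_detPolicy, sub_nonneg]
  calc M.vf c π s ≤ ∑ a, π s a * M.Q c π s (σ s) := Finset.sum_le_sum fun a _ =>
        mul_le_mul_of_nonneg_left (hσ s a) ((hπ s).1 a)
    _ = _ := by rw [← Finset.sum_mul, (hπ s).2, one_mul]

/-- The loss of an action with respect to the value of a policy. -/
def adv (c π : S → A → ℝ) (s : S) (a : A) : ℝ := M.vf c π s - M.Q c π s a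

lemma V_sub_eq_adv {π π' : S → A → ℝ} (hπ : π ∈ policies S A)
    (hπ' : π' ∈ policies S A) (c : S → A → ℝ) :
    M.V c π - M.V c π' = ∑ s, M.socc π' s * ∑ a, π' s a * M.adv c π s a := by
  rw [← neg_sub, M.performance_difference_vf hπ hπ', ← Finset.sum_neg_distrib]
  refine Finset.sum_congr rfl fun s _ => ?_
  simp only [adv, mul_sub, Finset.sum_sub_distrib, ← Finset.sum_mul, (hπ' s).2]
  ring

/-- An action with negative loss, used in its state alone, would strictly improve the value, because
that state has positive occupancy. -/
lemma adv_nonneg (hρ : ∀ s, 0 < M.ρ s) {π : S → A → ℝ} (hπ : π ∈ policies S A) {c : S → A → ℝ}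
    (hopt : ∀ π' ∈ policies S A, M.V c π' ≤ M.V c π) (s : S) (a : A) : 0 ≤ M.adv c π s a := by
  classical
  by_contra hneg
  push Not at hneg
  set π' : S → A → ℝ := Function.update π s (Pi.single a 1) with hπ'
  have hmem : π' ∈ policies S A := by
    intro s'
    rcases eq_or_ne s' s with rfl | h
    · simp only [hπ', Function.update_self]
      exact detPolicy_mem (fun _ => a) s'
    · simp only [hπ', Function.update_of_ne h]
      exact hπ s'
  have h1 := M.V_sub_eq_adv hπ hmem c
  have h0 : ∀ s', s' ≠ s → ∑ a', π' s' a' * M.adv c π s' a' = 0 := by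
    intro s' hs'
    simp only [hπ', Function.update_of_ne hs', adv, mul_sub, Finset.sum_sub_distrib,
      ← Finset.sum_mul, (hπ s').2, vf]
    ring
  rw [Finset.sum_eq_single s (fun s' _ hs' => by rw [h0 s' hs', mul_zero]) (by simp)] at h1
  have h2 : ∑ a', π' s a' * M.adv c π s a' = M.adv c π s a := by
    simp [hπ', Pi.single_apply]
  rw [h2] at h1
  have h3 := mul_neg_of_pos_of_neg ((hρ s).trans_le (M.ρ_le_socc hmem s)) hneg
  linarith [hopt π' hmem]

/-- Complementary slackness: equality of values makes a sum of nonnegative terms vanish, and all its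
occupancy weights are positive. -/
lemma mul_adv_eq_zero (hρ : ∀ s, 0 < M.ρ s) {π π' : S → A → ℝ} (hπ : π ∈ policies S A)
    (hπ' : π' ∈ policies S A) {c : S → A → ℝ} (hadv : ∀ s a, 0 ≤ M.adv c π s a)
    (h : M.V c π' = M.V c π) (s : S) (a : A) : π' s a * M.adv c π s a = 0 := by
  have h1 := M.V_sub_eq_adv hπ hπ' c
  rw [h, sub_self, eq_comm, Finset.sum_eq_zero_iff_of_nonneg fun s _ => mul_nonneg
    (M.socc_nonneg hπ' s) (Finset.sum_nonneg fun a _ => mul_nonneg ((hπ' s).1 a) (hadv s a))] at h1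
  have h2 := (mul_eq_zero.1 (h1 s (Finset.mem_univ s))).resolve_left
    ((hρ s).trans_le (M.ρ_le_socc hπ' s)).ne'
  rw [Finset.sum_eq_zero_iff_of_nonneg fun a _ => mul_nonneg ((hπ' s).1 a) (hadv s a)] at h2
  exact h2 a (Finset.mem_univ a)

lemma exists_pos_le_of_finite {ι : Type*} [Finite ι] {f : ι → ℝ} (hf : ∀ i, 0 ≤ f i) :
    ∃ k > 0, ∀ i, f i = 0 ∨ k ≤ f i := by
  have := Fintype.ofFinite ι
  rcases isEmpty_or_nonempty ι with hι | hι
  · exact ⟨1, one_pos, fun i => hι.elim i⟩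
  obtain ⟨i₀, h₀⟩ := Finite.exists_min fun i => if f i = 0 then 1 else f i
  refine ⟨if f i₀ = 0 then 1 else f i₀, ?_, fun i => ?_⟩
  · split_ifs with h
    · exact one_pos
    · exact lt_of_le_of_ne (hf i₀) (Ne.symm h)
  · by_cases h : f i = 0
    · exact Or.inl h
    · right
      have := h₀ i
      rwa [if_neg h] at this

lemma exists_ρ_lower (hρ : ∀ s, 0 < M.ρ s) : ∃ k > 0, ∀ s, k ≤ M.ρ s := by
  obtain ⟨k, hk, h⟩ := exists_pos_le_of_finite fun s => (hρ s).le
  exact ⟨k, hk, fun s => (h s).resolve_left (hρ s).ne'⟩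

/-- Error bound for the set of unconstrained optimal policies. -/
lemma exists_face_bound (hρ : ∀ s, 0 < M.ρ s) {πo : S → A → ℝ} (hπo : πo ∈ policies S A)
    {c : S → A → ℝ} (hopt : ∀ π' ∈ policies S A, M.V c π' ≤ M.V c πo) :
    ∃ C : ℝ, 0 ≤ C ∧ ∀ π ∈ policies S A, ∃ π' ∈ policies S A, M.V c π' = M.V c πo ∧
      ∀ s a, |π' s a - π s a| ≤ C * (M.V c πo - M.V c π) := by
  classical
  have hadv := M.adv_nonneg hρ hπo hopt
  obtain ⟨k, hk, hkadv⟩ := exists_pos_le_of_finite fun x : S × A => hadv x.1 x.2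
  obtain ⟨ρ₀, hρ₀, hρle⟩ := M.exists_ρ_lower hρ
  refine ⟨1 / (k * ρ₀), by positivity, fun π hπ => ?_⟩
  -- The mass that `π` puts on suboptimal actions. It is redistributed according to `πo`; each unit
  -- of it costs at least `k * ρ₀` in value, which bounds the displacement by the value gap.
  set bad : S → ℝ := fun s => ∑ a, if M.adv c πo s a = 0 then 0 else π s a with hbad
  have hterm : ∀ s a, 0 ≤ if M.adv c πo s a = 0 then 0 else π s a := fun s a => by
    split_ifs
    exacts [le_rfl, (hπ s).1 a]
  have hbad0 : ∀ s, 0 ≤ bad s := fun s => Finset.sum_nonneg fun a _ => hterm s a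
  set π' : S → A → ℝ := fun s a => (if M.adv c πo s a = 0 then π s a else 0) + bad s * πo s a
    with hπ'
  have hsum : ∀ s, ∑ a, (if M.adv c πo s a = 0 then π s a else 0) + bad s = 1 := by
    intro s
    rw [hbad, ← Finset.sum_add_distrib, ← (hπ s).2]
    exact Finset.sum_congr rfl fun a _ => by split_ifs <;> ring
  have hmem : π' ∈ policies S A := by
    intro s
    refine ⟨fun a => add_nonneg ?_ (mul_nonneg (hbad0 s) ((hπo s).1 a)), ?_⟩
    · split_ifs
      exacts [(hπ s).1 a, le_rfl]
    · simp only [hπ', Finset.sum_add_distrib, ← Finset.mul_sum, (hπo s).2, mul_one]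
      exact hsum s
  have hzero : ∀ s a, πo s a * M.adv c πo s a = 0 := M.mul_adv_eq_zero hρ hπo hπo hadv rfl
  refine ⟨π', hmem, ?_, fun s a => ?_⟩
  · have h1 := M.V_sub_eq_adv hπo hmem c
    rw [Finset.sum_eq_zero fun s _ => ?_] at h1
    · linarith
    rw [Finset.sum_eq_zero fun a _ => ?_, mul_zero]
    simp only [hπ', add_mul, mul_assoc, hzero, mul_zero, add_zero]
    split_ifs with h
    · rw [h, mul_zero]
    · rw [zero_mul]
  · have hle : |π' s a - π s a| ≤ bad s := by
      by_cases h : M.adv c πo s a = 0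
      · simp only [hπ', if_pos h, add_sub_cancel_left]
        rw [abs_of_nonneg (mul_nonneg (hbad0 s) ((hπo s).1 a))]
        exact mul_le_of_le_one_right (hbad0 s) (coord_le_one (hπo s) a)
      · have h0 := (mul_eq_zero.1 (hzero s a)).resolve_right h
        simp only [hπ', if_neg h, h0, mul_zero, zero_add, zero_sub, abs_neg]
        rw [abs_of_nonneg ((hπ s).1 a)]
        have := Finset.single_le_sum (fun a _ => hterm s a) (Finset.mem_univ a)
        rwa [if_neg h] at this
    refine hle.trans ?_
    rw [div_mul_eq_mul_div, one_mul, le_div_iff₀ (by positivity), M.V_sub_eq_adv hπo hπ]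
    have h2 : bad s * k ≤ ∑ a, π s a * M.adv c πo s a := by
      rw [hbad, Finset.sum_mul]
      refine Finset.sum_le_sum fun a _ => ?_
      split_ifs with h
      · rw [h]; simp
      · exact mul_le_mul_of_nonneg_left ((hkadv (s, a)).resolve_left h) ((hπ s).1 a)
    have hnn : ∀ s, 0 ≤ ∑ a, π s a * M.adv c πo s a := fun s =>
      Finset.sum_nonneg fun a _ => mul_nonneg ((hπ s).1 a) (hadv s a)
    calc bad s * (k * ρ₀) = ρ₀ * (bad s * k) := by ring
      _ ≤ M.socc π s * ∑ a, π s a * M.adv c πo s a :=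
        mul_le_mul ((hρle s).trans (M.ρ_le_socc hπ s)) h2 (mul_nonneg (hbad0 s) hk.le)
          (M.socc_nonneg hπ s)
      _ ≤ _ := Finset.single_le_sum (f := fun s => M.socc π s * ∑ a, π s a * M.adv c πo s a)
        (fun s _ => mul_nonneg (M.socc_nonneg hπ s) (hnn s)) (Finset.mem_univ s)

/-! ### The dual function -/

/-- The interval `[s₁, s₂]` of minimizers of the dual function, with optimal value `D`. -/
structure IsDualInterval (ξ D s₁ s₂ : ℝ) : Prop where
  nonneg : 0 ≤ s₁
  le : s₁ ≤ s₂
  le_length : s₂ ≤ 1 / ((1 - M.γ) * ξ)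
  bound_left : ∀ π ∈ policies S A, M.V M.r π + s₁ * M.V M.g π ≤ D
  bound_right : ∀ π ∈ policies S A, M.V M.r π + s₂ * M.V M.g π ≤ D
  exists_right : ∃ π ∈ policies S A, M.V M.r π + s₂ * M.V M.g π = D ∧ 0 < M.V M.g π
  exists_left : s₁ = 0 ∨ ∃ π ∈ policies S A, M.V M.r π + s₁ * M.V M.g π = D ∧ M.V M.g π < 0
  exists_mid : s₁ < s₂ → ∃ π ∈ policies S A, M.V M.r π = D ∧ M.V M.g π = 0

/-- Minimize the maximum over deterministic policies. A Slater policy bounds `s₂ * ξ` by the dual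
value, and the policy active at zero bounds the dual value by `1 / (1 - γ)`; hence the length bound.
-/
lemma exists_isDualInterval {ξ : ℝ} (hξ : 0 < ξ)
    (hslater : ∃ πbar ∈ policies S A, ξ ≤ M.V M.g πbar) :
    ∃ D s₁ s₂, M.IsDualInterval ξ D s₁ s₂ := by
  obtain ⟨πbar, hπbar, hbar⟩ := hslater
  have hg := M.one_sub_γ_pos
  have hpos : ∃ σ : S → A, 0 < M.V M.g (detPolicy σ) := by
    obtain ⟨σ, hσ⟩ := M.exists_detPolicy_ge hπbar M.g
    exact ⟨σ, by linarith⟩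
  obtain ⟨D, s₁, s₂, h0, h12, hb1, hb2, ⟨i, hi⟩, hright, hleft, hmid⟩ :=
    exists_minimizing_interval (fun σ : S → A => M.V M.r (detPolicy σ))
      (fun σ => M.V M.g (detPolicy σ)) hpos
  have hbd : ∀ s, (∀ σ : S → A, M.V M.r (detPolicy σ) + s * M.V M.g (detPolicy σ) ≤ D) →
      ∀ π ∈ policies S A, M.V M.r π + s * M.V M.g π ≤ D := by
    intro s hs π hπ
    obtain ⟨σ, hσ⟩ := M.exists_detPolicy_ge hπ (M.lagr M.g s)
    rw [M.V_lagr hπ, M.V_lagr (detPolicy_mem σ)] at hσ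
    exact hσ.trans (hs σ)
  have hD : D ≤ 1 / (1 - M.γ) := hi.trans (M.V_r_le (detPolicy_mem i))
  refine ⟨D, s₁, s₂, h0, h12, ?_, hbd s₁ hb1, hbd s₂ hb2, ?_, ?_, ?_⟩
  · have h1 := hbd s₂ hb2 πbar hπbar
    have h2 := M.V_r_nonneg hπbar
    have h3 := mul_le_mul_of_nonneg_left hbar (h0.trans h12)
    have h4 : s₂ * ξ ≤ 1 / (1 - M.γ) := by linarith
    rw [le_div_iff₀ hg] at h4
    rw [le_div_iff₀ (by positivity)]
    linarith
  · obtain ⟨σ, h1, h2⟩ := hright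
    exact ⟨_, detPolicy_mem σ, h1, h2⟩
  · rcases hleft with h | ⟨σ, h1, h2⟩
    · exact Or.inl h
    · exact Or.inr ⟨_, detPolicy_mem σ, h1, h2⟩
  · intro h
    obtain ⟨σ, h1, h2⟩ := hmid h
    exact ⟨_, detPolicy_mem σ, h1, h2⟩

lemma abs_g_le {ξ : ℝ} (hξ : 0 < ξ) (hslater : ∃ π ∈ policies S A, ξ ≤ M.V M.g π) (s : S) (a : A) :
    |M.g s a| ≤ 1 := by
  have := M.abs_gTight_le le_rfl hξ.le hslater s a
  simpa [gTight] using this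

lemma abs_V_sub_le_of_entries {π π' : S → A → ℝ} (hπ : π ∈ policies S A) (hπ' : π' ∈ policies S A)
    {c : S → A → ℝ} (hc : ∀ s a, |c s a| ≤ 1) {e : ℝ} (he : ∀ s a, |π' s a - π s a| ≤ e) :
    |M.V c π' - M.V c π| ≤ Fintype.card A / (1 - M.γ) ^ 2 * e := by
  have hg := M.one_sub_γ_pos
  refine (M.abs_V_sub_le hπ hπ' hc).trans ?_
  have h1 : ∑ s, M.socc π' s * ∑ a, |π' s a - π s a| ≤ Fintype.card A * e / (1 - M.γ) :=
    M.sum_socc_mul_le hπ' fun s => by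
      calc _ ≤ ∑ _a : A, e := Finset.sum_le_sum fun a _ => he s a
        _ = _ := by simp
  refine (mul_le_mul_of_nonneg_left h1 (by positivity)).trans (le_of_eq ?_)
  field_simp

/-- Moving along a mixture to a prescribed constraint value. -/
lemma exists_adjusted {ρ₀ : ℝ} (hρ₀ : 0 < ρ₀) (hρ : ∀ s, ρ₀ ≤ M.ρ s) {π₁ π₂ : S → A → ℝ}
    (h₁ : π₁ ∈ policies S A) (h₂ : π₂ ∈ policies S A) {c : S → A → ℝ} (hc : M.V c π₁ = M.V c π₂)
    {y θ : ℝ} (hθ : θ ∈ Set.Icc (0 : ℝ) 1) (hy : (1 - θ) * M.V M.g π₁ + θ * M.V M.g π₂ = y) :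
    ∃ π ∈ policies S A, M.V c π = M.V c π₁ ∧ M.V M.g π = y ∧
      ∀ s a, |π s a - π₁ s a| ≤ θ / ((1 - M.γ) * ρ₀) := by
  have hg := M.one_sub_γ_pos
  obtain ⟨w, hw, hwρ, hmem, hV⟩ := M.exists_mixture h₁ h₂ hθ
  refine ⟨_, hmem, by rw [hV, ← hc]; ring, by rw [hV, hy], fun s a => ?_⟩
  have e : (1 - w s) * π₁ s a + w s * π₂ s a - π₁ s a = w s * (π₂ s a - π₁ s a) := by ring
  have h3 : |π₂ s a - π₁ s a| ≤ 1 := abs_le.2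
    ⟨by linarith [(h₂ s).1 a, coord_le_one (h₁ s) a], by linarith [(h₁ s).1 a, coord_le_one (h₂ s) a]⟩
  rw [e, abs_mul, abs_of_nonneg (hw s).1]
  refine (mul_le_of_le_one_right (hw s).1 h3).trans ?_
  rw [le_div_iff₀ (by positivity)]
  have h4 := mul_le_mul_of_nonneg_left (hρ s) (hw s).1
  have h5 := h4.trans (hwρ s)
  rw [le_div_iff₀ hg] at h5
  linarith

/-- Error bound for the tightened problem when the dual solution is unique. -/
lemma exists_error_bound_unique {ξ D s : ℝ} (hξ : 0 < ξ)
    (hslater : ∃ πbar ∈ policies S A, ξ ≤ M.V M.g πbar) (hρ : ∀ s, 0 < M.ρ s)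
    (hD : M.IsDualInterval ξ D s s) :
    ∃ C > 0, ∃ δ₀ > 0, δ₀ ≤ ξ / 2 ∧ ∀ δ, 0 < δ → δ ≤ δ₀ → ∀ π ∈ policies S A, ∀ lam ∈ M.Λ (ξ - δ),
      ∀ G, (∀ π' ∈ policies S A, ∀ lam' ∈ M.Λ (ξ - δ),
        M.V M.r π' + lam * (M.V M.g π' - δ) - (M.V M.r π + lam' * (M.V M.g π - δ)) ≤ G) →
      ∃ πo ∈ policies S A, M.V M.r πo + s * M.V M.g πo = D ∧
        (M.V M.g πo = δ ∨ s = 0 ∧ δ ≤ M.V M.g πo) ∧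
        (∀ s a, |πo s a - π s a| ≤ C * G) ∧ |lam - s| ≤ C * G := by
  have hg := M.one_sub_γ_pos
  have hs0 := hD.nonneg
  obtain ⟨πp, hπp, hpD, hpg⟩ := hD.exists_right
  have hn := M.nonempty_action hπp
  obtain ⟨ρ₀, hρ₀, hρle⟩ := M.exists_ρ_lower hρ
  set lm := 1 / ((1 - M.γ) * ξ) with hlm
  have hlm0 : 0 < lm := by positivity
  have hVl : ∀ π ∈ policies S A, M.V (M.lagr M.g s) π = M.V M.r π + s * M.V M.g π :=
    fun π hπ => M.V_lagr hπ _ _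
  have hopt : ∀ π' ∈ policies S A, M.V (M.lagr M.g s) π' ≤ M.V (M.lagr M.g s) πp :=
    fun π' hπ' => by rw [hVl _ hπ', hVl _ hπp, hpD]; exact hD.bound_left π' hπ'
  obtain ⟨C₁, hC₁, hface⟩ := M.exists_face_bound hρ hπp hopt
  have hneg : ∃ k > 0, s = 0 ∨ (k ≤ s ∧ ∃ π ∈ policies S A,
      M.V M.r π + s * M.V M.g π = D ∧ M.V M.g π ≤ -k) := by
    rcases hs0.eq_or_lt with h | h
    · exact ⟨1, one_pos, Or.inl h.symm⟩
    · obtain ⟨π, hπ, h1, h2⟩ := hD.exists_left.resolve_left h.ne'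
      exact ⟨min s (-M.V M.g π), lt_min h (neg_pos.2 h2), Or.inr ⟨min_le_left _ _, π, hπ, h1, by
        linarith [min_le_right s (-M.V M.g π)]⟩⟩
  -- Strict inequality comes from an optimal policy with negative constraint value. The room to the
  -- right of `s` lets the multiplier `lm` detect a violated constraint.
  have hslm : s < lm := by
    rcases hs0.eq_or_lt with h | h
    · rw [← h]; exact hlm0
    · obtain ⟨π, hπ, h1, h2⟩ := hD.exists_left.resolve_left h.ne'
      obtain ⟨πbar, hπbar, hbar⟩ := hslater
      have h3 := hD.bound_left πbar hπbar
      have h4 := M.V_r_nonneg hπbar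
      have h5 := mul_le_mul_of_nonneg_left hbar hs0
      have h6 := M.V_r_le hπ
      have h7 := mul_neg_of_pos_of_neg h h2
      have h8 : s * ξ < 1 / (1 - M.γ) := by linarith
      rw [lt_div_iff₀ hg] at h8
      rw [hlm, lt_div_iff₀ (by positivity)]
      linarith
  obtain ⟨k₀, hk₀, hneg⟩ := hneg
  obtain ⟨k, hk0, hkk, hkp, hkm⟩ : ∃ k > 0, k ≤ k₀ ∧ k ≤ M.V M.g πp / 2 ∧ k ≤ lm - s :=
    ⟨min k₀ (min (M.V M.g πp / 2) (lm - s)), lt_min hk₀ (lt_min (by linarith) (by linarith)),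
      min_le_left _ _, (min_le_right _ _).trans (min_le_left _ _),
      (min_le_right _ _).trans (min_le_right _ _)⟩
  set CL := (Fintype.card A : ℝ) / (1 - M.γ) ^ 2 with hCL
  have hCL0 : 0 ≤ CL := by positivity
  set C₂ := 1 / k + CL * C₁ with hC₂
  have hC₂0 : 0 < C₂ := by positivity
  refine ⟨C₁ + C₂ / k / ((1 - M.γ) * ρ₀) + 1 / k, by positivity,
    min (ξ / 2) (M.V M.g πp / 2), lt_min (by linarith) (by linarith), min_le_left _ _,
    fun δ hδ0 hδle π hπ lam hlam G hG => ?_⟩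
  have hδξ : δ ≤ ξ / 2 := hδle.trans (min_le_left _ _)
  have hδp : δ ≤ M.V M.g πp / 2 := hδle.trans (min_le_right _ _)
  have hlmΛ : lm ≤ 1 / ((1 - M.γ) * (ξ - δ)) := by
    refine one_div_le_one_div_of_le (mul_pos hg (by linarith)) ?_
    exact mul_le_mul_of_nonneg_left (by linarith) hg.le
  set y := M.V M.g π with hy
  set hh := D - M.V M.r π - s * y with hhh
  have hh0 : 0 ≤ hh := by have := hD.bound_left π hπ; linarith
  -- A policy optimal at `s` whose constraint value lies on the side of `δ` where `lam` deviates
  -- from `s`; it turns that deviation into duality gap at rate `k`.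
  have hb : ∃ πb ∈ policies S A, M.V M.r πb + s * M.V M.g πb = D ∧
      k * |lam - s| ≤ (lam - s) * (M.V M.g πb - δ) := by
    rcases le_or_gt s lam with h | h
    · refine ⟨πp, hπp, hpD, ?_⟩
      rw [abs_of_nonneg (by linarith), mul_comm]
      exact mul_le_mul_of_nonneg_left (by linarith) (by linarith)
    · rcases hneg with h0 | ⟨-, πm, hπm, hm1, hm2⟩
      · exact absurd hlam.1 (by linarith)
      · refine ⟨πm, hπm, hm1, ?_⟩
        rw [abs_of_neg (by linarith)]
        have := mul_le_mul_of_nonneg_left (show k ≤ -(M.V M.g πm - δ) by linarith)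
          (show 0 ≤ -(lam - s) by linarith)
        linarith
  obtain ⟨πb, hπb, hbD, hbk⟩ := hb
  -- The test multiplier `s` bounds the Lagrangian deficit `hh` and the dual distance; `lm` bounds
  -- the violation of the tightened constraint; zero bounds its slack when `s > 0`.
  have hkey : ∀ lam' ∈ M.Λ (ξ - δ), hh + k * |lam - s| - (lam' - s) * (y - δ) ≤ G := by
    intro lam' hlam'
    have := hG πb hπb lam' hlam'
    nlinarith
  have hk1 := hkey s ⟨hs0, hslm.le.trans hlmΛ⟩
  rw [sub_self, zero_mul, sub_zero] at hk1
  have hk2 := hkey lm ⟨hlm0.le, hlmΛ⟩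
  have hk3 := hkey 0 ⟨le_rfl, hlm0.le.trans hlmΛ⟩
  have hkabs : 0 ≤ k * |lam - s| := by positivity
  have hG0 : 0 ≤ G := by linarith
  have hhG : hh ≤ G := by linarith
  have hlamG : |lam - s| ≤ 1 / k * G := by
    rw [div_mul_eq_mul_div, one_mul, le_div_iff₀ hk0]; linarith
  obtain ⟨π₁, hπ₁, hπ₁V, hπ₁e⟩ := hface π hπ
  rw [hVl _ hπ₁, hVl _ hπp, hpD] at hπ₁V
  have he : ∀ s a, |π₁ s a - π s a| ≤ C₁ * G := by
    intro s' a
    refine (hπ₁e s' a).trans (mul_le_mul_of_nonneg_left ?_ hC₁)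
    rw [hVl _ hπp, hVl _ hπ, hpD]
    linarith
  have hyy := abs_le.1 (M.abs_V_sub_le_of_entries hπ hπ₁ (M.abs_g_le hξ hslater) he)
  set y₁ := M.V M.g π₁ with hy₁
  rw [← hCL] at hyy
  have hup : δ - y ≤ 1 / k * G := by
    rw [div_mul_eq_mul_div, one_mul, le_div_iff₀ hk0]
    rcases le_or_gt δ y with h | h
    · have := mul_nonneg (show 0 ≤ y - δ by linarith) hk0.le
      linarith
    · have := mul_le_mul_of_nonneg_left hkm (show 0 ≤ δ - y by linarith)
      linarith
  have hCG : C₁ * G ≤ (C₁ + C₂ / k / ((1 - M.γ) * ρ₀) + 1 / k) * G :=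
    mul_le_mul_of_nonneg_right (by
      have : 0 ≤ C₂ / k / ((1 - M.γ) * ρ₀) + 1 / k := by positivity
      linarith) hG0
  have hlamC : |lam - s| ≤ (C₁ + C₂ / k / ((1 - M.γ) * ρ₀) + 1 / k) * G :=
    hlamG.trans (mul_le_mul_of_nonneg_right (by
      have : 0 ≤ C₂ / k / ((1 - M.γ) * ρ₀) := by positivity
      linarith) hG0)
  -- After projecting `π` to `π₁` on the optimal face, the constraint value is off by `O(G)`; mixing
  -- with `π₂`, whose value lies on the other side of `δ`, corrects it with weight `O(G)` and stays
  -- on the face.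
  have hadj : ∀ π₂ ∈ policies S A, M.V M.r π₂ + s * M.V M.g π₂ = D → ∀ θ, 0 ≤ θ → θ ≤ 1 →
      θ ≤ C₂ / k * G → (1 - θ) * y₁ + θ * M.V M.g π₂ = δ →
      ∃ πo ∈ policies S A, M.V M.r πo + s * M.V M.g πo = D ∧
        (M.V M.g πo = δ ∨ s = 0 ∧ δ ≤ M.V M.g πo) ∧
        (∀ s a, |πo s a - π s a| ≤ (C₁ + C₂ / k / ((1 - M.γ) * ρ₀) + 1 / k) * G) ∧
        |lam - s| ≤ (C₁ + C₂ / k / ((1 - M.γ) * ρ₀) + 1 / k) * G := by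
    intro π₂ hπ₂ h2D θ h0 h1 hθ heq
    obtain ⟨πo, hπo, hV, hgV, hent⟩ := M.exists_adjusted hρ₀ hρle hπ₁ hπ₂ (c := M.lagr M.g s)
      (by rw [hVl _ hπ₁, hVl _ hπ₂, h2D]; exact hπ₁V) ⟨h0, h1⟩ heq
    rw [hVl _ hπo, hVl _ hπ₁] at hV
    refine ⟨πo, hπo, hV.trans hπ₁V, Or.inl hgV, fun s' a => ?_, hlamC⟩
    have h3 := hent s' a
    have h4 : θ / ((1 - M.γ) * ρ₀) ≤ C₂ / k * G / ((1 - M.γ) * ρ₀) := by gcongr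
    have h5 : |πo s' a - π s' a| ≤ |πo s' a - π₁ s' a| + |π₁ s' a - π s' a| := abs_sub_le _ _ _
    have h6 := he s' a
    have h7 : 0 ≤ 1 / k * G := by positivity
    have h8 : (C₁ + C₂ / k / ((1 - M.γ) * ρ₀) + 1 / k) * G
        = C₁ * G + C₂ / k * G / ((1 - M.γ) * ρ₀) + 1 / k * G := by ring
    rw [h8]
    linarith
  have hratio : ∀ p q : ℝ, 0 ≤ p → p ≤ C₂ * G → p ≤ q → k ≤ q →
      0 ≤ p / q ∧ p / q ≤ 1 ∧ p / q ≤ C₂ / k * G := by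
    intro p q hp hpC hpq hkq
    have hq : 0 < q := hk0.trans_le hkq
    refine ⟨div_nonneg hp hq.le, div_le_one_of_le₀ hpq hq.le, ?_⟩
    calc p / q ≤ C₂ * G / k := div_le_div₀ (by positivity) hpC hk0 hkq
      _ = _ := by ring
  rcases lt_or_ge y₁ δ with hlt | hge
  · obtain ⟨r0, r1, r2⟩ := hratio (δ - y₁) (M.V M.g πp - y₁) (by linarith)
      (by rw [hC₂, add_mul]; linarith) (by linarith) (by linarith)
    refine hadj πp hπp hpD _ r0 r1 r2 ?_
    have : M.V M.g πp - y₁ ≠ 0 := by linarith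
    field_simp
    ring
  · rcases hneg with h0 | ⟨hks, πm, hπm, hm1, hm2⟩
    · exact ⟨π₁, hπ₁, hπ₁V, Or.inr ⟨h0, hge⟩, fun s' a => (he s' a).trans hCG, hlamC⟩
    · have hdown : y - δ ≤ 1 / k * G := by
        rw [div_mul_eq_mul_div, one_mul, le_div_iff₀ hk0]
        rcases le_or_gt y δ with h | h
        · have := mul_nonneg (show 0 ≤ δ - y by linarith) hk0.le
          linarith
        · have := mul_le_mul_of_nonneg_left (hkk.trans hks) (show 0 ≤ y - δ by linarith)
          linarith
      obtain ⟨r0, r1, r2⟩ := hratio (y₁ - δ) (y₁ - M.V M.g πm) (by linarith)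
        (by rw [hC₂, add_mul]; linarith) (by linarith) (by linarith)
      refine hadj πm hπm hm1 _ r0 r1 r2 ?_
      have : y₁ - M.V M.g πm ≠ 0 := by linarith
      field_simp
      ring

/-- Error bound, up to the margin, when the dual solution is not unique. -/
lemma exists_error_bound_interval {ξ D s₁ s₂ : ℝ} (hξ : 0 < ξ) (hρ : ∀ s, 0 < M.ρ s)
    (hD : M.IsDualInterval ξ D s₁ s₂) (hlt : s₁ < s₂) :
    ∃ C > 0, ∀ δ, 0 < δ → δ ≤ ξ / 2 → ∀ π ∈ policies S A, ∀ lam ∈ M.Λ (ξ - δ),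
      ∀ G, (∀ π' ∈ policies S A, ∀ lam' ∈ M.Λ (ξ - δ),
        M.V M.r π' + lam * (M.V M.g π' - δ) - (M.V M.r π + lam' * (M.V M.g π - δ)) ≤ G) →
      ∃ πo ∈ policies S A, M.V M.r πo = D ∧ M.V M.g πo = 0 ∧ ∃ lamo ∈ Set.Icc s₁ s₂,
        (∀ s a, |πo s a - π s a| ≤ C * (G + δ)) ∧ |lam - lamo| ≤ C * (G + δ) := by
  have hg := M.one_sub_γ_pos
  have hs0 := hD.nonneg
  obtain ⟨π₀, hπ₀, h0D, h0g⟩ := hD.exists_mid hlt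
  obtain ⟨πp, hπp, hpD, hpg⟩ := hD.exists_right
  -- At an interior multiplier the Lagrangian maximizers are exactly the policies with reward `D`
  -- and constraint value zero: any other constraint value would break the bound at one of the two
  -- ends.
  set m := (s₁ + s₂) / 2 with hm
  have hVl : ∀ π ∈ policies S A, M.V (M.lagr M.g m) π = M.V M.r π + m * M.V M.g π :=
    fun π hπ => M.V_lagr hπ _ _
  have hbm : ∀ π ∈ policies S A, M.V M.r π + m * M.V M.g π ≤ D := fun π hπ => by
    have h1 := hD.bound_left π hπ
    have h2 := hD.bound_right π hπ
    rw [hm]; linarith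
  have hopt : ∀ π' ∈ policies S A, M.V (M.lagr M.g m) π' ≤ M.V (M.lagr M.g m) π₀ :=
    fun π' hπ' => by
      rw [hVl _ hπ', hVl _ hπ₀, h0D, h0g, mul_zero, add_zero]; exact hbm π' hπ'
  obtain ⟨C₁, hC₁, hface⟩ := M.exists_face_bound hρ hπ₀ hopt
  set Lm := 2 / ((1 - M.γ) * ξ) with hLm
  have hLm0 : 0 < Lm := by positivity
  have hneg : ∃ k > 0, s₁ = 0 ∨ ∃ π ∈ policies S A,
      M.V M.r π + s₁ * M.V M.g π = D ∧ M.V M.g π ≤ -k := by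
    rcases hD.exists_left with h | ⟨π, hπ, h1, h2⟩
    · exact ⟨1, one_pos, Or.inl h⟩
    · exact ⟨-M.V M.g π, neg_pos.2 h2, Or.inr ⟨π, hπ, h1, by linarith⟩⟩
  obtain ⟨k₀, hk₀, hneg⟩ := hneg
  obtain ⟨k, hk0, hkk, hkp⟩ : ∃ k > 0, k ≤ k₀ ∧ k ≤ M.V M.g πp :=
    ⟨min k₀ (M.V M.g πp), lt_min hk₀ hpg, min_le_left _ _, min_le_right _ _⟩
  refine ⟨(C₁ + 1 / k) * (1 + Lm), by positivity, fun δ hδ0 hδξ π hπ lam hlam G hG => ?_⟩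
  have hlamL : lam ≤ Lm := hlam.2.trans (M.dual_length_le hξ hδξ)
  have hlmΛ : 1 / ((1 - M.γ) * ξ) ≤ 1 / ((1 - M.γ) * (ξ - δ)) := by
    refine one_div_le_one_div_of_le (mul_pos hg (by linarith)) ?_
    exact mul_le_mul_of_nonneg_left (by linarith) hg.le
  have hmΛ : m ∈ M.Λ (ξ - δ) :=
    ⟨by rw [hm]; linarith, by have := hD.le_length; rw [hm]; linarith⟩
  set y := M.V M.g π with hy
  set hh := D - M.V M.r π - m * y with hhh
  have hh0 : 0 ≤ hh := by have := hbm π hπ; linarith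
  have hlm : (lam - m) * δ ≤ Lm * δ := mul_le_mul_of_nonneg_right (by linarith [hmΛ.1]) hδ0.le
  have hE : hh ≤ G + Lm * δ := by
    have := hG π₀ hπ₀ m hmΛ
    rw [h0D, h0g] at this
    linarith
  have hEE : G + Lm * δ ≤ (1 + Lm) * (G + δ) := by
    have h1 : 0 ≤ Lm * (G + Lm * δ) := mul_nonneg hLm0.le (hh0.trans hE)
    have h2 := hh0.trans hE
    rcases le_or_gt 0 G with h | h
    · have := mul_nonneg hLm0.le h
      linarith
    · have h3 : (lam - m) * δ - G ≤ 0 ∨ 0 ≤ G + δ := by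
        right
        have := hG π hπ lam hlam
        linarith
      have h4 : 0 ≤ G := by
        have := hG π hπ lam hlam
        linarith
      linarith
  obtain ⟨πo, hπo, hoV, hoe⟩ := hface π hπ
  rw [hVl _ hπo, hVl _ hπ₀, h0D, h0g, mul_zero, add_zero] at hoV
  have hog : M.V M.g πo = 0 := by
    have h1 := hD.bound_left πo hπo
    have h2 := hD.bound_right πo hπo
    have h3 : (s₂ - s₁) * M.V M.g πo ≤ 0 := by rw [hm] at hoV; linarith
    have h4 : 0 ≤ (s₂ - s₁) * M.V M.g πo := by rw [hm] at hoV; linarith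
    rcases mul_eq_zero.1 (le_antisymm h3 h4) with h | h
    · linarith
    · exact h
  rw [hog, mul_zero, add_zero] at hoV
  have hGp : 0 ≤ (1 + Lm) * (G + δ) := (hh0.trans hE).trans hEE
  -- Outside `[s₁, s₂]` the policy active at the nearer end, tested against the multiplier `m`,
  -- turns the dual distance into gap, up to the error `Lm * δ` of the tightening.
  have hlamo : ∃ lamo ∈ Set.Icc s₁ s₂, k * |lam - lamo| ≤ G + Lm * δ := by
    rcases lt_or_ge s₂ lam with h | h
    · refine ⟨s₂, ⟨hD.le, le_rfl⟩, ?_⟩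
      rw [abs_of_nonneg (by linarith)]
      have h1 := hG πp hπp m hmΛ
      have h2 := mul_le_mul_of_nonneg_right hkp (show 0 ≤ lam - s₂ by linarith)
      nlinarith
    · rcases le_or_gt s₁ lam with h' | h'
      · exact ⟨lam, ⟨h', h⟩, by rw [sub_self, abs_zero, mul_zero]; linarith⟩
      · rcases hneg with h0 | ⟨πm, hπm, hm1, hm2⟩
        · exact absurd hlam.1 (by linarith)
        · refine ⟨s₁, ⟨le_rfl, hD.le⟩, ?_⟩
          rw [abs_of_neg (by linarith)]
          have h1 := hG πm hπm m hmΛ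
          have h2 := mul_le_mul_of_nonneg_right (show k ≤ -M.V M.g πm by linarith)
            (show 0 ≤ s₁ - lam by linarith)
          nlinarith
  obtain ⟨lamo, hlamo, hlamk⟩ := hlamo
  refine ⟨πo, hπo, hoV, hog, lamo, hlamo, fun s a => ?_, ?_⟩
  · refine (hoe s a).trans ?_
    rw [hVl _ hπ, hVl _ hπ₀, h0D, h0g, mul_zero, add_zero]
    calc C₁ * (D - (M.V M.r π + m * M.V M.g π)) ≤ C₁ * ((1 + Lm) * (G + δ)) :=
          mul_le_mul_of_nonneg_left (by linarith) hC₁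
      _ ≤ (C₁ + 1 / k) * ((1 + Lm) * (G + δ)) :=
        mul_le_mul_of_nonneg_right (by linarith [one_div_pos.2 hk0]) hGp
      _ = _ := by ring
  · calc |lam - lamo| ≤ 1 / k * ((1 + Lm) * (G + δ)) := by
          rw [div_mul_eq_mul_div, one_mul, le_div_iff₀ hk0]; linarith
      _ ≤ (C₁ + 1 / k) * ((1 + Lm) * (G + δ)) := mul_le_mul_of_nonneg_right (by linarith) hGp
      _ = _ := by ring

end CMDP

/-! ### Optimistic steps -/

/-- Use the optimality of `q'` tested at `x` and that of the extrapolated point `p` tested at `q'`.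
Both start from `q`, so the squares telescope, and the mismatch of the directions is absorbed by
half of the term in `q' - p`. -/
lemma optimistic_step {ι : Type*} [Fintype ι] {K : Set (ι → ℝ)} (hK : Convex ℝ K) {η : ℝ}
    (hη : 0 < η) {D D' q p q' : ι → ℝ} (hp : p ∈ K) (hq' : q' ∈ K)
    (hpmax : IsMaxOn (fun x : ι → ℝ => ∑ i, x i * D' i - 1 / (2 * η) * ∑ i, (x i - q i) ^ 2) K p)
    (hqmax : IsMaxOn (fun x : ι → ℝ => ∑ i, x i * D i - 1 / (2 * η) * ∑ i, (x i - q i) ^ 2) K q')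
    {x : ι → ℝ} (hx : x ∈ K) :
    η * ∑ i, (x i - p i) * D i ≤ 1 / 2 * ∑ i, (q i - x i) ^ 2 - 1 / 2 * ∑ i, (q' i - x i) ^ 2
      - 1 / 4 * ∑ i, (q' i - p i) ^ 2 - 1 / 2 * ∑ i, (p i - q i) ^ 2
      + η ^ 2 * ∑ i, (D i - D' i) ^ 2 := by
  have h1 := proj_foc hK hη hq' hqmax hx
  have h2 := proj_foc hK hη hp hpmax hq'
  simp only [Finset.mul_sum] at h1 h2 ⊢
  have h3 : ∑ i, (η * ((x i - p i) * D i) + 1 / 4 * (q' i - p i) ^ 2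
        - η * ((x i - q' i) * D i) - η * ((q' i - p i) * D' i))
      ≤ ∑ i, (1 / 2 * (q' i - p i) ^ 2 + η ^ 2 * (D i - D' i) ^ 2) :=
    Finset.sum_le_sum fun i _ => by
      nlinarith [sq_nonneg ((q' i - p i) / 2 - η * (D i - D' i))]
  have h4 : ∑ i, ((q' i - q i) * (x i - q' i) + (p i - q i) * (q' i - p i))
      = ∑ i, (1 / 2 * (q i - x i) ^ 2 - 1 / 2 * (q' i - x i) ^ 2 - 1 / 2 * (q' i - p i) ^ 2
        - 1 / 2 * (p i - q i) ^ 2) := Finset.sum_congr rfl fun i _ => by ring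
  simp only [Finset.sum_add_distrib, Finset.sum_sub_distrib] at h3 h4
  have e : ∑ i, 1 / 2 * (q' i - p i) ^ 2
      = ∑ i, 1 / 4 * (q' i - p i) ^ 2 + ∑ i, 1 / 4 * (q' i - p i) ^ 2 := by
    rw [← Finset.sum_add_distrib]
    exact Finset.sum_congr rfl fun i _ => by ring
  linarith only [h1, h2, h3, h4, e]

lemma optimistic_step_real {l u η : ℝ} (hη : 0 < η) {v v' q p q' : ℝ} (hp : p ∈ Set.Icc l u)
    (hq' : q' ∈ Set.Icc l u)
    (hpmin : IsMinOn (fun x : ℝ => x * v' + 1 / (2 * η) * (x - q) ^ 2) (Set.Icc l u) p)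
    (hqmin : IsMinOn (fun x : ℝ => x * v + 1 / (2 * η) * (x - q) ^ 2) (Set.Icc l u) q')
    {x : ℝ} (hx : x ∈ Set.Icc l u) :
    η * ((p - x) * v) ≤ 1 / 2 * (q - x) ^ 2 - 1 / 2 * (q' - x) ^ 2 - 1 / 4 * (q' - p) ^ 2
      - 1 / 2 * (p - q) ^ 2 + η ^ 2 * (v - v') ^ 2 := by
  have h1 := prox_real_foc hη hq' hqmin hx
  have h2 := prox_real_foc hη hp hpmin hq'
  linarith only [h1, h2, sq_nonneg ((q' - p) / 2 + η * (v - v'))]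

namespace CMDP

variable {S : Type uS} {A : Type uA} [Fintype S] [Fintype A] (M : CMDP S A)

/-! ### Lipschitz constants of the gradients -/

lemma ρmin_le (s : S) : M.ρmin ≤ M.ρ s := ciInf_le (Set.finite_range _).bddBelow s

lemma ρmin_pos (hρ : ∀ s, 0 < M.ρ s) : 0 < M.ρmin := by
  have := M.nonempty_state
  obtain ⟨s, hs⟩ := exists_eq_ciInf_of_finite (f := M.ρ)
  rw [ρmin, ← hs]
  exact hρ s

lemma ρmin_le_one : M.ρmin ≤ 1 := by
  obtain ⟨s⟩ := M.nonempty_state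
  exact (M.ρmin_le s).trans (coord_le_one M.ρ_mem s)

lemma dρ_le_κρ_mul (hρ : ∀ s, 0 < M.ρ s) {π : S → A → ℝ} (hπ : π ∈ policies S A) (s : S) :
    M.dρ π s ≤ M.κρ * M.ρ s := by
  rw [← div_le_iff₀ (hρ s)]
  refine le_csSup ⟨1 / M.ρmin, ?_⟩ ⟨π, hπ, s, rfl⟩
  rintro _ ⟨π, hπ, s, rfl⟩
  have h1 : M.dρ π s ≤ 1 := by
    have h := mul_le_mul_of_nonneg_left (M.socc_le hπ s) M.one_sub_γ_pos.le
    rwa [mul_one_div_cancel M.one_sub_γ_pos.ne', ← dρ_eq] at h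
  exact div_le_div₀ zero_le_one h1 (M.ρmin_pos hρ) (M.ρmin_le s)

lemma sq_sum_mul_le_card {x D : A → ℝ} {B : ℝ} (hD : ∀ a, |D a| ≤ B) :
    (∑ a, x a * D a) ^ 2 ≤ Fintype.card A * B ^ 2 * ∑ a, x a ^ 2 := by
  refine (Finset.sum_mul_sq_le_sq_mul_sq _ _ _).trans ?_
  rw [mul_comm]
  refine mul_le_mul_of_nonneg_right ?_ (Finset.sum_nonneg fun a _ => sq_nonneg _)
  calc ∑ a, D a ^ 2 ≤ ∑ _a : A, B ^ 2 := Finset.sum_le_sum fun a _ => sq_le_sq.2 ((hD a).trans (le_abs_self B))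
    _ = _ := by simp

/-- The squared distance of two primal-dual pairs, with weighted states. -/
def wDistSq (w : S → ℝ) (π : S → A → ℝ) (lam : ℝ) (π' : S → A → ℝ) (lam' : ℝ) : ℝ :=
  ∑ s, w s * ∑ a, (π s a - π' s a) ^ 2 + (lam - lam') ^ 2

lemma Q_lagr {π : S → A → ℝ} (hπ : π ∈ policies S A) (h : S → A → ℝ) (k : ℝ) (s : S) (a : A) :
    M.Q (M.lagr h k) π s a = M.Q M.r π s a + k * M.Q h π s a := M.Q_add_smul hπ _ _ _ _ _

/-- Weights above `ρ` allow both estimates: a single state distance is at most the weighted distance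
over `ρmin`, which controls the action values, and the occupancy of `π` is at most `κρ / (1 - γ)`
times the weight, which controls the constraint value. The three summands of `iota` are the
constraint, policy and multiplier contributions. -/
lemma gradient_lipschitz (hρ : ∀ s, 0 < M.ρ s) {ξ : ℝ} {h : S → A → ℝ}
    (hh : ∀ s a, |h s a| ≤ 1) {w : S → ℝ} (hw : ∀ s, M.ρ s ≤ w s) (hw1 : ∑ s, w s = 1 / (1 - M.γ))
    {π π' : S → A → ℝ} (hπ : π ∈ policies S A) (hπ' : π' ∈ policies S A) {lam lam' : ℝ}
    (hlam : lam ∈ M.Λ ξ) :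
    wDistSq w (M.Q (M.lagr h lam) π) (M.V h π) (M.Q (M.lagr h lam') π') (M.V h π')
      ≤ M.iota ξ * wDistSq w π lam π' lam' := by
  have hg := M.one_sub_γ_pos
  have hg1 := M.one_sub_γ_le_one
  have hγ := M.γ_mem.1
  have hm := M.ρmin_pos hρ
  obtain ⟨n, hn⟩ : ∃ n : ℝ, n = Fintype.card A := ⟨_, rfl⟩
  obtain ⟨l, hl⟩ : ∃ l, l = 1 / ((1 - M.γ) * ξ) := ⟨_, rfl⟩
  have hn0 : 0 ≤ n := by rw [hn]; positivity
  have hlam' : |lam| ≤ l := by rw [abs_of_nonneg hlam.1, hl]; exact hlam.2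
  have hl0 : 0 ≤ l := (abs_nonneg _).trans hlam'
  have hw0 : ∀ s, 0 ≤ w s := fun s => (hρ s).le.trans (hw s)
  obtain ⟨p, hp⟩ : ∃ p : S → ℝ, p = fun s => ∑ a, (π s a - π' s a) ^ 2 := ⟨_, rfl⟩
  have hp0 : ∀ s, 0 ≤ p s := fun s => by
    rw [hp]; exact Finset.sum_nonneg fun a _ => sq_nonneg _
  obtain ⟨P, hP⟩ : ∃ P : ℝ, P = ∑ s, w s * p s := ⟨_, rfl⟩
  have hP0 : 0 ≤ P := hP ▸ Finset.sum_nonneg fun s _ => mul_nonneg (hw0 s) (hp0 s)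
  have hpP : ∀ s, p s ≤ P / M.ρmin := fun s => by
    rw [le_div_iff₀ hm, mul_comm, hP]
    exact (mul_le_mul_of_nonneg_right ((M.ρmin_le s).trans (hw s)) (hp0 s)).trans
      (Finset.single_le_sum (f := fun s => w s * p s)
        (fun s _ => mul_nonneg (hw0 s) (hp0 s)) (Finset.mem_univ s))
  -- policy part of the change of the action values
  obtain ⟨X, hX⟩ : ∃ X, X = 2 * M.γ ^ 2 * n * (1 + l ^ 2) / ((1 - M.γ) ^ 4 * M.ρmin) * P := ⟨_, rfl⟩
  have hQmax : ∀ s a, |M.Q (M.lagr h lam) π' s a| ≤ (1 + l) / (1 - M.γ) := fun s a =>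
    M.abs_Q_le hπ' (fun s a => M.abs_lagr_le hh hlam' s a) s a
  have h1 : ∀ s a, (M.Q (M.lagr h lam) π s a - M.Q (M.lagr h lam) π' s a) ^ 2 ≤ X := by
    intro s a
    have hB : ∀ s, |∑ a, (π s a - π' s a) * M.Q (M.lagr h lam) π' s a|
        ≤ Real.sqrt (n * ((1 + l) / (1 - M.γ)) ^ 2 * (P / M.ρmin)) := fun s => by
      refine Real.le_sqrt_of_sq_le ?_
      rw [sq_abs]
      refine (sq_sum_mul_le_card (hQmax s)).trans ?_
      rw [← hn]
      refine mul_le_mul_of_nonneg_left ?_ (by positivity)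
      have := hpP s
      rwa [hp] at this
    have h2 := M.abs_Q_sub_le hπ' hπ _ hB s a
    have h3 := pow_le_pow_left₀ (abs_nonneg _) h2 2
    rw [sq_abs, mul_pow, Real.sq_sqrt (by positivity)] at h3
    refine h3.trans ?_
    have e1 : (M.γ / (1 - M.γ)) ^ 2 * (n * ((1 + l) / (1 - M.γ)) ^ 2 * (P / M.ρmin))
        = M.γ ^ 2 * n / ((1 - M.γ) ^ 4 * M.ρmin) * P * (1 + l) ^ 2 := by
      field_simp
    have e2 : X = M.γ ^ 2 * n / ((1 - M.γ) ^ 4 * M.ρmin) * P * (2 * (1 + l ^ 2)) := by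
      rw [hX]; field_simp
    rw [e1, e2]
    exact mul_le_mul_of_nonneg_left (by linarith only [sq_nonneg (1 - l)]) (by positivity)
  have h2 : ∀ s a, (M.Q (M.lagr h lam) π s a - M.Q (M.lagr h lam') π' s a) ^ 2
      ≤ 2 * X + 2 * ((lam - lam') ^ 2 / (1 - M.γ) ^ 2) := by
    intro s a
    have e : M.Q (M.lagr h lam) π s a - M.Q (M.lagr h lam') π' s a
        = (M.Q (M.lagr h lam) π s a - M.Q (M.lagr h lam) π' s a) + (lam - lam') * M.Q h π' s a := by
      rw [M.Q_lagr hπ', M.Q_lagr hπ']; ring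
    have h3 : (M.Q h π' s a) ^ 2 ≤ (1 / (1 - M.γ)) ^ 2 :=
      sq_le_sq.2 ((M.abs_Q_le hπ' hh s a).trans (le_abs_self _))
    have h4 := mul_le_mul_of_nonneg_left h3 (sq_nonneg (lam - lam'))
    have e2 : (lam - lam') ^ 2 * (1 / (1 - M.γ)) ^ 2 = (lam - lam') ^ 2 / (1 - M.γ) ^ 2 := by
      field_simp
    rw [e2] at h4
    rw [e]
    have h5 := h1 s a
    linarith only [h4, h5, sq_nonneg ((M.Q (M.lagr h lam) π s a - M.Q (M.lagr h lam) π' s a)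
      - (lam - lam') * M.Q h π' s a)]
  have h3 : ∑ s, w s * ∑ a, (M.Q (M.lagr h lam) π s a - M.Q (M.lagr h lam') π' s a) ^ 2
      ≤ 1 / (1 - M.γ) * (n * (2 * X + 2 * ((lam - lam') ^ 2 / (1 - M.γ) ^ 2))) := by
    rw [← hw1, Finset.sum_mul]
    refine Finset.sum_le_sum fun s _ => mul_le_mul_of_nonneg_left ?_ (hw0 s)
    exact (Finset.sum_le_sum fun a _ => h2 s a).trans (le_of_eq (by
      rw [Finset.sum_const, Finset.card_univ, nsmul_eq_mul, hn]))
  -- the change of the constraint value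
  have h4 : (M.V h π - M.V h π') ^ 2 ≤ M.κρ ^ 2 * n / (1 - M.γ) ^ 5 * P := by
    rw [M.performance_difference hπ' hπ]
    have hb : ∀ s, (∑ a, (π s a - π' s a) * M.Q h π' s a) ^ 2 ≤ n * (1 / (1 - M.γ)) ^ 2 * p s := by
      intro s
      rw [hn, hp]
      exact sq_sum_mul_le_card (M.abs_Q_le hπ' hh s)
    have hocc : ∀ s, M.socc π s ≤ M.κρ / (1 - M.γ) * w s := fun s => by
      have h5 := M.dρ_le_κρ_mul hρ hπ s
      have hκ : 0 ≤ M.κρ := by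
        have h6 : 0 ≤ M.dρ π s := by rw [dρ_eq]; exact mul_nonneg hg.le (M.socc_nonneg hπ s)
        exact nonneg_of_mul_nonneg_left (h6.trans h5) (hρ s)
      have h6 := h5.trans (mul_le_mul_of_nonneg_left (hw s) hκ)
      rw [dρ_eq] at h6
      rw [div_mul_eq_mul_div, le_div_iff₀ hg]
      linarith only [h6]
    obtain ⟨y, hy⟩ : ∃ y : S → ℝ, y = fun s => ∑ a, (π s a - π' s a) * M.Q h π' s a := ⟨_, rfl⟩
    have hy' : ∀ s, y s ^ 2 ≤ n * (1 / (1 - M.γ)) ^ 2 * p s := fun s => by rw [hy]; exact hb s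
    have e0 : ∑ s, M.socc π s * ∑ a, (π s a - π' s a) * M.Q h π' s a = ∑ s, M.socc π s * y s := by
      rw [hy]
    rw [e0]
    have h5 : |∑ s, M.socc π s * y s| ≤ M.κρ / (1 - M.γ) * ∑ s, w s * |y s| := by
      refine (Finset.abs_sum_le_sum_abs _ _).trans ?_
      rw [Finset.mul_sum]
      refine Finset.sum_le_sum fun s _ => ?_
      rw [abs_mul, abs_of_nonneg (M.socc_nonneg hπ s), ← mul_assoc]
      exact mul_le_mul_of_nonneg_right (hocc s) (abs_nonneg _)
    have h6 := pow_le_pow_left₀ (abs_nonneg _) h5 2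
    rw [sq_abs, mul_pow] at h6
    have h7 : (∑ s, w s * |y s|) ^ 2 ≤ (∑ s, w s) * ∑ s, w s * y s ^ 2 := by
      refine Finset.sum_sq_le_sum_mul_sum_of_sq_le_mul _ (fun s _ => hw0 s)
        (fun s _ => mul_nonneg (hw0 s) (sq_nonneg _)) fun s _ => ?_
      rw [mul_pow, sq_abs]
      exact le_of_eq (by ring)
    have h8 : ∑ s, w s * y s ^ 2 ≤ n * (1 / (1 - M.γ)) ^ 2 * P := by
      rw [hP, Finset.mul_sum]
      exact Finset.sum_le_sum fun s _ => (mul_le_mul_of_nonneg_left (hy' s) (hw0 s)).trans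
        (le_of_eq (by ring))
    rw [hw1] at h7
    have h9 := h7.trans (mul_le_mul_of_nonneg_left h8 (by positivity))
    refine (h6.trans (mul_le_mul_of_nonneg_left h9 (sq_nonneg _))).trans (le_of_eq ?_)
    field_simp
  have e1 : wDistSq w π lam π' lam' = P + (lam - lam') ^ 2 := by rw [wDistSq, hP, hp]
  rw [e1, wDistSq]
  obtain ⟨Y, hY⟩ : ∃ Y, Y = (lam - lam') ^ 2 := ⟨_, rfl⟩
  have hY0 : 0 ≤ Y := hY ▸ sq_nonneg _
  rw [← hY] at h3 ⊢
  obtain ⟨i₁, hi₁⟩ : ∃ i, i = M.κρ ^ 2 * n / (1 - M.γ) ^ 6 := ⟨_, rfl⟩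
  obtain ⟨i₂, hi₂⟩ : ∃ i, i = 4 * M.γ ^ 2 * n ^ 2 / ((1 - M.γ) ^ 6 * M.ρmin) * (1 + l ^ 2) :=
    ⟨_, rfl⟩
  obtain ⟨i₃, hi₃⟩ : ∃ i, i = 2 * n / (1 - M.γ) ^ 3 := ⟨_, rfl⟩
  have hi₁0 : 0 ≤ i₁ := by rw [hi₁]; positivity
  have hi₂0 : 0 ≤ i₂ := by rw [hi₂]; positivity
  have hi₃0 : 0 ≤ i₃ := by rw [hi₃]; positivity
  have ei : M.iota ξ = 2 * i₁ + 2 * i₂ + 2 * i₃ := by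
    rw [iota, hi₁, hi₂, hi₃, hl, ← hn, div_pow, mul_pow]
    ring
  have e3 : 1 / (1 - M.γ) * (n * (2 * X + 2 * (Y / (1 - M.γ) ^ 2)))
      = (1 - M.γ) * (i₂ * P) + i₃ * Y := by
    rw [hX, hi₂, hi₃]; field_simp; ring
  have e4 : M.κρ ^ 2 * n / (1 - M.γ) ^ 5 * P = (1 - M.γ) * (i₁ * P) := by
    rw [hi₁]; field_simp
  rw [e3] at h3
  rw [e4] at h4
  rw [ei]
  have f1 := mul_le_of_le_one_left (mul_nonneg hi₁0 hP0) hg1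
  have f2 := mul_le_of_le_one_left (mul_nonneg hi₂0 hP0) hg1
  have f3 := mul_nonneg hi₁0 hP0
  have f4 := mul_nonneg hi₂0 hP0
  have f5 := mul_nonneg hi₃0 hP0
  have f6 := mul_nonneg hi₁0 hY0
  have f7 := mul_nonneg hi₂0 hY0
  have f8 := mul_nonneg hi₃0 hY0
  linarith only [h3, h4, f1, f2, f3, f4, f5, f6, f7, f8]

end CMDP

namespace CMDP

variable {S : Type uS} {A : Type uA} [Fintype S] [Fintype A] (M : CMDP S A)

/-! ### Descent of optimistic gradient steps -/

lemma wDistSq_nonneg {w : S → ℝ} (hw : ∀ s, 0 ≤ w s) (π : S → A → ℝ) (lam : ℝ) (π' : S → A → ℝ)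
    (lam' : ℝ) : 0 ≤ wDistSq w π lam π' lam' :=
  add_nonneg (Finset.sum_nonneg fun s _ => mul_nonneg (hw s) (Finset.sum_nonneg fun _ _ =>
    sq_nonneg _)) (sq_nonneg _)

lemma wDistSq_triangle {w : S → ℝ} (hw : ∀ s, 0 ≤ w s) (π : S → A → ℝ) (lam : ℝ)
    (π' : S → A → ℝ) (lam' : ℝ) (π'' : S → A → ℝ) (lam'' : ℝ) :
    wDistSq w π lam π'' lam'' ≤ 2 * wDistSq w π lam π' lam' + 2 * wDistSq w π' lam' π'' lam'' := by
  have h1 : ∑ s, w s * ∑ a, (π s a - π'' s a) ^ 2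
      ≤ ∑ s, w s * ∑ a, (2 * (π s a - π' s a) ^ 2 + 2 * (π' s a - π'' s a) ^ 2) :=
    Finset.sum_le_sum fun s _ => mul_le_mul_of_nonneg_left (Finset.sum_le_sum fun a _ => by
      linarith only [sq_nonneg ((π s a - π' s a) - (π' s a - π'' s a))]) (hw s)
  have e : ∑ s, w s * ∑ a, (2 * (π s a - π' s a) ^ 2 + 2 * (π' s a - π'' s a) ^ 2)
      = 2 * (∑ s, w s * ∑ a, (π s a - π' s a) ^ 2)
        + 2 * ∑ s, w s * ∑ a, (π' s a - π'' s a) ^ 2 := by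
    simp only [Finset.mul_sum, ← Finset.sum_add_distrib]
    exact Finset.sum_congr rfl fun s _ => Finset.sum_congr rfl fun a _ => by ring
  simp only [wDistSq]
  linarith only [h1, e, sq_nonneg ((lam - lam') - (lam' - lam''))]

lemma wDistSq_mono {w w' : S → ℝ} {k : ℝ} (hw : ∀ s, w s ≤ k * w' s) (hk : 1 ≤ k) (π : S → A → ℝ)
    (lam : ℝ) (π' : S → A → ℝ) (lam' : ℝ) :
    wDistSq w π lam π' lam' ≤ k * wDistSq w' π lam π' lam' := by
  rw [wDistSq, wDistSq, mul_add, Finset.mul_sum]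
  refine add_le_add (Finset.sum_le_sum fun s _ => ?_) (le_mul_of_one_le_left (sq_nonneg _) hk)
  rw [← mul_assoc]
  exact mul_le_mul_of_nonneg_right (hw s) (Finset.sum_nonneg fun a _ => sq_nonneg _)

section Iterates

variable {M} {h : S → A → ℝ} {ξ η : ℝ} {π πh : ℕ → S → A → ℝ} {lam lamh : ℕ → ℝ}

lemma IsOPG.mem_π (H : M.IsOPG h ξ η π πh lam lamh) (t : ℕ) : π t ∈ policies S A := by
  cases t with
  | zero => exact H.init_π
  | succ t => exact fun s => (H.step_π t s).1

lemma IsOPG.mem_πh (H : M.IsOPG h ξ η π πh lam lamh) (t : ℕ) : πh t ∈ policies S A := by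
  cases t with
  | zero => rw [H.init_πh]; exact H.init_π
  | succ t => exact fun s => (H.step_πh t s).1

lemma IsOPG.mem_lam (H : M.IsOPG h ξ η π πh lam lamh) (t : ℕ) : lam t ∈ M.Λ ξ := by
  cases t with
  | zero => exact H.init_lam
  | succ t => exact (H.step_lam t).1

lemma IsOPG.mem_lamh (H : M.IsOPG h ξ η π πh lam lamh) (t : ℕ) : lamh t ∈ M.Λ ξ := by
  cases t with
  | zero => rw [H.init_lamh]; exact H.init_lam
  | succ t => exact (H.step_lamh t).1

/-- Only the first entry of the threshold enters. With the factor 2 of the triangle inequality, 1/16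
becomes the 1/8 that the descent can afford. -/
lemma sq_mul_iota_le (hη : 0 < η) (hthr : η ≤ M.opgThreshold ξ) (hi : 0 ≤ M.iota ξ) :
    η ^ 2 * M.iota ξ ≤ 1 / 16 := by
  have h1 : η ≤ 1 / (4 * Real.sqrt (M.iota ξ)) := hthr.trans (min_le_left _ _)
  rcases hi.eq_or_lt with h0 | h0
  · rw [← h0]; norm_num
  have h2 := Real.sqrt_pos.2 h0
  rw [le_div_iff₀ (by positivity)] at h1
  have h3 := pow_le_pow_left₀ (by positivity) h1 2
  have h4 := Real.sq_sqrt hi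
  have e : (η * (4 * Real.sqrt (M.iota ξ))) ^ 2 = 16 * (η ^ 2 * Real.sqrt (M.iota ξ) ^ 2) := by ring
  rw [e, h4] at h3
  linarith only [h3]

lemma iota_nonneg (hρ : ∀ s, 0 < M.ρ s) (ξ : ℝ) : 0 ≤ M.iota ξ := by
  have hg := M.one_sub_γ_pos
  have hm := M.ρmin_pos hρ
  have hγ := M.γ_mem.1
  rw [iota]
  positivity

/-- The weighted squared distance, with a correction, decreases along the iterates. -/
lemma IsOPG.descent (H : M.IsOPG h ξ η π πh lam lamh) (hρ : ∀ s, 0 < M.ρ s)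
    (hh : ∀ s a, |h s a| ≤ 1) (hη : 0 < η) (hthr : η ≤ M.opgThreshold ξ) {πo : S → A → ℝ}
    (hπo : πo ∈ policies S A) {lamo : ℝ} (hlamo : lamo ∈ M.Λ ξ) {d : ℝ}
    (hsad : ∀ π ∈ policies S A, ∀ lam ∈ M.Λ ξ,
      M.V M.r π + lamo * M.V h π - (M.V M.r πo + lam * M.V h πo) ≤ d * |lam - lamo|) (t : ℕ) :
    1 / 2 * wDistSq (M.socc πo) (πh (t + 2)) (lamh (t + 2)) πo lamo
        + 3 / 16 * wDistSq (M.socc πo) (πh (t + 2)) (lamh (t + 2)) (π (t + 1)) (lam (t + 1))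
      ≤ 1 / 2 * wDistSq (M.socc πo) (πh (t + 1)) (lamh (t + 1)) πo lamo
        + 3 / 16 * wDistSq (M.socc πo) (πh (t + 1)) (lamh (t + 1)) (π t) (lam t)
        - 1 / 16 * wDistSq (M.socc πo) (πh (t + 2)) (lamh (t + 2)) (π (t + 1)) (lam (t + 1))
        - 3 / 8 * wDistSq (M.socc πo) (π (t + 1)) (lam (t + 1)) (πh (t + 1)) (lamh (t + 1))
        + η * (d * |lam (t + 1) - lamo|) := by
  have hw0 := M.socc_nonneg hπo
  have hprimal : ∀ s, _ := fun s => optimistic_step (convex_stdSimplex ℝ A) hη (H.step_π t s).1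
    (H.step_πh (t + 1) s).1 (H.step_π t s).2 (H.step_πh (t + 1) s).2 (hπo s)
  have hdual := optimistic_step_real hη (H.step_lam t).1 (H.step_lamh (t + 1)).1 (H.step_lam t).2
    (H.step_lamh (t + 1)).2 hlamo
  have hsum := Finset.sum_le_sum fun s (_ : s ∈ Finset.univ) =>
    mul_le_mul_of_nonneg_left (hprimal s) (hw0 s)
  have hcomb : ∀ f₁ f₂ f₃ f₄ f₅ : S → ℝ, ∑ s, M.socc πo s * (1 / 2 * f₁ s - 1 / 2 * f₂ s
      - 1 / 4 * f₃ s - 1 / 2 * f₄ s + η ^ 2 * f₅ s)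
      = 1 / 2 * ∑ s, M.socc πo s * f₁ s - 1 / 2 * ∑ s, M.socc πo s * f₂ s
        - 1 / 4 * ∑ s, M.socc πo s * f₃ s - 1 / 2 * ∑ s, M.socc πo s * f₄ s
        + η ^ 2 * ∑ s, M.socc πo s * f₅ s := by
    intro f₁ f₂ f₃ f₄ f₅
    simp only [Finset.mul_sum, ← Finset.sum_sub_distrib, ← Finset.sum_add_distrib]
    exact Finset.sum_congr rfl fun s _ => by ring
  rw [hcomb] at hsum
  have hpd := M.performance_difference (H.mem_π (t + 1)) hπo (M.lagr h (lam (t + 1)))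
  have e1 : ∑ s, M.socc πo s * (η * ∑ a, (πo s a - π (t + 1) s a)
        * M.Q (M.lagr h (lam (t + 1))) (π (t + 1)) s a)
      = η * (M.V (M.lagr h (lam (t + 1))) πo - M.V (M.lagr h (lam (t + 1))) (π (t + 1))) := by
    rw [hpd, Finset.mul_sum]
    exact Finset.sum_congr rfl fun s _ => by ring
  rw [e1, M.V_lagr hπo, M.V_lagr (H.mem_π (t + 1))] at hsum
  have hlip := M.gradient_lipschitz hρ hh (M.ρ_le_socc hπo) (M.sum_socc hπo) (H.mem_π (t + 1))
    (H.mem_π t) (lam' := lam t) (H.mem_lam (t + 1))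
  have hs := hsad _ (H.mem_π (t + 1)) _ (H.mem_lam (t + 1))
  have hs' := mul_le_mul_of_nonneg_left hs hη.le
  have htri := wDistSq_triangle hw0 (π (t + 1)) (lam (t + 1)) (πh (t + 1)) (lamh (t + 1)) (π t)
    (lam t)
  have hi := sq_mul_iota_le hη hthr (iota_nonneg hρ ξ)
  have h1 := mul_le_mul_of_nonneg_left hlip (sq_nonneg η)
  have h2 := mul_le_mul_of_nonneg_right hi
    (wDistSq_nonneg hw0 (π (t + 1)) (lam (t + 1)) (π t) (lam t))
  have h3 := wDistSq_nonneg hw0 (πh (t + 1)) (lamh (t + 1)) (π t) (lam t)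
  simp only [wDistSq] at h1 h2 h3 htri ⊢
  -- The gradient error contributes 1/8 of the latest half-step and 1/8 of the previous one. This
  -- leaves `-1/2 + 1/8 = -3/8` for the former, the latter is covered by the carried 3/16, and the
  -- remaining `-1/4` splits as `-3/16 - 1/16`.
  linarith only [hsum, hdual, hs', htri, h1, h2, h3]

end Iterates

end CMDP

/-! ### The duality gap after short optimistic steps -/

namespace CMDP

variable {S : Type uS} {A : Type uA} [Fintype S] [Fintype A] (M : CMDP S A)

lemma abs_Q_lagr_sub_le {h : S → A → ℝ} (hh : ∀ s a, |h s a| ≤ 1) {π π' : S → A → ℝ}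
    (hπ : π ∈ policies S A) (hπ' : π' ∈ policies S A) {lam lam' l e : ℝ} (hl : |lam| ≤ l)
    (he : ∀ s a, |π s a - π' s a| ≤ e) (he' : |lam - lam'| ≤ e) (s : S) (a : A) :
    |M.Q (M.lagr h lam) π s a - M.Q (M.lagr h lam') π' s a|
      ≤ (Fintype.card A * (1 + l) / (1 - M.γ) ^ 2 + 1 / (1 - M.γ)) * e := by
  have hg := M.one_sub_γ_pos
  have hl0 : 0 ≤ l := (abs_nonneg _).trans hl
  have he0 : 0 ≤ e := (abs_nonneg _).trans he'
  have h1 : ∀ s, |∑ a, (π s a - π' s a) * M.Q (M.lagr h lam) π' s a|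
      ≤ (1 + l) / (1 - M.γ) * (Fintype.card A * e) := fun s => by
    refine (abs_sum_mul_le fun a => M.abs_Q_le hπ' (fun s a => M.abs_lagr_le hh hl s a) s a).trans ?_
    refine mul_le_mul_of_nonneg_left ?_ (by positivity)
    calc ∑ a, |π s a - π' s a| ≤ ∑ _a : A, e := Finset.sum_le_sum fun a _ => he s a
      _ = _ := by simp
  have h2 := M.abs_Q_sub_le hπ' hπ _ h1 s a
  have h3 : M.γ / (1 - M.γ) * ((1 + l) / (1 - M.γ) * (Fintype.card A * e))
      ≤ Fintype.card A * (1 + l) / (1 - M.γ) ^ 2 * e := by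
    have e1 : M.γ / (1 - M.γ) * ((1 + l) / (1 - M.γ) * (Fintype.card A * e))
        = M.γ * (Fintype.card A * (1 + l) / (1 - M.γ) ^ 2 * e) := by field_simp
    rw [e1]
    exact mul_le_of_le_one_left (by positivity) M.γ_mem.2.le
  have h4 : |(lam - lam') * M.Q h π' s a| ≤ e * (1 / (1 - M.γ)) := by
    rw [abs_mul]
    exact mul_le_mul he' (M.abs_Q_le hπ' hh s a) (abs_nonneg _) he0
  have e2 : M.Q (M.lagr h lam) π s a - M.Q (M.lagr h lam') π' s a
      = (M.Q (M.lagr h lam) π s a - M.Q (M.lagr h lam) π' s a) + (lam - lam') * M.Q h π' s a := by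
    rw [M.Q_lagr hπ', M.Q_lagr hπ']; ring
  rw [e2]
  refine (abs_add_le _ _).trans ?_
  linarith only [h2, h3, h4]

lemma abs_sub_le_one {π π' : S → A → ℝ} (hπ : π ∈ policies S A) (hπ' : π' ∈ policies S A) (s : S)
    (a : A) : |π s a - π' s a| ≤ 1 :=
  abs_le.2 ⟨by linarith [(hπ s).1 a, coord_le_one (hπ' s) a],
    by linarith [(hπ' s).1 a, coord_le_one (hπ s) a]⟩

section Iterates

variable {M} {h : S → A → ℝ} {ξ η : ℝ} {π πh : ℕ → S → A → ℝ} {lam lamh : ℕ → ℝ}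

/-- The duality gap at an iterate is controlled by the lengths of the last two steps. -/
lemma IsOPG.gap_le (H : M.IsOPG h ξ η π πh lam lamh) (hh : ∀ s a, |h s a| ≤ 1) (hη : 0 < η)
    {l r : ℝ} (hl : 1 / ((1 - M.γ) * ξ) ≤ l) {t : ℕ} (h1 : ∀ s a, |π t s a - πh t s a| ≤ r)
    (h2 : |lam t - lamh t| ≤ r) (h3 : ∀ s a, |πh (t + 1) s a - π t s a| ≤ r)
    (h4 : |lamh (t + 1) - lam t| ≤ r) {π' : S → A → ℝ} (hπ' : π' ∈ policies S A) {lam' : ℝ}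
    (hlam' : lam' ∈ M.Λ ξ) :
    M.V M.r π' + lamh (t + 1) * M.V h π'
        - (M.V M.r (πh (t + 1)) + lam' * M.V h (πh (t + 1)))
      ≤ ((2 * Fintype.card A / η + Fintype.card A * (Fintype.card A * (1 + l) / (1 - M.γ) ^ 2
          + 1 / (1 - M.γ))) / (1 - M.γ) + (2 * l / η + l * (Fintype.card A / (1 - M.γ) ^ 2))) * r := by
  have hg := M.one_sub_γ_pos
  obtain ⟨n, hn⟩ : ∃ n : ℝ, n = Fintype.card A := ⟨_, rfl⟩
  obtain ⟨CQ, hCQ⟩ : ∃ C : ℝ, C = n * (1 + l) / (1 - M.γ) ^ 2 + 1 / (1 - M.γ) := ⟨_, rfl⟩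
  rw [← hn, ← hCQ]
  have hr0 : 0 ≤ r := (abs_nonneg _).trans h2
  have hp := H.mem_πh (t + 1)
  have hlh := H.mem_lamh (t + 1)
  have hl0 : 0 ≤ l := hlh.1.trans (hlh.2.trans hl)
  have hle : |lamh (t + 1)| ≤ l := by rw [abs_of_nonneg hlh.1]; exact hlh.2.trans hl
  have hstate : ∀ s, ∑ a, (π' s a - πh (t + 1) s a)
      * M.Q (M.lagr h (lamh (t + 1))) (πh (t + 1)) s a ≤ (2 * n / η + n * CQ) * r := by
    intro s
    -- The hatted iterate is optimal for the direction at `π t`, up to the length of the step. The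
    -- action values are then transferred from `π t` to the hatted iterate by their Lipschitz bound.
    have f1 := proj_foc (convex_stdSimplex ℝ A) hη (H.step_πh t s).1 (H.step_πh t s).2 (hπ' s)
    have f2 : ∑ a, (πh (t + 1) s a - πh t s a) * (π' s a - πh (t + 1) s a) ≤ n * (2 * r) := by
      calc _ ≤ ∑ _a : A, 2 * r := Finset.sum_le_sum fun a _ => by
            refine (le_abs_self _).trans ?_
            rw [abs_mul]
            have k1 : |πh (t + 1) s a - πh t s a| ≤ 2 * r := by
              have := abs_add_le (πh (t + 1) s a - π t s a) (π t s a - πh t s a)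
              rw [sub_add_sub_cancel] at this
              linarith only [this, h1 s a, h3 s a]
            exact (mul_le_of_le_one_right (abs_nonneg _) (abs_sub_le_one hπ' hp s a)).trans k1
        _ = _ := by rw [Finset.sum_const, Finset.card_univ, nsmul_eq_mul, hn]
    have f3 : ∑ a, (π' s a - πh (t + 1) s a) * (M.Q (M.lagr h (lamh (t + 1))) (πh (t + 1)) s a
        - M.Q (M.lagr h (lam t)) (π t) s a) ≤ n * (CQ * r) := by
      calc _ ≤ ∑ _a : A, CQ * r := Finset.sum_le_sum fun a _ => by
            refine (le_abs_self _).trans ?_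
            rw [abs_mul]
            have k1 := M.abs_Q_lagr_sub_le hh hp (H.mem_π t) hle h3 h4 s a
            rw [← hn, ← hCQ] at k1
            exact (mul_le_of_le_one_left (abs_nonneg _) (abs_sub_le_one hπ' hp s a)).trans k1
        _ = _ := by rw [Finset.sum_const, Finset.card_univ, nsmul_eq_mul, hn]
    have f4 : ∑ a, (π' s a - πh (t + 1) s a) * M.Q (M.lagr h (lam t)) (π t) s a
        ≤ n * (2 * r) / η := by
      rw [le_div_iff₀ hη, mul_comm]
      exact f1.trans f2
    simp only [mul_sub, Finset.sum_sub_distrib] at f3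
    have e : (2 * n / η + n * CQ) * r = n * (2 * r) / η + n * (CQ * r) := by ring
    rw [e]
    linarith only [f3, f4]
  have hprimal := M.sum_socc_mul_le hπ' hstate
  rw [← M.performance_difference hp hπ', M.V_lagr hp, M.V_lagr hπ'] at hprimal
  have f1 := prox_real_foc hη hlh (H.step_lamh t).2 hlam'
  have hd : |lam' - lamh (t + 1)| ≤ l := abs_le.2
    ⟨by linarith only [hlam'.1, hlh.2, hl], by linarith only [hlam'.2, hlh.1, hl]⟩
  have f2 : (lamh (t + 1) - lamh t) * (lam' - lamh (t + 1)) ≤ 2 * r * l := by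
    refine (le_abs_self _).trans ?_
    rw [abs_mul]
    have k1 : |lamh (t + 1) - lamh t| ≤ 2 * r := by
      have := abs_add_le (lamh (t + 1) - lam t) (lam t - lamh t)
      rw [sub_add_sub_cancel] at this
      linarith only [this, h2, h4]
    exact mul_le_mul k1 hd (abs_nonneg _) (by positivity)
  have f3 : (lamh (t + 1) - lam') * M.V h (π t) ≤ 2 * r * l / η := by
    rw [le_div_iff₀ hη]
    linarith only [f1, f2]
  have f4 : (lamh (t + 1) - lam') * (M.V h (πh (t + 1)) - M.V h (π t))
      ≤ l * (n / (1 - M.γ) ^ 2 * r) := by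
    refine (le_abs_self _).trans ?_
    rw [abs_mul, abs_sub_comm]
    rw [hn]
    exact mul_le_mul hd (M.abs_V_sub_le_of_entries (H.mem_π t) hp hh h3) (abs_nonneg _) hl0
  have e : ((2 * n / η + n * CQ) / (1 - M.γ) + (2 * l / η + l * (n / (1 - M.γ) ^ 2))) * r
      = (2 * n / η + n * CQ) * r / (1 - M.γ) + 2 * r * l / η + l * (n / (1 - M.γ) ^ 2 * r) := by
    ring
  rw [e]
  linarith only [hprimal, f3, f4]

end Iterates

end CMDP

namespace CMDP

variable {S : Type uS} {A : Type uA} [Fintype S] [Fintype A] (M : CMDP S A)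

/-! ### Linear convergence towards a set of approximate saddle points -/

/-- `Z` consists of saddle points up to `d * |lam - lamo|`, and satisfies an error bound. -/
structure IsTarget (h : S → A → ℝ) (ξ : ℝ) (Z : Set ((S → A → ℝ) × ℝ)) (d C : ℝ) : Prop where
  mem : ∀ z ∈ Z, z.1 ∈ policies S A ∧ z.2 ∈ M.Λ ξ
  saddle : ∀ z ∈ Z, ∀ π ∈ policies S A, ∀ lam ∈ M.Λ ξ,
    M.V M.r π + z.2 * M.V h π - (M.V M.r z.1 + lam * M.V h z.1) ≤ d * |lam - z.2|
  error_bound : ∀ π ∈ policies S A, ∀ lam ∈ M.Λ ξ, ∀ G, (∀ π' ∈ policies S A, ∀ lam' ∈ M.Λ ξ,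
      M.V M.r π' + lam * M.V h π' - (M.V M.r π + lam' * M.V h π) ≤ G) →
    ∃ z ∈ Z, (∀ s a, |z.1 s a - π s a| ≤ C * (G + d)) ∧ |lam - z.2| ≤ C * (G + d)

/-- The squared distance of two primal-dual pairs. -/
abbrev distSq (π : S → A → ℝ) (lam : ℝ) (π' : S → A → ℝ) (lam' : ℝ) : ℝ :=
  wDistSq (fun _ => 1) π lam π' lam'

lemma distSq_nonneg (π : S → A → ℝ) (lam : ℝ) (π' : S → A → ℝ) (lam' : ℝ) :
    0 ≤ distSq π lam π' lam' := wDistSq_nonneg (fun _ => zero_le_one) _ _ _ _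

lemma sq_entry_le_distSq (π : S → A → ℝ) (lam : ℝ) (π' : S → A → ℝ) (lam' : ℝ) (s : S) (a : A) :
    (π s a - π' s a) ^ 2 ≤ distSq π lam π' lam' := by
  simp only [distSq, wDistSq, one_mul]
  have h1 := Finset.single_le_sum (f := fun a => (π s a - π' s a) ^ 2) (fun _ _ => sq_nonneg _)
    (Finset.mem_univ a)
  have h2 := Finset.single_le_sum (f := fun s => ∑ a, (π s a - π' s a) ^ 2)
    (fun _ _ => Finset.sum_nonneg fun _ _ => sq_nonneg _) (Finset.mem_univ s)
  linarith only [h1, h2, sq_nonneg (lam - lam')]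

lemma sq_dual_le_distSq (π : S → A → ℝ) (lam : ℝ) (π' : S → A → ℝ) (lam' : ℝ) :
    (lam - lam') ^ 2 ≤ distSq π lam π' lam' := by
  simp only [distSq, wDistSq, one_mul]
  exact le_add_of_nonneg_left
    (Finset.sum_nonneg fun _ _ => Finset.sum_nonneg fun _ _ => sq_nonneg _)

lemma distSq_le {π : S → A → ℝ} {lam : ℝ} {π' : S → A → ℝ} {lam' y z : ℝ}
    (hy : ∀ s a, (π s a - π' s a) ^ 2 ≤ y) (hz : (lam - lam') ^ 2 ≤ z) :
    distSq π lam π' lam' ≤ Fintype.card S * Fintype.card A * y + z := by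
  simp only [distSq, wDistSq, one_mul]
  refine add_le_add ?_ hz
  calc _ ≤ ∑ _s : S, ∑ _a : A, y := Finset.sum_le_sum fun s _ => Finset.sum_le_sum fun a _ => hy s a
    _ = _ := by simp only [Finset.sum_const, Finset.card_univ, nsmul_eq_mul]; ring

section Iterates

variable {M} {h : S → A → ℝ} {ξ η : ℝ} {π πh : ℕ → S → A → ℝ} {lam lamh : ℕ → ℝ}

/-- The squared lengths of the two half-steps at time `t`. -/
def stepSq (π πh : ℕ → S → A → ℝ) (lam lamh : ℕ → ℝ) (t : ℕ) : ℝ :=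
  distSq (π t) (lam t) (πh t) (lamh t) + distSq (πh (t + 1)) (lamh (t + 1)) (π t) (lam t)

/-- The potential of the iterates with respect to a target point. -/
def opgPotential (M : CMDP S A) (π πh : ℕ → S → A → ℝ) (lam lamh : ℕ → ℝ) (z : (S → A → ℝ) × ℝ)
    (t : ℕ) : ℝ :=
  1 / 2 * wDistSq (M.socc z.1) (πh (t + 1)) (lamh (t + 1)) z.1 z.2
    + 3 / 16 * wDistSq (M.socc z.1) (πh (t + 1)) (lamh (t + 1)) (π t) (lam t)

lemma stepSq_nonneg (π πh : ℕ → S → A → ℝ) (lam lamh : ℕ → ℝ) (t : ℕ) :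
    0 ≤ stepSq π πh lam lamh t := add_nonneg (distSq_nonneg _ _ _ _) (distSq_nonneg _ _ _ _)

/-- The constant is chosen before `h` and `ξ`, so that it serves every tightened problem with dual
interval inside `[0, l]`. -/
lemma exists_gap_constant (M : CMDP S A) {l : ℝ} (hη : 0 < η) (hl0 : 0 ≤ l) :
    ∃ Cg : ℝ, 0 ≤ Cg ∧ ∀ (h : S → A → ℝ) (ξ : ℝ) (π πh : ℕ → S → A → ℝ) (lam lamh : ℕ → ℝ),
      (∀ s a, |h s a| ≤ 1) → 1 / ((1 - M.γ) * ξ) ≤ l → M.IsOPG h ξ η π πh lam lamh →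
      ∀ t, ∀ π' ∈ policies S A, ∀ lam' ∈ M.Λ ξ,
        M.V M.r π' + lamh (t + 1) * M.V h π' - (M.V M.r (πh (t + 1)) + lam' * M.V h (πh (t + 1)))
          ≤ Cg * Real.sqrt (stepSq π πh lam lamh t) := by
  have hg := M.one_sub_γ_pos
  refine ⟨(2 * Fintype.card A / η + Fintype.card A * (Fintype.card A * (1 + l) / (1 - M.γ) ^ 2
          + 1 / (1 - M.γ))) / (1 - M.γ) + (2 * l / η + l * (Fintype.card A / (1 - M.γ) ^ 2)),
    by positivity, fun h ξ π πh lam lamh hh hl H t π' hπ' lam' hlam' => ?_⟩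
  have n1 := distSq_nonneg (π t) (lam t) (πh t) (lamh t)
  have n2 := distSq_nonneg (πh (t + 1)) (lamh (t + 1)) (π t) (lam t)
  have b1 : distSq (π t) (lam t) (πh t) (lamh t) ≤ stepSq π πh lam lamh t :=
    le_add_of_nonneg_right n2
  have b2 : distSq (πh (t + 1)) (lamh (t + 1)) (π t) (lam t) ≤ stepSq π πh lam lamh t :=
    le_add_of_nonneg_left n1
  exact H.gap_le hh hη hl (fun s a => Real.abs_le_sqrt ((sq_entry_le_distSq _ _ _ _ s a).trans b1))
    (Real.abs_le_sqrt ((sq_dual_le_distSq _ _ _ _).trans b1))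
    (fun s a => Real.abs_le_sqrt ((sq_entry_le_distSq _ _ _ _ s a).trans b2))
    (Real.abs_le_sqrt ((sq_dual_le_distSq _ _ _ _).trans b2)) hπ' hlam'

/-- After short steps the iterate is close to the target set. -/
lemma exists_restart_constant (M : CMDP S A) {l C : ℝ} (hη : 0 < η) (hl0 : 0 ≤ l) :
    ∃ C₃ : ℝ, 1 ≤ C₃ ∧ ∀ (h : S → A → ℝ) (ξ : ℝ) (Z : Set ((S → A → ℝ) × ℝ)) (d : ℝ)
      (π πh : ℕ → S → A → ℝ) (lam lamh : ℕ → ℝ),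
      (∀ s a, |h s a| ≤ 1) → 1 / ((1 - M.γ) * ξ) ≤ l → M.IsTarget h ξ Z d C →
      M.IsOPG h ξ η π πh lam lamh → ∀ t, ∃ z ∈ Z,
        opgPotential M π πh lam lamh z t ≤ C₃ * (stepSq π πh lam lamh t + d ^ 2) := by
  have hg := M.one_sub_γ_pos
  obtain ⟨Cg, hCg, hgap⟩ := exists_gap_constant M hη hl0
  obtain ⟨N, hN⟩ : ∃ N : ℝ, N = Fintype.card S * Fintype.card A + 1 := ⟨_, rfl⟩
  obtain ⟨L, hL⟩ : ∃ L : ℝ, L = 1 / (1 - M.γ) := ⟨_, rfl⟩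
  have hN0 : 0 ≤ N := by rw [hN]; positivity
  have hL1 : 1 ≤ L := by rw [hL, le_div_iff₀ hg, one_mul]; exact M.one_sub_γ_le_one
  have hc0 : 0 ≤ N * C ^ 2 * (Cg ^ 2 + 1) := by positivity
  refine ⟨L * (N * C ^ 2 * (Cg ^ 2 + 1) + 1),
    one_le_mul_of_one_le_of_one_le hL1 (by linarith only [hc0]), ?_⟩
  intro h ξ Z d π πh lam lamh hh hl hZ H t
  obtain ⟨z, hz, hz1, hz2⟩ := hZ.error_bound _ (H.mem_πh (t + 1)) _ (H.mem_lamh (t + 1)) _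
    (hgap h ξ π πh lam lamh hh hl H t)
  refine ⟨z, hz, ?_⟩
  obtain ⟨q, hq⟩ : ∃ q, q = stepSq π πh lam lamh t := ⟨_, rfl⟩
  have hq0 : 0 ≤ q := hq ▸ stepSq_nonneg _ _ _ _ _
  rw [← hq] at hz1 hz2 ⊢
  obtain ⟨y, hy⟩ : ∃ y, y = C ^ 2 * (2 * Cg ^ 2 * q + 2 * d ^ 2) := ⟨_, rfl⟩
  have hsq : (C * (Cg * Real.sqrt q + d)) ^ 2 ≤ y := by
    have e1 := Real.sq_sqrt hq0
    have e2 : (Cg * Real.sqrt q + d) ^ 2 ≤ 2 * (Cg ^ 2 * Real.sqrt q ^ 2) + 2 * d ^ 2 := by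
      linarith only [sq_nonneg (Cg * Real.sqrt q - d)]
    rw [e1] at e2
    rw [mul_pow, hy]
    exact mul_le_mul_of_nonneg_left (by linarith only [e2]) (sq_nonneg C)
  have hd1 : distSq (πh (t + 1)) (lamh (t + 1)) z.1 z.2 ≤ N * y := by
    refine (distSq_le (y := y) (z := y) (fun s a => ?_) ?_).trans (le_of_eq (by rw [hN]; ring))
    · refine le_trans ?_ hsq
      rw [← neg_sub, neg_sq, ← sq_abs]
      exact pow_le_pow_left₀ (abs_nonneg _) (hz1 s a) 2
    · refine le_trans ?_ hsq
      rw [← sq_abs]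
      exact pow_le_pow_left₀ (abs_nonneg _) hz2 2
  have hd2 : distSq (πh (t + 1)) (lamh (t + 1)) (π t) (lam t) ≤ q := by
    rw [hq]; exact le_add_of_nonneg_left (distSq_nonneg _ _ _ _)
  have hw : ∀ s, M.socc z.1 s ≤ L * (fun _ => (1 : ℝ)) s := fun s => by
    rw [mul_one, hL]; exact M.socc_le (hZ.mem z hz).1 s
  have m1 := wDistSq_mono hw hL1 (πh (t + 1)) (lamh (t + 1)) z.1 z.2
  have m2 := wDistSq_mono hw hL1 (πh (t + 1)) (lamh (t + 1)) (π t) (lam t)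
  have hL0 : 0 ≤ L := zero_le_one.trans hL1
  have k1 := mul_le_mul_of_nonneg_left hd1 hL0
  have k2 := mul_le_mul_of_nonneg_left hd2 hL0
  have e : L * (N * C ^ 2 * (Cg ^ 2 + 1) + 1) * (q + d ^ 2)
      = 1 / 2 * (L * (N * y)) + L * q + L * d ^ 2 + L * (N * C ^ 2 * q) + L * (N * C ^ 2 * Cg ^ 2 * d ^ 2) := by
    rw [hy]; ring
  have p1 : 0 ≤ L * d ^ 2 := by positivity
  have p2 : 0 ≤ L * (N * C ^ 2 * q) := by positivity
  have p3 : 0 ≤ L * (N * C ^ 2 * Cg ^ 2 * d ^ 2) := by positivity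
  have p4 : 0 ≤ L * q := by positivity
  rw [e, opgPotential]
  simp only [distSq] at k1 k2
  linarith only [m1, m2, k1, k2, p1, p2, p3, p4]

/-- Descent of the potential, in terms of the lengths of the steps. -/
lemma IsOPG.potential_descent (H : M.IsOPG h ξ η π πh lam lamh) (hρ : ∀ s, 0 < M.ρ s)
    (hh : ∀ s a, |h s a| ≤ 1) (hη : 0 < η) (hthr : η ≤ M.opgThreshold ξ)
    {Z : Set ((S → A → ℝ) × ℝ)} {d C : ℝ} (hZ : M.IsTarget h ξ Z d C) {z : (S → A → ℝ) × ℝ}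
    (hz : z ∈ Z) {μ : ℝ} (hμ : 0 < μ) (hμk : 64 * μ ≤ M.ρmin) (t : ℕ) :
    opgPotential M π πh lam lamh z (t + 1) ≤ (1 + 4 * μ) * opgPotential M π πh lam lamh z t
      - M.ρmin / 32 * stepSq π πh lam lamh (t + 1) + η ^ 2 * d ^ 2 / (4 * μ) := by
  have hm := M.ρmin_pos hρ
  obtain ⟨hz1, hz2⟩ := hZ.mem z hz
  have hdesc := H.descent hρ hh hη hthr hz1 hz2 (hZ.saddle z hz) t
  have hw : ∀ s, (fun _ => (1 : ℝ)) s ≤ 1 / M.ρmin * M.socc z.1 s := fun s => by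
    rw [div_mul_eq_mul_div, le_div_iff₀ hm, one_mul, one_mul]
    exact (M.ρmin_le s).trans (M.ρ_le_socc hz1 s)
  have hm1 : 1 ≤ 1 / M.ρmin := by rw [le_div_iff₀ hm, one_mul]; exact M.ρmin_le_one
  have m1 := wDistSq_mono hw hm1 (π (t + 1)) (lam (t + 1)) (πh (t + 1)) (lamh (t + 1))
  have m2 := wDistSq_mono hw hm1 (πh (t + 2)) (lamh (t + 2)) (π (t + 1)) (lam (t + 1))
  rw [div_mul_eq_mul_div, le_div_iff₀ hm, one_mul] at m1 m2
  have hw0 := M.socc_nonneg hz1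
  have n1 := wDistSq_nonneg hw0 (πh (t + 1)) (lamh (t + 1)) (π t) (lam t)
  have n2 := wDistSq_nonneg hw0 (π (t + 1)) (lam (t + 1)) (πh (t + 1)) (lamh (t + 1))
  have hP : (lamh (t + 1) - z.2) ^ 2 ≤ 2 * opgPotential M π πh lam lamh z t := by
    have : (lamh (t + 1) - z.2) ^ 2
        ≤ wDistSq (M.socc z.1) (πh (t + 1)) (lamh (t + 1)) z.1 z.2 :=
      le_add_of_nonneg_left (Finset.sum_nonneg fun s _ => mul_nonneg (hw0 s)
        (Finset.sum_nonneg fun _ _ => sq_nonneg _))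
    rw [opgPotential]
    linarith only [this, n1]
  obtain ⟨q, hq⟩ : ∃ q, q = stepSq π πh lam lamh (t + 1) := ⟨_, rfl⟩
  have hq0 : 0 ≤ q := hq ▸ stepSq_nonneg _ _ _ _ _
  have hqle : (lam (t + 1) - lamh (t + 1)) ^ 2 ≤ q := by
    rw [hq]
    exact (sq_dual_le_distSq _ _ _ _).trans (le_add_of_nonneg_right (distSq_nonneg _ _ _ _))
  have hq' : q * M.ρmin ≤ wDistSq (M.socc z.1) (π (t + 1)) (lam (t + 1)) (πh (t + 1)) (lamh (t + 1))
      + wDistSq (M.socc z.1) (πh (t + 2)) (lamh (t + 2)) (π (t + 1)) (lam (t + 1)) := by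
    rw [hq, stepSq, add_mul]
    exact add_le_add m1 m2
  -- The defect `d` of an approximate saddle point is traded for `O(d²)` and a small multiple of the
  -- squared dual distance, the origin of the factor `1 + 4 μ`.
  have hyoung : η * (d * |lam (t + 1) - z.2|)
      ≤ μ * (lam (t + 1) - z.2) ^ 2 + η ^ 2 * d ^ 2 / (4 * μ) := by
    rw [← sub_nonneg, ← sq_abs (lam (t + 1) - z.2)]
    have e : μ * |lam (t + 1) - z.2| ^ 2 + η ^ 2 * d ^ 2 / (4 * μ) - η * (d * |lam (t + 1) - z.2|)
        = (2 * μ * |lam (t + 1) - z.2| - η * d) ^ 2 / (4 * μ) := by field_simp; ring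
    rw [e]
    positivity
  have hx : (lam (t + 1) - z.2) ^ 2 ≤ 2 * q + 4 * opgPotential M π πh lam lamh z t := by
    linarith only [hqle, hP, sq_nonneg ((lam (t + 1) - lamh (t + 1)) - (lamh (t + 1) - z.2))]
  have k1 := mul_le_mul_of_nonneg_left hx hμ.le
  have k2 := mul_le_mul_of_nonneg_right hμk hq0
  rw [← hq]
  rw [opgPotential, opgPotential] at *
  linarith only [hdesc, hq', hyoung, k1, k2, n2]

end Iterates

end CMDP

namespace CMDP

variable {S : Type uS} {A : Type uA} [Fintype S] [Fintype A] (M : CMDP S A)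

lemma opgPotential_nonneg {π πh : ℕ → S → A → ℝ} {lam lamh : ℕ → ℝ} {z : (S → A → ℝ) × ℝ}
    (hz : z.1 ∈ policies S A) (t : ℕ) : 0 ≤ opgPotential M π πh lam lamh z t := by
  have n1 := wDistSq_nonneg (M.socc_nonneg hz) (πh (t + 1)) (lamh (t + 1)) z.1 z.2
  have n2 := wDistSq_nonneg (M.socc_nonneg hz) (πh (t + 1)) (lamh (t + 1)) (π t) (lam t)
  rw [opgPotential]
  linarith only [n1, n2]

lemma distSq_le_opgPotential (hρ : ∀ s, 0 < M.ρ s) {π πh : ℕ → S → A → ℝ} {lam lamh : ℕ → ℝ}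
    {z : (S → A → ℝ) × ℝ} (hz : z.1 ∈ policies S A) (t : ℕ) :
    M.ρmin * distSq (πh (t + 1)) (lamh (t + 1)) z.1 z.2
      ≤ 2 * opgPotential M π πh lam lamh z t := by
  have hm := M.ρmin_pos hρ
  have hw : ∀ s, (fun _ => (1 : ℝ)) s ≤ 1 / M.ρmin * M.socc z.1 s := fun s => by
    rw [div_mul_eq_mul_div, le_div_iff₀ hm, one_mul, one_mul]
    exact (M.ρmin_le s).trans (M.ρ_le_socc hz s)
  have hm1 : 1 ≤ 1 / M.ρmin := by rw [le_div_iff₀ hm, one_mul]; exact M.ρmin_le_one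
  have m1 := wDistSq_mono hw hm1 (πh (t + 1)) (lamh (t + 1)) z.1 z.2
  rw [div_mul_eq_mul_div, le_div_iff₀ hm, one_mul, mul_comm] at m1
  have n2 := wDistSq_nonneg (M.socc_nonneg hz) (πh (t + 1)) (lamh (t + 1)) (π t) (lam t)
  rw [opgPotential]
  linarith only [m1, n2]

/-- Linear convergence of the optimistic iterates to the target set, up to `O(d)`. -/
theorem exists_linear_convergence (hρ : ∀ s, 0 < M.ρ s) {l C η : ℝ} (hη : 0 < η) (hl0 : 0 ≤ l) :
    ∃ K > 0, ∃ θ : ℝ, 0 < θ ∧ θ < 1 ∧ ∀ (h : S → A → ℝ) (ξ : ℝ) (Z : Set ((S → A → ℝ) × ℝ)) (d : ℝ)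
      (π πh : ℕ → S → A → ℝ) (lam lamh : ℕ → ℝ),
      (∀ s a, |h s a| ≤ 1) → 1 / ((1 - M.γ) * ξ) ≤ l → η ≤ M.opgThreshold ξ →
      M.IsTarget h ξ Z d C → M.IsOPG h ξ η π πh lam lamh → ∀ t, ∃ z ∈ Z,
        distSq (πh (t + 1)) (lamh (t + 1)) z.1 z.2 ≤ K * (θ ^ t + d ^ 2) ∧
        stepSq π πh lam lamh (t + 1) ≤ K * (θ ^ t + d ^ 2) := by
  obtain ⟨C₃, hC₃, hrestart⟩ := exists_restart_constant M (C := C) hη hl0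
  obtain ⟨k, hk⟩ : ∃ k, k = M.ρmin := ⟨_, rfl⟩
  have hk0 : 0 < k := hk ▸ M.ρmin_pos hρ
  have hk1 : k ≤ 1 := hk ▸ M.ρmin_le_one
  have hC₃0 : 0 < C₃ := one_pos.trans_le hC₃
  -- Chosen so that a step with `q ≥ B / (2 C₃)` decreases the potential by `k / 32 * q ≥ 8 μ B`,
  -- twice the growth allowed by the factor `1 + 4 μ`.
  obtain ⟨μ, hμ⟩ : ∃ μ, μ = k / (512 * C₃) := ⟨_, rfl⟩
  have hμ0 : 0 < μ := by rw [hμ]; positivity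
  have hμk : 512 * μ ≤ k := by
    rw [hμ, mul_div_assoc', div_le_iff₀ (by positivity)]
    have := mul_le_mul_of_nonneg_left hC₃ hk0.le
    linarith only [this]
  have hμC : 512 * (μ * C₃) = k := by rw [hμ]; field_simp
  obtain ⟨S₀, hS₀⟩ : ∃ S₀ : ℝ, S₀ = 2 * (Fintype.card S * Fintype.card A * 1 + l ^ 2) := ⟨_, rfl⟩
  have hS₀0 : 0 ≤ S₀ := by rw [hS₀]; positivity
  obtain ⟨C₄, hC₄⟩ : ∃ C₄, C₄ = η ^ 2 / (4 * μ) + C₃ := ⟨_, rfl⟩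
  have hq0 : 0 ≤ η ^ 2 / (4 * μ) := by positivity
  have hC₄3 : C₃ ≤ C₄ := by rw [hC₄]; linarith only [hq0]
  have hC₄0 : 0 < C₄ := hC₃0.trans_le hC₄3
  have hθ1 : 1 - 4 * μ < 1 := by linarith only [hμ0]
  have hθ2 : 1 / 2 ≤ 1 - 4 * μ := by linarith only [hμk, hk1]
  refine ⟨32 / k * (2 * (C₃ * S₀) + 2 * (C₄ / (4 * μ)) + C₄), by positivity, 1 - 4 * μ,
    by linarith only [hθ2], hθ1, ?_⟩
  intro h ξ Z d π πh lam lamh hh hl hthr hZ H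
  have hd2 : 0 ≤ d ^ 2 := sq_nonneg d
  have eC : ∀ x, η ^ 2 * x / (4 * μ) = η ^ 2 / (4 * μ) * x := fun x => by ring
  have hdesc : ∀ z ∈ Z, ∀ t, opgPotential M π πh lam lamh z (t + 1)
      ≤ (1 + 4 * μ) * opgPotential M π πh lam lamh z t
        - k / 32 * stepSq π πh lam lamh (t + 1) + η ^ 2 / (4 * μ) * d ^ 2 := fun z hz t => by
    have := H.potential_descent hρ hh hη hthr hZ hz hμ0
      (by rw [← hk]; linarith only [hμk, hμ0]) t
    rwa [← hk, eC] at this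
  have hstep : ∀ t B, 0 ≤ B → (∃ z ∈ Z, opgPotential M π πh lam lamh z t ≤ B) →
      ∃ z ∈ Z, opgPotential M π πh lam lamh z (t + 1) ≤ (1 - 4 * μ) * B + C₄ * d ^ 2 := by
    rintro t B hB ⟨z, hz, hzB⟩
    obtain ⟨q, hq⟩ : ∃ q, q = stepSq π πh lam lamh (t + 1) := ⟨_, rfl⟩
    -- A long step contracts with the same target point. A short one permits changing the target
    -- point, and with it the occupancy weights, after which the potential is at most half of `B`,
    -- up to `O(d²)`.
    rcases le_total (B / (2 * C₃)) q with hc | hc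
    · refine ⟨z, hz, (hdesc z hz t).trans ?_⟩
      rw [← hq]
      have f1 := mul_le_mul_of_nonneg_left hc (by positivity : 0 ≤ k / 32)
      have e1 : k / 32 * (B / (2 * C₃)) = 8 * μ * B := by
        rw [hμ]; field_simp; ring
      have f2 := mul_le_mul_of_nonneg_left hzB (by positivity : 0 ≤ 1 + 4 * μ)
      have f3 : C₄ * d ^ 2 = η ^ 2 / (4 * μ) * d ^ 2 + C₃ * d ^ 2 := by rw [hC₄]; ring
      have f4 : 0 ≤ C₃ * d ^ 2 := by positivity
      rw [f3]
      linarith only [f1, e1, f2, f4]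
    · obtain ⟨z', hz', h1⟩ := hrestart h ξ Z d π πh lam lamh hh hl hZ H (t + 1)
      refine ⟨z', hz', h1.trans ?_⟩
      rw [← hq]
      have f1 := mul_le_mul_of_nonneg_left hc hC₃0.le
      have e1 : C₃ * (B / (2 * C₃)) = B / 2 := by field_simp
      have f2 := mul_le_mul_of_nonneg_right hC₄3 hd2
      have f3 := mul_le_mul_of_nonneg_right hθ2 hB
      linarith only [f1, e1, f2, f3]
  have hbound : ∀ t, ∃ z ∈ Z, opgPotential M π πh lam lamh z t
      ≤ C₃ * S₀ * (1 - 4 * μ) ^ t + C₄ / (4 * μ) * d ^ 2 := by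
    intro t
    induction t with
    | zero =>
      -- The steps are bounded a priori by the diameters of the policy set and of the dual interval,
      -- so the restart bound provides the initial potential.
      obtain ⟨z, hz, h1⟩ := hrestart h ξ Z d π πh lam lamh hh hl hZ H 0
      refine ⟨z, hz, h1.trans ?_⟩
      have hlam : ∀ x ∈ M.Λ ξ, ∀ y ∈ M.Λ ξ, (x - y) ^ 2 ≤ l ^ 2 := fun x hx y hy =>
        sq_le_sq' (by linarith only [hx.1, hy.2, hl]) (by linarith only [hx.2, hy.1, hl])
      have hent : ∀ π₁ ∈ policies S A, ∀ π₂ ∈ policies S A, ∀ s a, (π₁ s a - π₂ s a) ^ 2 ≤ 1 :=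
        fun π₁ h₁ π₂ h₂ s a => (sq_le_one_iff_abs_le_one _).2 (abs_sub_le_one h₁ h₂ s a)
      have f1 := distSq_le (hent _ (H.mem_π 0) _ (H.mem_πh 0))
        (hlam _ (H.mem_lam 0) _ (H.mem_lamh 0))
      have f2 := distSq_le (hent _ (H.mem_πh (0 + 1)) _ (H.mem_π 0))
        (hlam _ (H.mem_lamh (0 + 1)) _ (H.mem_lam 0))
      have f3 : stepSq π πh lam lamh 0 ≤ S₀ := by
        rw [hS₀, stepSq]; linarith only [f1, f2]
      have f4 := mul_le_mul_of_nonneg_left f3 hC₃0.le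
      have f5 : C₄ ≤ C₄ / (4 * μ) := by
        rw [le_div_iff₀ (by positivity)]
        exact mul_le_of_le_one_right hC₄0.le (by linarith only [hμk, hk1, hμ0])
      have f6 := mul_le_mul_of_nonneg_right (hC₄3.trans f5) hd2
      rw [pow_zero, mul_one]
      linarith only [f4, f6]
    | succ t ih =>
      obtain ⟨z, hz, h1⟩ := hstep t _ (by
        have : 0 ≤ (1 - 4 * μ) ^ t := pow_nonneg (by linarith only [hθ2]) t
        positivity) ih
      refine ⟨z, hz, h1.trans (le_of_eq ?_)⟩
      rw [pow_succ]
      field_simp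
      ring
  intro t
  obtain ⟨z, hz, h1⟩ := hbound t
  have hz1 := (hZ.mem z hz).1
  have hP0 := M.opgPotential_nonneg (π := π) (πh := πh) (lam := lam) (lamh := lamh) hz1 t
  have hP1 := M.opgPotential_nonneg (π := π) (πh := πh) (lam := lam) (lamh := lamh) hz1 (t + 1)
  have hθt : 0 ≤ (1 - 4 * μ) ^ t := pow_nonneg (by linarith only [hθ2]) t
  obtain ⟨B, hB⟩ : ∃ B, B = C₃ * S₀ * (1 - 4 * μ) ^ t + C₄ / (4 * μ) * d ^ 2 := ⟨_, rfl⟩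
  rw [← hB] at h1
  have hKB : 32 / k * (2 * B + C₄ * d ^ 2)
      ≤ 32 / k * (2 * (C₃ * S₀) + 2 * (C₄ / (4 * μ)) + C₄) * ((1 - 4 * μ) ^ t + d ^ 2) := by
    rw [mul_assoc]
    refine mul_le_mul_of_nonneg_left ?_ (by positivity)
    have g1 : 0 ≤ C₄ / (4 * μ) * (1 - 4 * μ) ^ t := by positivity
    have g2 : 0 ≤ C₄ * (1 - 4 * μ) ^ t := by positivity
    have g3 : 0 ≤ C₃ * S₀ * d ^ 2 := by positivity
    rw [hB]
    linarith only [g1, g2, g3]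
  refine ⟨z, hz, le_trans ?_ hKB, le_trans ?_ hKB⟩
  · rw [div_mul_eq_mul_div, le_div_iff₀ hk0]
    have f1 := M.distSq_le_opgPotential hρ (π := π) (πh := πh) (lam := lam) (lamh := lamh) hz1 t
    rw [← hk] at f1
    have f2 : 0 ≤ C₄ * d ^ 2 := by positivity
    linarith only [f1, f2, h1, hP0]
  · rw [div_mul_eq_mul_div, le_div_iff₀ hk0]
    have f1 := hdesc z hz t
    have f2 : (1 + 4 * μ) * opgPotential M π πh lam lamh z t ≤ 2 * B := by
      refine mul_le_mul (by linarith only [hμk, hk1]) h1 hP0 zero_le_two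
    have f3 : η ^ 2 / (4 * μ) * d ^ 2 ≤ C₄ * d ^ 2 :=
      mul_le_mul_of_nonneg_right (by rw [hC₄]; linarith only [hC₃0]) hd2
    linarith only [f1, f2, f3, hP1]

end CMDP

/-! ### Iteration counts and stepsize margin for OPG-PD -/

lemma exists_time_constant {θ c : ℝ} (hθ0 : 0 < θ) (hθ1 : θ < 1) (hc : 0 < c) (m : ℕ) :
    ∃ C > 0, ∀ ε, 0 < ε → 3 * ε ≤ 1 → ∀ t : ℕ, C * Real.log (1 / ε) ^ 2 ≤ t →
      ∃ T : ℕ, t = T + m ∧ ∀ u, T ≤ u → θ ^ u ≤ (c * ε) ^ 2 := by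
  have hlθ : Real.log θ < 0 := Real.log_neg hθ0 hθ1
  -- Taking logarithms, `2 log (1/ε) + 2 |log c|` has to be at most `u * (-log θ)`. Since `log (1/ε)
  -- ≥ 1`, its square absorbs the constant term, and likewise the shift `m` below.
  obtain ⟨C, hC⟩ : ∃ C, C = (2 + 2 * |Real.log c|) / (-Real.log θ) := ⟨_, rfl⟩
  have hC0 : 0 < C := by
    rw [hC]; exact div_pos (by positivity) (by linarith only [hlθ])
  refine ⟨C + m, by positivity, fun ε hε hε3 t ht => ?_⟩
  have hlog : 1 ≤ Real.log (1 / ε) := by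
    rw [Real.le_log_iff_exp_le (by positivity), le_div_iff₀ hε]
    have := Real.exp_one_lt_d9
    nlinarith
  have hlog2 : Real.log (1 / ε) ≤ Real.log (1 / ε) ^ 2 := by nlinarith
  have hmt : m ≤ t := by
    have h1 : (m : ℝ) ≤ m * Real.log (1 / ε) ^ 2 :=
      le_mul_of_one_le_right (by positivity) (hlog.trans hlog2)
    have h2 : 0 ≤ C * Real.log (1 / ε) ^ 2 := by positivity
    exact_mod_cast (by linarith only [h1, h2, ht] : (m : ℝ) ≤ t)
  refine ⟨t - m, by omega, fun u hu => ?_⟩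
  have hu' : C * Real.log (1 / ε) ^ 2 ≤ u := by
    have h1 : (m : ℝ) ≤ m * Real.log (1 / ε) ^ 2 :=
      le_mul_of_one_le_right (by positivity) (hlog.trans hlog2)
    have h2 : (t : ℝ) ≤ u + m := by exact_mod_cast (by omega : t ≤ u + m)
    linarith only [h1, h2, ht]
  rw [← Real.log_le_log_iff (by positivity) (by positivity), Real.log_pow, Real.log_pow,
    Real.log_mul hc.ne' hε.ne']
  rw [one_div, Real.log_inv] at *
  have h1 := mul_le_mul_of_nonneg_right hu' (by linarith only [hlθ] : 0 ≤ -Real.log θ)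
  have e : C * (-Real.log ε) ^ 2 * -Real.log θ = (2 + 2 * |Real.log c|) * (-Real.log ε) ^ 2 := by
    have : -Real.log θ ≠ 0 := by linarith only [hlθ]
    rw [hC, mul_right_comm, div_mul_cancel₀ _ this]
  rw [e] at h1
  have h2 : 2 * |Real.log c| ≤ 2 * |Real.log c| * (-Real.log ε) ^ 2 :=
    le_mul_of_one_le_right (by positivity) (hlog.trans hlog2)
  push_cast
  linarith only [h1, h2, hlog2, neg_abs_le (Real.log c)]

/-- The truncation at `m` records that the sequence may stop growing once it has reached `m`, and
cannot fall below it afterwards. -/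
lemma le_of_increments {x : ℕ → ℝ} {k m : ℝ} (hk : 0 ≤ k)
    (hx : ∀ n, min (x n + k) m ≤ x (n + 1)) (n : ℕ) : min (x 0 + n * k) m ≤ x n := by
  induction n with
  | zero => simp
  | succ n ih =>
    refine le_trans ?_ (hx n)
    push_cast
    rcases min_le_iff.1 ih with h | h
    · exact min_le_min (by linarith only [h]) le_rfl
    · exact (min_le_right _ _).trans (le_min (by linarith only [h, hk]) le_rfl)

namespace CMDP

variable {S : Type uS} {A : Type uA} [Fintype S] [Fintype A] (M : CMDP S A)

/-- The threshold is continuous in the slack, so a strict inequality at `ξ` survives small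
tightening. -/
lemma exists_threshold_margin (hρ : ∀ s, 0 < M.ρ s) {ξ η : ℝ} (hξ : 0 < ξ)
    (hη : η < M.opgThreshold ξ) : ∃ δ₁ > 0, ∀ δ, 0 < δ → δ ≤ δ₁ → η ≤ M.opgThreshold (ξ - δ) := by
  have hg := M.one_sub_γ_pos
  have hc : ContinuousAt (fun δ => M.opgThreshold (ξ - δ)) 0 := by
    -- Without actions the division by the square root may be degenerate, but then the threshold
    -- does not depend on the slack.
    rcases isEmpty_or_nonempty A with hA | hA
    · have : ∀ x, M.opgThreshold x
          = min (1 / (4 * Real.sqrt (2 * M.κρ ^ 2 * (Fintype.card A : ℝ) / (1 - M.γ) ^ 6)))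
            (min ((1 - M.γ) ^ 3 / (4 * (Fintype.card A : ℝ))) ((1 - M.γ) ^ 3 / (2 * M.κρ))) := by
        intro x; simp [opgThreshold, iota]
      simp only [this]
      exact continuousAt_const
    have hn : (0 : ℝ) < Fintype.card A := by exact_mod_cast Fintype.card_pos
    have hpos : 0 < M.iota (ξ - 0) := by
      have hm := M.ρmin_pos hρ
      have hγ := M.γ_mem.1
      rw [iota]
      positivity
    have hi : ContinuousAt (fun δ => M.iota (ξ - δ)) 0 := by
      have : (1 - M.γ) ^ 2 * (ξ - 0) ^ 2 ≠ 0 := by rw [sub_zero]; positivity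
      unfold iota
      fun_prop (disch := assumption)
    have h4 : 4 * Real.sqrt (M.iota (ξ - 0)) ≠ 0 := by
      have := Real.sqrt_pos.2 hpos
      positivity
    unfold opgThreshold
    exact (ContinuousAt.div continuousAt_const
      (continuousAt_const.mul (Real.continuous_sqrt.continuousAt.comp hi)) h4).min continuousAt_const
  have he : ∀ᶠ δ in nhds 0, η < M.opgThreshold (ξ - δ) :=
    hc.eventually (lt_mem_nhds (by simpa using hη))
  obtain ⟨δ₁, hδ₁, h⟩ := Metric.eventually_nhds_iff.1 he
  refine ⟨δ₁ / 2, by positivity, fun δ hδ hδ' => (h ?_).le⟩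
  rw [Real.dist_eq, sub_zero, abs_of_pos hδ]
  linarith only [hδ', hδ₁]

/-! ### Elimination of suboptimal actions -/

lemma Q_gTight {π : S → A → ℝ} (hπ : π ∈ policies S A) (δ : ℝ) (s : S) (a : A) :
    M.Q (M.gTight δ) π s a = M.Q M.g π s a - δ := by
  have h := M.Q_add_smul hπ M.g (fun _ _ => 1) (-((1 - M.γ) * δ)) s a
  have h1 : M.Q (fun _ _ => 1) π s a = 1 / (1 - M.γ) := by
    rw [Q, M.discountedSum_eq hπ (dirac_mem s a), ← Finset.sum_mul, M.sum_occ hπ (dirac_mem s a),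
      mul_one]
  have e : M.gTight δ = fun s a => M.g s a + -((1 - M.γ) * δ) * 1 := by
    funext s a; simp only [gTight]; ring
  rw [e, h, h1]
  have := M.one_sub_γ_pos.ne'
  field_simp
  ring

lemma adv_lagr {π : S → A → ℝ} (hπ : π ∈ policies S A) (h : S → A → ℝ) (k : ℝ) (s : S) (a : A) :
    M.adv (M.lagr h k) π s a = M.adv M.r π s a + k * M.adv h π s a := by
  simp only [adv, vf, M.Q_lagr hπ, mul_add, Finset.sum_add_distrib, mul_sub, Finset.mul_sum,
    mul_left_comm k]
  ring

/-- Tightening shifts all values of the constraint by the same constant, so advantages do not see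
it. -/
lemma adv_lagr_gTight {π : S → A → ℝ} (hπ : π ∈ policies S A) (δ k : ℝ) (s : S) (a : A) :
    M.adv (M.lagr (M.gTight δ) k) π s a = M.adv (M.lagr M.g k) π s a := by
  rw [M.adv_lagr hπ, M.adv_lagr hπ]
  congr 2
  simp only [adv, vf, M.Q_gTight hπ, mul_sub, Finset.sum_sub_distrib, ← Finset.sum_mul, (hπ s).2]
  ring

lemma sum_mul_adv {π : S → A → ℝ} (hπ : π ∈ policies S A) (c : S → A → ℝ) (s : S) :
    ∑ a, π s a * M.adv c π s a = 0 := by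
  simp only [adv, mul_sub, Finset.sum_sub_distrib, ← Finset.sum_mul, (hπ s).2, one_mul]
  exact sub_self _

/-- Optimal policies have the same action values. -/
lemma Q_eq_of_optimal (hρ : ∀ s, 0 < M.ρ s) {π π' : S → A → ℝ} (hπ : π ∈ policies S A)
    (hπ' : π' ∈ policies S A) {c : S → A → ℝ} (hadv : ∀ s a, 0 ≤ M.adv c π s a)
    (h : M.V c π' = M.V c π) (s : S) (a : A) : M.Q c π' s a = M.Q c π s a := by
  have h0 := M.mul_adv_eq_zero hρ hπ hπ' hadv h
  have h1 : ∀ s, |∑ a, (π' s a - π s a) * M.Q c π s a| ≤ 0 := fun s => by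
    have e : ∑ a, (π' s a - π s a) * M.Q c π s a
        = (∑ a, π' s a - ∑ a, π s a) * M.vf c π s
          - (∑ a, π' s a * M.adv c π s a - ∑ a, π s a * M.adv c π s a) := by
      rw [← Finset.sum_sub_distrib, ← Finset.sum_sub_distrib, Finset.sum_mul,
        ← Finset.sum_sub_distrib]
      exact Finset.sum_congr rfl fun a _ => by rw [adv]; ring
    rw [e, M.sum_mul_adv hπ, (hπ s).2, (hπ' s).2, Finset.sum_eq_zero fun a _ => h0 s a]
    simp
  have h2 := M.abs_Q_sub_le hπ hπ' c h1 s a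
  rw [mul_zero] at h2
  exact sub_eq_zero.1 (abs_eq_zero.1 (le_antisymm h2 (abs_nonneg _)))

/-- Actions kept by a short projected step are nearly optimal. -/
lemma adv_le_of_projStep {π₀ : S → A → ℝ} (hπ₀ : π₀ ∈ policies S A) {c : S → A → ℝ} {η : ℝ}
    (hη : 0 < η) {D q p : S → A → ℝ} (hstep : ProjStep η D q p) {e E : ℝ}
    (he : ∀ s a, |p s a - q s a| ≤ e) (hE : ∀ s a, |D s a - M.Q c π₀ s a| ≤ E) {s : S} {a : A}
    (hpos : 0 < p s a) : M.adv c π₀ s a ≤ 2 * E + Fintype.card A * e / η := by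
  classical
  have hsum : ∀ f : A → ℝ, ∑ i, (π₀ s i - (Pi.single a 1 : A → ℝ) i) * f i
      = ∑ i, π₀ s i * f i - f a := fun f => by
    simp [sub_mul, Finset.sum_sub_distrib, Pi.single_apply]
  -- The test point moves the whole mass of the action `a` to the distribution `π₀`. Dividing the
  -- variational inequality by `p s a > 0` compares the action value at `a` with the average under
  -- `π₀`, whatever the size of that mass.
  have hx : (fun i => p s i + p s a * (π₀ s i - (Pi.single a 1 : A → ℝ) i)) ∈ stdSimplex ℝ A := by
    refine ⟨fun i => ?_, ?_⟩
    · have h1 := mul_nonneg hpos.le ((hπ₀ s).1 i)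
      have h2 := (hstep s).1.1 i
      rcases eq_or_ne i a with rfl | h
      · simp only [Pi.single_eq_same]; linarith only [h1]
      · simp only [Pi.single_eq_of_ne h]; linarith only [h1, h2]
    · have := hsum fun _ => 1
      simp only [mul_one, (hπ₀ s).2, sub_self] at this
      rw [Finset.sum_add_distrib, ← Finset.mul_sum, this, (hstep s).1.2]
      ring
  have h1 := proj_foc (convex_stdSimplex ℝ A) hη (hstep s).1 (hstep s).2 hx
  simp only [add_sub_cancel_left] at h1
  have e1 : ∑ i, p s a * (π₀ s i - (Pi.single a 1 : A → ℝ) i) * D s i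
      = p s a * (∑ i, π₀ s i * D s i - D s a) := by
    rw [← hsum, Finset.mul_sum]
    exact Finset.sum_congr rfl fun i _ => by ring
  have e2 : ∑ i, (p s i - q s i) * (p s a * (π₀ s i - (Pi.single a 1 : A → ℝ) i))
      = p s a * (∑ i, (p s i - q s i) * (π₀ s i - (Pi.single a 1 : A → ℝ) i)) := by
    rw [Finset.mul_sum]
    exact Finset.sum_congr rfl fun i _ => by ring
  rw [e1, e2, mul_left_comm] at h1
  have h2 := le_of_mul_le_mul_left h1 hpos
  have h3 : ∑ i, (p s i - q s i) * (π₀ s i - (Pi.single a 1 : A → ℝ) i) ≤ Fintype.card A * e := by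
    calc _ ≤ ∑ _i : A, e := Finset.sum_le_sum fun i _ => by
          refine (le_abs_self _).trans ?_
          rw [abs_mul]
          refine (mul_le_of_le_one_right (abs_nonneg _) ?_).trans (he s i)
          have h4 := (hπ₀ s).1 i
          have h5 := coord_le_one (hπ₀ s) i
          rcases eq_or_ne i a with rfl | h
          · rw [Pi.single_eq_same, abs_le]; constructor <;> linarith only [h4, h5]
          · rw [Pi.single_eq_of_ne h, sub_zero, abs_of_nonneg h4]; exact h5
      _ = _ := by rw [Finset.sum_const, Finset.card_univ, nsmul_eq_mul]
  have h6 : ∑ i, π₀ s i * D s i - D s a ≤ Fintype.card A * e / η := by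
    rw [le_div_iff₀ hη, mul_comm]
    exact h2.trans h3
  have h7 : M.vf c π₀ s - E ≤ ∑ i, π₀ s i * D s i := by
    have : ∑ i, π₀ s i * (M.Q c π₀ s i - E) ≤ ∑ i, π₀ s i * D s i :=
      Finset.sum_le_sum fun i _ => mul_le_mul_of_nonneg_left
        (by linarith only [(abs_le.1 (hE s i)).1]) ((hπ₀ s).1 i)
    simp only [mul_sub, Finset.sum_sub_distrib, ← Finset.sum_mul, (hπ₀ s).2, one_mul] at this
    exact this
  rw [adv]
  linarith only [h6, h7, (abs_le.1 (hE s a)).2]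

lemma V_eq_of_support {π₀ π : S → A → ℝ} (hπ₀ : π₀ ∈ policies S A) (hπ : π ∈ policies S A)
    {c : S → A → ℝ} (h : ∀ s a, 0 < π s a → M.adv c π₀ s a = 0) : M.V c π = M.V c π₀ := by
  have h1 := M.V_sub_eq_adv hπ₀ hπ c
  rw [Finset.sum_eq_zero, sub_eq_zero] at h1
  · exact h1.symm
  · intro s _
    rw [Finset.sum_eq_zero, mul_zero]
    intro a _
    rcases ((hπ s).1 a).eq_or_lt with h0 | h0
    · rw [← h0, zero_mul]
    · rw [h s a h0, mul_zero]

end CMDP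

/-! ### OPG-PD with a unique dual solution -/

namespace CMDP

variable {S : Type uS} {A : Type uA} [Fintype S] [Fintype A] (M : CMDP S A)

lemma mem_Λ_of_le {ξ δ x : ℝ} (hδ : 0 < δ) (hδξ : δ ≤ ξ / 2) (hξ : 0 < ξ) (h0 : 0 ≤ x)
    (h1 : x ≤ 1 / ((1 - M.γ) * ξ)) : x ∈ M.Λ (ξ - δ) := by
  have hg := M.one_sub_γ_pos
  refine ⟨h0, h1.trans (one_div_le_one_div_of_le (mul_pos hg (by linarith only [hδξ, hξ])) ?_)⟩
  exact mul_le_mul_of_nonneg_left (by linarith only [hδ]) hg.le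

lemma IsDualInterval.weak_duality {M : CMDP S A} {ξ D s₁ s₂ : ℝ} (hD : M.IsDualInterval ξ D s₁ s₂)
    {πstar : S → A → ℝ} (h : M.IsOptimal πstar) : M.V M.r πstar ≤ D := by
  have h1 := hD.bound_left πstar h.1
  have h2 := mul_nonneg hD.nonneg h.2.1
  linarith only [h1, h2]

/-- Zero violation of OPG-PD when the dual problem has a unique solution. -/
theorem opgZeroViolation_of_unique {ξ η D s : ℝ} (hξ : 0 < ξ)
    (hslater : ∃ πbar ∈ policies S A, ξ ≤ M.V M.g πbar) (hρ : ∀ s, 0 < M.ρ s) (hη0 : 0 < η)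
    (hη : η < M.opgThreshold ξ) (hD : M.IsDualInterval ξ D s s) : M.OPGZeroViolation ξ η := by
  have hg := M.one_sub_γ_pos
  have hs0 := hD.nonneg
  obtain ⟨δ₁, hδ₁, hthr⟩ := M.exists_threshold_margin hρ hξ hη
  obtain ⟨C, -, δ₀, hδ₀, hδ₀ξ, herr⟩ := M.exists_error_bound_unique hξ hslater hρ hD
  obtain ⟨K, hK, θ, hθ0, hθ1, hconv⟩ := M.exists_linear_convergence (C := C) hρ hη0
    (by positivity : 0 ≤ 2 / ((1 - M.γ) * ξ))
  obtain ⟨Lip, hLip⟩ : ∃ Lip : ℝ, Lip = Fintype.card A / (1 - M.γ) ^ 2 := ⟨_, rfl⟩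
  have hLip0 : 0 ≤ Lip := by rw [hLip]; positivity
  -- The accuracy is tuned so that `K θ ^ T ≤ e²` with `e = δ / (Lip + 1)`. The shift by one is
  -- there because the convergence bound concerns the hatted iterate at time `T + 1`.
  obtain ⟨C', hC', htime⟩ := exists_time_constant hθ0 hθ1
    (by positivity : 0 < 1 / ((s + 1) * ((Lip + 1) * (K + 1)))) 1
  refine ⟨C', hC', min (1 / 3) (min δ₀ δ₁), by positivity, fun ε hε hεbar => ?_⟩
  have hε3 : 3 * ε ≤ 1 := by linarith only [(lt_min_iff.1 hεbar).1]
  have hεδ₀ := (lt_min_iff.1 (lt_min_iff.1 hεbar).2).1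
  have hεδ₁ := (lt_min_iff.1 (lt_min_iff.1 hεbar).2).2
  -- Tightening lowers the optimal reward by `s δ`, and the iteration error takes at most another
  -- `δ`.
  obtain ⟨δ, hδ⟩ : ∃ δ, δ = ε / (s + 1) := ⟨_, rfl⟩
  have hδ0 : 0 < δ := by rw [hδ]; positivity
  have hδε : δ ≤ ε := by rw [hδ]; exact div_le_self hε.le (by linarith only [hs0])
  have hδξ : δ ≤ ξ / 2 := by linarith only [hδε, hεδ₀, hδ₀ξ]
  have hδs : (s + 1) * δ = ε := by rw [hδ]; field_simp
  refine ⟨δ, hδ0, by linarith only [hδξ, hξ], hthr δ hδ0 (by linarith only [hδε, hεδ₁]), ?_⟩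
  intro π πh lam lamh H t ht
  obtain ⟨T, rfl, hT⟩ := htime ε hε hε3 t ht
  have hh := M.abs_gTight_le hδ0.le (by linarith only [hδξ, hξ]) hslater
  -- These are exact saddle points of the tightened problem, so the defect is zero. For `s = 0` the
  -- constraint may be slack.
  have hZ : M.IsTarget (M.gTight δ) (ξ - δ) {z | z.1 ∈ policies S A ∧
      M.V M.r z.1 + s * M.V M.g z.1 = D ∧ (M.V M.g z.1 = δ ∨ s = 0 ∧ δ ≤ M.V M.g z.1) ∧ z.2 = s}
      0 C := by
    refine ⟨fun z hz => ⟨hz.1, ?_⟩, ?_, ?_⟩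
    · rw [hz.2.2.2]
      exact M.mem_Λ_of_le hδ0 hδξ hξ hs0 hD.le_length
    · rintro z ⟨hz1, hz2, hz3, hz4⟩ π hπ lam hlam
      rw [hz4, M.V_gTight hπ, M.V_gTight hz1, zero_mul]
      have f1 := hD.bound_left π hπ
      rcases hz3 with h | ⟨rfl, h⟩
      · rw [h] at hz2 ⊢
        linarith only [f1, hz2]
      · have f2 := mul_nonneg hlam.1 (sub_nonneg.2 h)
        linarith only [f1, hz2, f2]
    · intro π hπ lam hlam G hG
      obtain ⟨πo, h1, h2, h3, h4, h5⟩ := herr δ hδ0 (by linarith only [hδε, hεδ₀]) π hπ lam hlam G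
        fun π' hπ' lam' hlam' => by
          have := hG π' hπ' lam' hlam'
          rwa [M.V_gTight hπ, M.V_gTight hπ'] at this
      exact ⟨(πo, s), ⟨h1, h2, h3, rfl⟩, by simpa using h4, by simpa using h5⟩
  obtain ⟨z, ⟨hz1, hz2, hz3, -⟩, hd, -⟩ := hconv (M.gTight δ) (ξ - δ) _ 0 π πh lam lamh hh
    (M.dual_length_le hξ hδξ) (hthr δ hδ0 (by linarith only [hδε, hεδ₁])) hZ H T
  obtain ⟨e, he⟩ : ∃ e, e = δ / (Lip + 1) := ⟨_, rfl⟩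
  have he0 : 0 ≤ e := by rw [he]; positivity
  have hLe : (Lip + 1) * e = δ := by rw [he]; field_simp
  have hKe : K * (θ ^ T + 0 ^ 2) ≤ e ^ 2 := by
    have f1 := mul_le_mul_of_nonneg_left (hT T le_rfl) hK.le
    have e1 : K * (1 / ((s + 1) * ((Lip + 1) * (K + 1))) * ε) ^ 2 = K / (K + 1) ^ 2 * e ^ 2 := by
      rw [he, hδ]; field_simp
    have f2 : K / (K + 1) ^ 2 ≤ 1 := by
      rw [div_le_one (by positivity)]
      linarith only [hK, sq_nonneg K]
    rw [e1] at f1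
    have f3 := mul_le_of_le_one_left (sq_nonneg e) f2
    linarith only [f1, f3]
  have hent : ∀ s a, |πh (T + 1) s a - z.1 s a| ≤ e := fun s a =>
    abs_le_of_sq_le_sq ((sq_entry_le_distSq _ _ _ _ s a).trans (hd.trans hKe)) he0
  have hVg := M.abs_V_sub_le_of_entries hz1 (H.mem_πh (T + 1)) (M.abs_g_le hξ hslater) hent
  have hVr := M.abs_V_sub_le_of_entries hz1 (H.mem_πh (T + 1)) M.abs_r_le hent
  rw [← hLip] at hVg hVr
  have hVg' := abs_le.1 hVg
  have hVr' := abs_le.1 hVr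
  refine ⟨fun πstar hstar => ?_, ?_⟩
  · have f1 := hD.weak_duality hstar
    have f2 : D - s * δ ≤ M.V M.r z.1 := by
      rcases hz3 with h | ⟨rfl, h⟩
      · rw [h] at hz2; linarith only [hz2]
      · linarith only [hz2]
    linarith only [f1, f2, hVr'.1, hLe, hδs, he0]
  · have f1 : δ ≤ M.V M.g z.1 := by
      rcases hz3 with h | ⟨-, h⟩
      exacts [h.ge, h]
    linarith only [f1, hVg'.1, hLe, he0]

end CMDP

/-! ### OPG-PD with an interval of dual solutions -/

namespace CMDP

variable {S : Type uS} {A : Type uA} [Fintype S] [Fintype A] (M : CMDP S A)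

/-- Close to a saddle point the iterates only use actions which are optimal at an endpoint of the
dual interval, unless the dual variable is close to the other endpoint. -/
lemma exists_elimination_constant {ξ η D s₁ s₂ R : ℝ} (hξ : 0 < ξ)
    (hslater : ∃ πbar ∈ policies S A, ξ ≤ M.V M.g πbar) (hρ : ∀ s, 0 < M.ρ s) (hη : 0 < η)
    (hD : M.IsDualInterval ξ D s₁ s₂) (hlt : s₁ < s₂) (hR : 0 ≤ R) :
    ∃ K > 0, ∀ δ, 0 < δ → δ ≤ ξ / 2 → ∀ (π πh : ℕ → S → A → ℝ) (lam lamh : ℕ → ℝ),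
      M.IsOPG (M.gTight δ) (ξ - δ) η π πh lam lamh → ∀ u, ∀ πo ∈ policies S A, ∀ lamo ∈ Set.Icc s₁ s₂,
      M.V M.r πo = D → M.V M.g πo = 0 → (∀ s a, |πh u s a - πo s a| ≤ R * δ) →
      |lamh u - lamo| ≤ R * δ → (∀ s a, |π u s a - πh u s a| ≤ R * δ) → |lam u - lamh u| ≤ R * δ →
      (∀ s a, |πh (u + 1) s a - π u s a| ≤ R * δ) →
      (∀ s a, |π (u + 1) s a - πh (u + 1) s a| ≤ R * δ) →
      (K * δ ≤ lamo - s₁ → 0 ≤ M.V M.g (πh (u + 1))) ∧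
        (K * δ ≤ s₂ - lamo → M.V M.g (π (u + 1)) ≤ 0) := by
  have hg := M.one_sub_γ_pos
  have hs0 := hD.nonneg
  obtain ⟨π₀, hπ₀, h0D, h0g⟩ := hD.exists_mid hlt
  have hd0 : 0 < s₂ - s₁ := sub_pos.2 hlt
  have hbound : ∀ x ∈ Set.Icc s₁ s₂, ∀ π ∈ policies S A, M.V M.r π + x * M.V M.g π ≤ D := by
    intro x hx π hπ
    have f1 := mul_le_mul_of_nonneg_left (hD.bound_left π hπ) (sub_nonneg.2 hx.2)
    have f2 := mul_le_mul_of_nonneg_left (hD.bound_right π hπ) (sub_nonneg.2 hx.1)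
    refine le_of_mul_le_mul_left (?_ : (s₂ - s₁) * _ ≤ (s₂ - s₁) * _) hd0
    linarith only [f1, f2]
  have hV₀ : ∀ x, M.V (M.lagr M.g x) π₀ = D := fun x => by
    rw [M.V_lagr hπ₀, h0D, h0g, mul_zero, add_zero]
  have hadv : ∀ x ∈ Set.Icc s₁ s₂, ∀ s a, 0 ≤ M.adv (M.lagr M.g x) π₀ s a := fun x hx =>
    M.adv_nonneg hρ hπ₀ fun π' hπ' => by
      rw [hV₀, M.V_lagr hπ']; exact hbound x hx π' hπ'
  have hs₁ : s₁ ∈ Set.Icc s₁ s₂ := ⟨le_rfl, hlt.le⟩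
  have hs₂ : s₂ ∈ Set.Icc s₁ s₂ := ⟨hlt.le, le_rfl⟩
  obtain ⟨k₁, hk₁, hk₁adv⟩ := exists_pos_le_of_finite fun x : S × A => hadv s₁ hs₁ x.1 x.2
  obtain ⟨k₂, hk₂, hk₂adv⟩ := exists_pos_le_of_finite fun x : S × A => hadv s₂ hs₂ x.1 x.2
  obtain ⟨k, hk0, hkk₁, hkk₂⟩ : ∃ k, 0 < k ∧ k ≤ k₁ ∧ k ≤ k₂ :=
    ⟨min k₁ k₂, lt_min hk₁ hk₂, min_le_left _ _, min_le_right _ _⟩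
  obtain ⟨CQ, hCQ⟩ : ∃ C : ℝ, C = Fintype.card A * (1 + 2 / ((1 - M.γ) * ξ)) / (1 - M.γ) ^ 2
    + 1 / (1 - M.γ) := ⟨_, rfl⟩
  have hCQ0 : 0 ≤ CQ := by rw [hCQ]; positivity
  obtain ⟨K', hK'⟩ : ∃ K' : ℝ, K' = 2 * (CQ * (2 * R)) + Fintype.card A * (2 * R) / η := ⟨_, rfl⟩
  have hK'0 : 0 ≤ K' := by rw [hK']; positivity
  refine ⟨(K' + 1) * (s₂ - s₁) / k, by positivity, ?_⟩
  intro δ hδ0 hδξ π πh lam lamh H u πo hπo lamo hlamo hoD hog h1 h2 h3 h4 h5 h6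
  have hh := M.abs_gTight_le hδ0.le (by linarith only [hδξ, hξ]) hslater
  have hRδ : 0 ≤ R * δ := by positivity
  have e1 : ∀ s a, |π u s a - πo s a| ≤ 2 * R * δ := fun s a => by
    have := abs_add_le (π u s a - πh u s a) (πh u s a - πo s a)
    rw [sub_add_sub_cancel] at this
    linarith only [this, h1 s a, h3 s a]
  have e2 : |lam u - lamo| ≤ 2 * R * δ := by
    have := abs_add_le (lam u - lamh u) (lamh u - lamo)
    rw [sub_add_sub_cancel] at this
    linarith only [this, h2, h4]
  have e3 : ∀ s a, |πh (u + 1) s a - πh u s a| ≤ 2 * R * δ := fun s a => by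
    have := abs_add_le (πh (u + 1) s a - π u s a) (π u s a - πh u s a)
    rw [sub_add_sub_cancel] at this
    linarith only [this, h3 s a, h5 s a]
  have hlam : |lam u| ≤ 2 / ((1 - M.γ) * ξ) := by
    have := H.mem_lam u
    rw [abs_of_nonneg this.1]
    exact this.2.trans (M.dual_length_le hξ hδξ)
  have hQ : ∀ s a, |M.Q (M.lagr (M.gTight δ) (lam u)) (π u) s a
      - M.Q (M.lagr (M.gTight δ) lamo) π₀ s a| ≤ CQ * (2 * R * δ) := fun s a => by
    have f1 := M.abs_Q_lagr_sub_le hh (H.mem_π u) hπo hlam e1 e2 s a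
    rw [← hCQ] at f1
    rwa [M.Q_eq_of_optimal hρ hπ₀ hπo (fun s a => by
      rw [M.adv_lagr_gTight hπ₀]; exact hadv lamo hlamo s a) (by
      rw [M.V_lagr hπo, M.V_lagr hπ₀, M.V_gTight hπo, M.V_gTight hπ₀, hoD, hog, h0D, h0g])] at f1
  have hle : ∀ (p q : S → A → ℝ), ProjStep η (M.Q (M.lagr (M.gTight δ) (lam u)) (π u)) q p →
      (∀ s a, |p s a - q s a| ≤ 2 * R * δ) → ∀ s a, 0 < p s a →
      M.adv (M.lagr M.g lamo) π₀ s a ≤ K' * δ := by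
    intro p q hpq he s a hpos
    have f1 := M.adv_le_of_projStep hπ₀ hη hpq he hQ hpos
    rw [M.adv_lagr_gTight hπ₀] at f1
    refine f1.trans (le_of_eq ?_)
    rw [hK']; ring
  -- The advantage is affine in the multiplier: at `lamo` it is a convex combination of the
  -- nonnegative advantages at both ends. An action of small loss at `lamo` thus has zero loss at
  -- each end whose weight is not small, because positive losses are at least `k`.
  have hcomb : ∀ s a, (s₂ - s₁) * M.adv (M.lagr M.g lamo) π₀ s a
      = (s₂ - lamo) * M.adv (M.lagr M.g s₁) π₀ s a + (lamo - s₁) * M.adv (M.lagr M.g s₂) π₀ s a := by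
    intro s a
    rw [M.adv_lagr hπ₀, M.adv_lagr hπ₀, M.adv_lagr hπ₀]
    ring
  have hKk : (K' + 1) * (s₂ - s₁) / k * δ * k = (K' + 1) * (s₂ - s₁) * δ := by field_simp
  have hpos' : 0 < (s₂ - s₁) * δ := mul_pos hd0 hδ0
  constructor
  · intro hK
    have hp := H.mem_πh (u + 1)
    -- Every action in use is optimal at `s₂`, so the Lagrangian there equals `D`. Since it is at
    -- most `D` at `s₁`, the constraint value is nonnegative; the other half is symmetric.
    have hV : M.V (M.lagr M.g s₂) (πh (u + 1)) = M.V (M.lagr M.g s₂) π₀ := by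
      refine M.V_eq_of_support hπ₀ hp fun s a hpa => (hk₂adv (s, a)).resolve_right fun hk' => ?_
      have f1 := mul_le_mul_of_nonneg_left (hle _ _ (H.step_πh u) e3 s a hpa) hd0.le
      have f2 := mul_nonneg (sub_nonneg.2 hlamo.2) (hadv s₁ hs₁ s a)
      have f3 := mul_le_mul hK (hkk₂.trans hk') hk0.le (sub_nonneg.2 hlamo.1)
      rw [hcomb] at f1
      rw [hKk] at f3
      simp only at f3
      linarith only [f1, f2, f3, hpos']
    rw [hV₀, M.V_lagr hp] at hV
    have f1 := hD.bound_left _ hp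
    refine nonneg_of_mul_nonneg_right (?_ : 0 ≤ (s₂ - s₁) * _) hd0
    linarith only [f1, hV]
  · intro hK
    have hp := H.mem_π (u + 1)
    have hV : M.V (M.lagr M.g s₁) (π (u + 1)) = M.V (M.lagr M.g s₁) π₀ := by
      refine M.V_eq_of_support hπ₀ hp fun s a hpa => (hk₁adv (s, a)).resolve_right fun hk' => ?_
      have f1 := mul_le_mul_of_nonneg_left (hle _ _ (H.step_π u) (fun s a => by
        linarith only [h6 s a, hRδ]) s a hpa) hd0.le
      have f2 := mul_nonneg (sub_nonneg.2 hlamo.1) (hadv s₂ hs₂ s a)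
      have f3 := mul_le_mul hK (hkk₁.trans hk') hk0.le (sub_nonneg.2 hlamo.2)
      rw [hcomb] at f1
      rw [hKk] at f3
      simp only at f3
      linarith only [f1, f2, f3, hpos']
    rw [hV₀, M.V_lagr hp] at hV
    have f1 := hD.bound_right _ hp
    have f2 : 0 ≤ (s₂ - s₁) * -M.V M.g (π (u + 1)) := by linarith only [f1, hV]
    linarith only [nonneg_of_mul_nonneg_right f2 hd0]

/-- The dual variable increases while the constraint value is small. -/
lemma IsOPG.dual_increase {M : CMDP S A} {h : S → A → ℝ} {ξ η : ℝ} {π πh : ℕ → S → A → ℝ}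
    {lam lamh : ℕ → ℝ} (H : M.IsOPG h ξ η π πh lam lamh) (hη : 0 < η) {u : ℕ} {m k : ℝ}
    (hm : m ∈ M.Λ ξ) (hk : η * M.V h (π u) ≤ -k) : min (lamh u + k) m ≤ lamh (u + 1) := by
  by_contra hcon
  push Not at hcon
  obtain ⟨h1, h2⟩ := lt_min_iff.1 hcon
  have h3 := prox_real_foc hη (H.step_lamh u).1 (H.step_lamh u).2 hm
  have h4 := mul_neg_of_neg_of_pos (by linarith only [h1, hk] :
    η * M.V h (π u) + (lamh (u + 1) - lamh u) < 0) (sub_pos.2 h2)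
  linarith only [h3, h4]

/-- Zero violation of OPG-PD when the dual problem has an interval of solutions. -/
theorem opgZeroViolation_of_interval {ξ η D s₁ s₂ : ℝ} (hξ : 0 < ξ)
    (hslater : ∃ πbar ∈ policies S A, ξ ≤ M.V M.g πbar) (hρ : ∀ s, 0 < M.ρ s) (hη0 : 0 < η)
    (hη : η < M.opgThreshold ξ) (hD : M.IsDualInterval ξ D s₁ s₂) (hlt : s₁ < s₂) :
    M.OPGZeroViolation ξ η := by
  have hg := M.one_sub_γ_pos
  have hs0 := hD.nonneg
  obtain ⟨δ₁, hδ₁, hthr⟩ := M.exists_threshold_margin hρ hξ hη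
  obtain ⟨C, -, herr⟩ := M.exists_error_bound_interval hξ hρ hD hlt
  obtain ⟨K, hK, θ, hθ0, hθ1, hconv⟩ := M.exists_linear_convergence (C := C) hρ hη0
    (by positivity : 0 ≤ 2 / ((1 - M.γ) * ξ))
  obtain ⟨Lip, hLip⟩ : ∃ Lip : ℝ, Lip = Fintype.card A / (1 - M.γ) ^ 2 := ⟨_, rfl⟩
  have hLip0 : 0 ≤ Lip := by rw [hLip]; positivity
  obtain ⟨R, hR⟩ : ∃ R, R = 2 * K + 1 := ⟨_, rfl⟩
  have hR0 : 0 < R := by rw [hR]; positivity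
  obtain ⟨K₃, hK₃, helim⟩ := M.exists_elimination_constant hξ hslater hρ hη0 hD hlt hR0.le
  -- Enough increments `η δ` to lift the multiplier from `s₁ - R δ` to `s₁ + (K₃ + R) δ`; the number
  -- does not depend on `ε`.
  obtain ⟨N, hN⟩ := exists_nat_ge ((K₃ + 2 * R) / η)
  rw [div_le_iff₀ hη0] at hN
  -- The margin is `δ = c ε`, so that the reward error `Lip * R * δ` is at most `ε`.
  obtain ⟨c, hc⟩ : ∃ c, c = 1 / (Lip * R + 1) := ⟨_, rfl⟩
  have hc0 : 0 < c := by rw [hc]; positivity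
  have hc1 : c ≤ 1 := by
    rw [hc, div_le_one (by positivity)]
    linarith only [mul_nonneg hLip0 hR0.le]
  have hcL : Lip * R * c ≤ 1 := by
    rw [hc, mul_one_div, div_le_one (by positivity)]
    linarith only
  obtain ⟨C', hC', htime⟩ := exists_time_constant hθ0 hθ1 hc0 (N + 3)
  refine ⟨C', hC', min (1 / 3) (min (ξ / 2) (min δ₁ ((s₂ - s₁) / (2 * K₃ + 7 * R)))), ?_, ?_⟩
  · have := sub_pos.2 hlt
    positivity
  intro ε hε hεbar
  obtain ⟨hε1, hε2⟩ := lt_min_iff.1 hεbar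
  obtain ⟨hε2, hε4⟩ := lt_min_iff.1 hε2
  obtain ⟨hε4, hε5⟩ := lt_min_iff.1 hε4
  rw [lt_div_iff₀ (by positivity)] at hε5
  obtain ⟨δ, hδ⟩ : ∃ δ, δ = c * ε := ⟨_, rfl⟩
  have hδ0 : 0 < δ := by rw [hδ]; positivity
  have hδε : δ ≤ ε := by rw [hδ]; exact mul_le_of_le_one_left hε.le hc1
  have hδξ : δ ≤ ξ / 2 := by linarith only [hδε, hε2]
  have hδs : (2 * K₃ + 7 * R) * δ < s₂ - s₁ := by
    have := mul_le_mul_of_nonneg_left hδε (by positivity : 0 ≤ 2 * K₃ + 7 * R)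
    linarith only [this, hε5]
  have hδη : η ≤ M.opgThreshold (ξ - δ) := hthr δ hδ0 (by linarith only [hδε, hε4])
  refine ⟨δ, hδ0, by linarith only [hδξ, hξ], hδη, ?_⟩
  intro π πh lam lamh H t ht
  obtain ⟨T, rfl, hT⟩ := htime ε hε (by linarith only [hε1]) t ht
  have hh := M.abs_gTight_le hδ0.le (by linarith only [hδξ, hξ]) hslater
  have hd0 : 0 < s₂ - s₁ := sub_pos.2 hlt
  -- Saddle points of the untightened problem; for the tightened one the saddle inequality fails by
  -- at most `δ` times the dual distance, so the defect is `δ`.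
  have hZ : M.IsTarget (M.gTight δ) (ξ - δ) {z | z.1 ∈ policies S A ∧
      M.V M.r z.1 = D ∧ M.V M.g z.1 = 0 ∧ z.2 ∈ Set.Icc s₁ s₂} δ C := by
    refine ⟨fun z hz => ⟨hz.1, M.mem_Λ_of_le hδ0 hδξ hξ (hs0.trans hz.2.2.2.1)
      (hz.2.2.2.2.trans hD.le_length)⟩, ?_, ?_⟩
    · rintro z ⟨hz1, hz2, hz3, hz4⟩ π hπ lam hlam
      rw [M.V_gTight hπ, M.V_gTight hz1, hz2, hz3]
      have f0 : M.V M.r π + z.2 * M.V M.g π ≤ D := by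
        have f1 := mul_le_mul_of_nonneg_left (hD.bound_left π hπ) (sub_nonneg.2 hz4.2)
        have f2 := mul_le_mul_of_nonneg_left (hD.bound_right π hπ) (sub_nonneg.2 hz4.1)
        refine le_of_mul_le_mul_left (?_ : (s₂ - s₁) * _ ≤ (s₂ - s₁) * _) hd0
        linarith only [f1, f2]
      have f1 := mul_le_mul_of_nonneg_left (le_abs_self (lam - z.2)) hδ0.le
      linarith only [f0, f1]
    · intro π hπ lam hlam G hG
      obtain ⟨πo, h1, h2, h3, lamo, h4, h5, h6⟩ := herr δ hδ0 hδξ π hπ lam hlam G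
        fun π' hπ' lam' hlam' => by
          have := hG π' hπ' lam' hlam'
          rwa [M.V_gTight hπ, M.V_gTight hπ'] at this
      exact ⟨(πo, lamo), ⟨h1, h2, h3, h4⟩, h5, h6⟩
  have hsq : ∀ u, T ≤ u → K * (θ ^ u + δ ^ 2) ≤ (R * δ) ^ 2 := fun u hu => by
    have f1 := hT u hu
    rw [← hδ] at f1
    have f2 := mul_le_mul_of_nonneg_left f1 hK.le
    have f3 : 2 * K ≤ R ^ 2 := by rw [hR]; linarith only [sq_nonneg K, hK]
    have f4 := mul_le_mul_of_nonneg_right f3 (sq_nonneg δ)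
    rw [mul_pow]
    linarith only [f2, f4]
  have hRδ : 0 ≤ R * δ := by positivity
  have hnear : ∀ u, T + 1 ≤ u → ∃ πo ∈ policies S A, ∃ lamo ∈ Set.Icc s₁ s₂, M.V M.r πo = D ∧
      M.V M.g πo = 0 ∧ (∀ s a, |πh u s a - πo s a| ≤ R * δ) ∧ |lamh u - lamo| ≤ R * δ ∧
      (∀ s a, |π u s a - πh u s a| ≤ R * δ) ∧ |lam u - lamh u| ≤ R * δ ∧
      (∀ s a, |πh (u + 1) s a - π u s a| ≤ R * δ) ∧ |lamh (u + 1) - lam u| ≤ R * δ := by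
    intro u hu
    obtain ⟨u, rfl⟩ := Nat.exists_eq_add_of_le' ((Nat.le_add_left 1 T).trans hu)
    obtain ⟨z, ⟨hz1, hz2, hz3, hz4⟩, hd, hst⟩ := hconv (M.gTight δ) (ξ - δ) _ δ π πh lam lamh hh
      (M.dual_length_le hξ hδξ) hδη hZ H u
    have hR' := hsq u (by omega)
    have n1 := distSq_nonneg (π (u + 1)) (lam (u + 1)) (πh (u + 1)) (lamh (u + 1))
    have n2 := distSq_nonneg (πh (u + 2)) (lamh (u + 2)) (π (u + 1)) (lam (u + 1))
    rw [stepSq] at hst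
    have b0 := hd.trans hR'
    have b1 := ((le_add_of_nonneg_right n2).trans hst).trans hR'
    have b2 := ((le_add_of_nonneg_left n1).trans hst).trans hR'
    exact ⟨z.1, hz1, z.2, hz4, hz2, hz3,
      fun s a => abs_le_of_sq_le_sq ((sq_entry_le_distSq _ _ _ _ s a).trans b0) hRδ,
      abs_le_of_sq_le_sq ((sq_dual_le_distSq _ _ _ _).trans b0) hRδ,
      fun s a => abs_le_of_sq_le_sq ((sq_entry_le_distSq _ _ _ _ s a).trans b1) hRδ,
      abs_le_of_sq_le_sq ((sq_dual_le_distSq _ _ _ _).trans b1) hRδ,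
      fun s a => abs_le_of_sq_le_sq ((sq_entry_le_distSq _ _ _ _ s a).trans b2) hRδ,
      abs_le_of_sq_le_sq ((sq_dual_le_distSq _ _ _ _).trans b2) hRδ⟩
  have hs₂Λ : s₂ ∈ M.Λ (ξ - δ) := M.mem_Λ_of_le hδ0 hδξ hξ (hs0.trans hlt.le) hD.le_length
  -- Away from `s₂` the policy has nonpositive constraint value, hence tightened value at most `-δ`,
  -- and the dual step gains `η δ` or passes `s₂`.
  have hinc : ∀ n, min (lamh (T + 2 + n) + η * δ) (s₂ - (K₃ + 5 * R) * δ) ≤ lamh (T + 2 + (n + 1)) := by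
    intro n
    obtain ⟨πo, hπo, lamo, hlamo, hoD, hog, h1, h2, h3, h4, h5, h6⟩ := hnear (T + 1 + n) (by omega)
    obtain ⟨-, -, -, -, -, -, -, -, h3', h4', -, h6'⟩ := hnear (T + 1 + n + 1) (by omega)
    have he := (helim δ hδ0 hδξ π πh lam lamh H (T + 1 + n) πo hπo lamo hlamo hoD hog h1 h2 h3 h4 h5
      h3').2
    have i1 : T + 2 + n = T + 1 + n + 1 := by omega
    have i2 : T + 2 + (n + 1) = T + 1 + n + 1 + 1 := by omega
    rw [i1, i2]
    rcases le_total (K₃ * δ) (s₂ - lamo) with hc | hc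
    · have hV : η * M.V (M.gTight δ) (π (T + 1 + n + 1)) ≤ -(η * δ) := by
        rw [M.V_gTight (H.mem_π _)]
        have := mul_le_mul_of_nonneg_left (he hc) hη0.le
        linarith only [this]
      refine le_trans (min_le_min le_rfl ?_) (H.dual_increase hη0 hs₂Λ hV)
      have : 0 ≤ (K₃ + 5 * R) * δ := by positivity
      linarith only [this]
    -- Close to `s₂` nothing is gained, but five distances of at most `R δ` lead from `lamo` through
    -- the intermediate dual variables to the next one, so it stays near `s₂`.
    · refine (min_le_right _ _).trans ?_
      linarith only [hc, (abs_le.1 h2).1, (abs_le.1 h4).1, (abs_le.1 h6).1, (abs_le.1 h4').1,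
        (abs_le.1 h6').1]
  have hdual := le_of_increments (x := fun n => lamh (T + 2 + n)) (by positivity) hinc N
  simp only [add_zero] at hdual
  have hstart : s₁ - R * δ ≤ lamh (T + 2) := by
    obtain ⟨-, -, lamo, hlamo, -, -, -, h2, -⟩ := hnear (T + 2) (by omega)
    linarith only [hlamo.1, (abs_le.1 h2).1]
  -- Both entries of the minimum are large enough: the first by the choice of `N`, the second
  -- because `(2 K₃ + 7 R) δ` is below the length of the dual interval.
  have hlow : s₁ + (K₃ + R) * δ ≤ lamh (T + 2 + N) := by
    refine le_trans (le_min ?_ ?_) hdual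
    · have := mul_le_mul_of_nonneg_right hN hδ0.le
      linarith only [this, hstart]
    · have : 0 ≤ R * δ := hRδ
      linarith only [hδs, this]
  refine ⟨fun πstar hstar => ?_, ?_⟩
  · obtain ⟨πo, hπo, -, -, hoD, -, h1, -⟩ := hnear (T + (N + 3)) (by omega)
    have f1 := hD.weak_duality hstar
    have f2 := M.abs_V_sub_le_of_entries hπo (H.mem_πh (T + (N + 3))) M.abs_r_le h1
    rw [← hLip, hoD] at f2
    have f3 := mul_le_mul_of_nonneg_right hcL hε.le
    have e : Lip * (R * δ) = Lip * R * c * ε := by rw [hδ]; ring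
    rw [e] at f2
    linarith only [f1, f3, (abs_le.1 f2).1]
  · obtain ⟨πo, hπo, lamo, hlamo, hoD, hog, h1, h2, h3, h4, h5, h6⟩ := hnear (T + 2 + N) (by omega)
    obtain ⟨-, -, -, -, -, -, -, -, h3', -⟩ := hnear (T + 2 + N + 1) (by omega)
    have he := (helim δ hδ0 hδξ π πh lam lamh H (T + 2 + N) πo hπo lamo hlamo hoD hog h1 h2 h3 h4 h5
      h3').1
    have i1 : T + (N + 3) = T + 2 + N + 1 := by omega
    rw [i1]
    exact he (by linarith only [hlow, (abs_le.1 h2).2])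

/-- Zero violation of OPG-PD. -/
theorem opgZeroViolation {ξ η : ℝ} (hξ : 0 < ξ)
    (hslater : ∃ πbar ∈ policies S A, ξ ≤ M.V M.g πbar) (hρ : ∀ s, 0 < M.ρ s) (hη0 : 0 < η)
    (hη : η < M.opgThreshold ξ) : M.OPGZeroViolation ξ η := by
  obtain ⟨D, s₁, s₂, hD⟩ := M.exists_isDualInterval hξ hslater
  rcases hD.le.eq_or_lt with rfl | hlt
  · exact M.opgZeroViolation_of_unique hξ hslater hρ hη0 hη hD
  · exact M.opgZeroViolation_of_interval hξ hslater hρ hη0 hη hD hlt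

end CMDP

end

theorem mainTheorem8 {S : Type uS} {A : Type uA} [Fintype S] [Fintype A] (M : CMDP S A)
    (ξ : ℝ) (hξ : 0 < ξ) (hslater : ∃ πbar ∈ policies S A, ξ ≤ M.V M.g πbar) :
    -- RPG-PD
    ((∀ a₁ a₂ b₁ b₂ c : ℝ, 0 < a₁ → a₁ ≤ a₂ → 0 < b₁ → b₁ ≤ b₂ → 0 < c →
        ∃ K > 0, M.RPGZeroViolation ξ K a₁ a₂ b₁ b₂ c) ∧
      (∃ a > 0, ∃ b > 0, ∃ c > 0, M.RPGZeroViolation ξ 1 a a b b c)) ∧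
    -- inexact RPG-PD
    (∀ (d : ℕ) (φ : S → A → EuclideanSpace ℝ (Fin d)), (∀ s a, ‖φ s a‖ ≤ 1) →
      ∀ W : ℝ, 0 < W → ∀ ν ∈ stdSimplex ℝ (S × A), ∀ θ₀ : EuclideanSpace ℝ (Fin d),
        (∀ a₁ a₂ b₁ b₂ c : ℝ, 0 < a₁ → a₁ ≤ a₂ → 0 < b₁ → b₁ ≤ b₂ → 0 < c →
          ∃ K > 0, CMDP.InexactZeroViolation.{uS, uA, uΩ} M φ W ν θ₀ ξ K a₁ a₂ b₁ b₂ c) ∧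
        (∃ a > 0, ∃ b > 0, ∃ c > 0,
          CMDP.InexactZeroViolation.{uS, uA, uΩ} M φ W ν θ₀ ξ 1 a a b b c)) ∧
    -- OPG-PD
    ((∀ s, 0 < M.ρ s) →
      (∀ π π' : S → A → ℝ, M.IsOptimal π → M.IsOptimal π' → M.dρ π = M.dρ π') →
      ∀ η : ℝ, 0 < η → η < M.opgThreshold ξ → M.OPGZeroViolation ξ η) := by
  refine ⟨⟨fun a₁ a₂ b₁ b₂ c ha₁ ha hb₁ hb hc => M.exists_rpgZeroViolation hξ hslater ha₁ ha hb₁ hb hc,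
      ?_⟩, fun d φ hφ W hW ν hν θ₀ => ⟨fun a₁ a₂ b₁ b₂ c ha₁ ha hb₁ hb hc =>
        M.exists_inexactZeroViolation hξ hslater hφ hW hν θ₀ ha₁ ha hb₁ hb hc, ?_⟩, ?_⟩
  · obtain ⟨K, hK, h⟩ := M.exists_rpgZeroViolation hξ hslater one_pos le_rfl one_pos le_rfl one_pos
    exact ⟨1 / K ^ 4, by positivity, 1 / K ^ 2, by positivity, 1 / K, by positivity,
      M.rpgZeroViolation_one hK h⟩
  · obtain ⟨K, hK, h⟩ := M.exists_inexactZeroViolation hξ hslater hφ hW hν θ₀ one_pos le_rfl one_pos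
      le_rfl one_pos
    exact ⟨1 / K ^ 4, by positivity, 1 / K ^ 2, by positivity, 1 / K ^ 8, by positivity,
      M.inexactZeroViolation_one hK h⟩
  · intro hρ _ η hη0 hη
    exact M.opgZeroViolation hξ hslater hρ hη0 hη
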